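/- Let $G$ be a finite simple connected graph with $n$ vertices and $m$ edges such that no separator of $G$ consists only of vertices of degree $2$ (a separator is a vertex set $S$ for which $G-S$ is disconnected). For a tree $T$, let $L(T)$ be its set of leaves (vertices of degree $1$; the vertex of a one-vertex tree also counts as a leaf). Call a spanning tree $T$ of $G$ *good* if, for every collection $\mathcal C$ of pairwise vertex-disjoint cycles in the induced subgraph $G[L(T)]$, $$|L(T)|\ \ge\ \frac{n+3|\mathcal C|}{4}.$$ Then $G$ has a good spanning tree, and one can be found in linear time: there are a RAM program and a constant $c$ such that, for every such $G$ given by adjacency lists, the program halts after at most $c\,(n+m)$ steps and outputs (as parent pointers) a good spanning tree of $G$. Moreover, unless $G$ is a triangle, good trees are found by the following algorithm BRANCHING, and the tree output by the program is one that BRANCHING can produce. Let $\tilde G$ be obtained from $G$ by deleting all edges between two vertices of degree $2$. Start with the tree $T=\{r\}$ for an arbitrary vertex $r$. To *expand* a vertex $v$ of $T$ is to add all vertices of $N_{\tilde G}(v)\setminus V(T)$ to $T$ as children of $v$. Perform the following operations as long as one applies. - (O1) If $v\in V(T)$ has $|N_{\tilde G}(v)\setminus V(T)|\ge 2$, expand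 $v$. - (O2) If $v\in V(T)$ has $N_{\tilde G}(v)\setminus V(T)=\{x\}$, and $N_{\tilde G}(x)\subseteq V(T)$ or $|N_{\tilde G}(x)\cap V(T)|\ge 2$, expand $v$. - (O3) If $v\in V(T)$ has $N_{\tilde G}(v)\setminus V(T)=\{x\}$ and $|N_{\tilde G}(x)\setminus V(T)|\ge 2$, expand $v$ and then $x$. Operation O1 has precedence over O2 and O3. If O1 applies at several vertices, one that adds the largest number of vertices is chosen, and among these one that was added to $T$ last; if O1 does not apply, then among the vertices at which O2 or O3 applies one that was added to $T$ last is chosen; remaining ties (vertices added by the same expansion count as added simultaneously) are broken arbitrarily. For every root $r$ an execution of BRANCHING that runs to its end exists, and every such execution ends with a good spanning tree of $G$. -/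

import Mathlib

universe u

/-! ### Leaves, separators, disjoint cycles -/

section Graphs

variable {V : Type u}

/-- The degree of `v` in `G` (all graphs considered are finite). -/
noncomputable def deg (G : SimpleGraph V) (v : V) : ℕ := (G.neighborSet v).ncard

/-- The set `L(T)` of leaves of a tree `T`. A vertex of a tree with at least two vertices is a leaf
iff its degree is `1`; the only vertex of a one-vertex tree counts as a leaf. -/
def leaves (T : SimpleGraph V) : Set V := {v | deg T v ≤ 1}

/-- `S` is a separator of `G`: two vertices outside `S` are not connected in `G - S`. -/
def IsSeparator (G : SimpleGraph V) (S : Set V) : Prop := ¬ (G.induce Sᶜ).Preconnected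

/-- No separator of `G` consists of vertices of degree `2` only. -/
def NoTwoVertexSeparator (G : SimpleGraph V) : Prop :=
  ∀ S : Set V, (∀ v ∈ S, deg G v = 2) → ¬ IsSeparator G S

/-- `H` contains a collection of `k` pairwise vertex-disjoint cycles. -/
def HasDisjointCycles {W : Type u} (H : SimpleGraph W) (k : ℕ) : Prop :=
  ∃ (a : Fin k → W) (c : ∀ i, H.Walk (a i) (a i)),
    (∀ i, (c i).IsCycle) ∧ ∀ i j, i ≠ j → List.Disjoint (c i).support (c j).support

/-- `T` is a spanning tree of `G` such that `|L(T)| ≥ (n + 3|C|)/4` for every collection `C` of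
vertex-disjoint cycles in `G[L(T)]`. -/
def IsManyLeafTree [Fintype V] (G T : SimpleGraph V) : Prop :=
  T ≤ G ∧ T.IsTree ∧
    ∀ k : ℕ, HasDisjointCycles (G.induce (leaves T)) k →
      ((leaves T).ncard : ℝ) ≥ ((Fintype.card V : ℝ) + 3 * (k : ℝ)) / 4

/-- The graph obtained from `G` by deleting all edges whose two ends both have degree `2`. -/
def simplify (G : SimpleGraph V) : SimpleGraph V where
  Adj a b := G.Adj a b ∧ ¬ (deg G a = 2 ∧ deg G b = 2)
  symm := ⟨fun _ _ h => ⟨h.1.symm, fun h' => h.2 ⟨h'.2, h'.1⟩⟩⟩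
  loopless := ⟨fun _ h => h.1.ne rfl⟩

/-- `G` is a triangle. -/
def IsTriangle [Fintype V] (G : SimpleGraph V) : Prop := Fintype.card V = 3 ∧ G = ⊤

/-- The graph whose edges join each vertex `v` to `p v`, where `p v = v` gives no edge. -/
def parentGraph (p : V → V) : SimpleGraph V := SimpleGraph.fromRel (fun a b => p a = b)

end Graphs

/-! ### The algorithm BRANCHING -/

namespace Branching

variable {V : Type u}

/-- A rooted tree `T` under construction. -/
structure State (V : Type u) where
  /-- the vertex set of `T` -/
  verts : Set V
  /-- the parent of each vertex; the root and the vertices outside `T` are their own parents -/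
  parent : V → V
  /-- the time at which a vertex was added to `T` -/
  stamp : V → ℕ
  /-- the number of expansions made so far -/
  clock : ℕ

/-- The one-vertex tree with root `r`. -/
def init (r : V) : State V := ⟨{r}, id, fun _ => 0, 0⟩

/-- The set `N_G(v) \ V(T)`. -/
def outer (G : SimpleGraph V) (s : State V) (v : V) : Set V := G.neighborSet v \ s.verts

open Classical in
/-- Expand `v`: all vertices of `N_G(v) \ V(T)` are added to `T` as children of `v`. They are all
added at the same time. -/
noncomputable def expand (G : SimpleGraph V) (s : State V) (v : V) : State V where
  verts := s.verts ∪ outer G s v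
  parent w := if w ∈ outer G s v then v else s.parent w
  stamp w := if w ∈ outer G s v then s.clock + 1 else s.stamp w
  clock := s.clock + 1

/-- Operation O1 applies at `v`. (In O1, O2 and O3, `v` is automatically a leaf of `T`: a vertex
that was expanded has no neighbours outside `T`.) -/
def O1 (G : SimpleGraph V) (s : State V) (v : V) : Prop :=
  v ∈ s.verts ∧ 2 ≤ (outer G s v).ncard

/-- Operation O2 applies at `v`, with new vertex `x`. -/
def O2 (G : SimpleGraph V) (s : State V) (v x : V) : Prop :=
  v ∈ s.verts ∧ outer G s v = {x} ∧
    (outer G s x = ∅ ∨ 2 ≤ (G.neighborSet x ∩ s.verts).ncard)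

/-- Operation O3 applies at `v`, with new vertex `x`, which is to be expanded after `v`. -/
def O3 (G : SimpleGraph V) (s : State V) (v x : V) : Prop :=
  v ∈ s.verts ∧ outer G s v = {x} ∧ 2 ≤ (outer G s x).ncard

/-- The DFS rule when O1 applies nowhere: `v` was added no earlier than any vertex at which O2
or O3 applies. -/
def Latest (G : SimpleGraph V) (s : State V) (v : V) : Prop :=
  ∀ w y, O2 G s w y ∨ O3 G s w y → s.stamp w ≤ s.stamp v

/-- One operation of BRANCHING. O1 has precedence; among the vertices at which O1 applies, one with
the largest number of new vertices is expanded, and among these one that was added to `T` last. If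
O1 does not apply, then O2 or O3 is performed at a vertex that was added last among those at which
O2 or O3 applies. Remaining ties are broken arbitrarily. -/
inductive Step (G : SimpleGraph V) : State V → State V → Prop
  | o1 (s : State V) (v : V) (h : O1 G s v)
      (largest : ∀ w, O1 G s w → (outer G s w).ncard ≤ (outer G s v).ncard)
      (dfs : ∀ w, O1 G s w → (outer G s w).ncard = (outer G s v).ncard → s.stamp w ≤ s.stamp v) :
      Step G s (expand G s v)
  | o2 (s : State V) (v x : V) (noO1 : ∀ w, ¬ O1 G s w) (h : O2 G s v x) (dfs : Latest G s v) :
      Step G s (expand G s v)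
  | o3 (s : State V) (v x : V) (noO1 : ∀ w, ¬ O1 G s w) (h : O3 G s v x) (dfs : Latest G s v) :
      Step G s (expand G (expand G s v) x)

/-- `s` is a possible final state of BRANCHING on `G` with root `r`: it is reached from the
one-vertex tree by operations, and no further operation applies. -/
def IsResult (G : SimpleGraph V) (r : V) (s : State V) : Prop :=
  Relation.ReflTransGen (Step G) (init r) s ∧ ∀ s', ¬ Step G s s'

end Branching

/-! ### Random access machines

Programs for a machine with registers and arrays of natural numbers, with indirect addressing and
with unit cost for each elementary instruction and each test. The only arithmetic is successor and
predecessor, so the numbers in memory exceed the numbers in the input and in the program by at most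
the number of steps: a computation of linear length handles words of logarithmic length only. -/

namespace RAM

/-- The memory: registers `reg x` and arrays `arr a`, with entries `arr a i`. -/
structure Store where
  reg : ℕ → ℕ
  arr : ℕ → ℕ → ℕ

def Store.setReg (s : Store) (x k : ℕ) : Store := { s with reg := Function.update s.reg x k }

def Store.setArr (s : Store) (a i k : ℕ) : Store :=
  { s with arr := Function.update s.arr a (Function.update (s.arr a) i k) }

/-- Elementary instructions. -/
inductive Instr
  /-- `reg x := k` -/
  | const (x k : ℕ)
  /-- `reg x := reg y` -/
  | copy (x y : ℕ)
  /-- `reg x := reg x + 1` -/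
  | succ (x : ℕ)
  /-- `reg x := reg x - 1`, truncated at `0` -/
  | pred (x : ℕ)
  /-- `reg x := arr a (reg y)` -/
  | load (x a y : ℕ)
  /-- `arr a (reg y) := reg x` -/
  | store (a y x : ℕ)

def Instr.run : Instr → Store → Store
  | .const x k, s => s.setReg x k
  | .copy x y, s => s.setReg x (s.reg y)
  | .succ x, s => s.setReg x (s.reg x + 1)
  | .pred x, s => s.setReg x (s.reg x - 1)
  | .load x a y, s => s.setReg x (s.arr a (s.reg y))
  | .store a y x, s => s.setArr a (s.reg y) (s.reg x)

/-- Tests: comparison of two registers. -/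
inductive Test
  | eq (x y : ℕ)
  | lt (x y : ℕ)

def Test.holds : Test → Store → Prop
  | .eq x y, s => s.reg x = s.reg y
  | .lt x y, s => s.reg x < s.reg y

/-- Programs. -/
inductive Prog
  | skip
  | instr (i : Instr)
  | seq (p q : Prog)
  | cond (b : Test) (p q : Prog)
  | loop (b : Test) (p : Prog)

/-- `Exec p s s' t`: the program `p`, started with memory `s`, halts with memory `s'` after `t`
steps. (`loop b p` repeats `p` while `b` holds.) -/
inductive Exec : Prog → Store → Store → ℕ → Prop
  | skip (s : Store) : Exec .skip s s 1
  | instr (i : Instr) (s : Store) : Exec (.instr i) s (i.run s) 1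
  | seq {p q : Prog} {s s' s'' : Store} {t t' : ℕ} :
      Exec p s s' t → Exec q s' s'' t' → Exec (.seq p q) s s'' (t + t')
  | condTrue {b : Test} {p q : Prog} {s s' : Store} {t : ℕ} :
      b.holds s → Exec p s s' t → Exec (.cond b p q) s s' (t + 1)
  | condFalse {b : Test} {p q : Prog} {s s' : Store} {t : ℕ} :
      ¬ b.holds s → Exec q s s' t → Exec (.cond b p q) s s' (t + 1)
  | loopTrue {b : Test} {p : Prog} {s s' s'' : Store} {t t' : ℕ} :
      b.holds s → Exec p s s' t → Exec (.loop b p) s' s'' t' → Exec (.loop b p) s s'' (t + t' + 1)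
  | loopFalse {b : Test} {p : Prog} {s : Store} :
      ¬ b.holds s → Exec (.loop b p) s s 1

/-- `L` is an adjacency-list representation of `G`: the list `L v` contains every neighbour of `v`
exactly once, in any order. -/
def IsAdjLists {n : ℕ} (G : SimpleGraph (Fin n)) (L : Fin n → List (Fin n)) : Prop :=
  ∀ v, (L v).Nodup ∧ ∀ w, w ∈ L v ↔ G.Adj v w

/-- The memory that holds the adjacency lists `L`: register `0` is the number `n` of vertices,
array `1` is the concatenation of the lists `L 0, …, L (n-1)`, and for `i ≤ n` entry `i` of array
`0` is the total length of the first `i` lists (so that `L v` occupies the positions from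
`arr 0 v` up to but not including `arr 0 (v+1)` of array `1`); everything else is `0`. -/
def inputStore {n : ℕ} (L : Fin n → List (Fin n)) : Store where
  reg x := if x = 0 then n else 0
  arr a i :=
    if a = 0 then (if i ≤ n then ((List.ofFn L).take i).flatten.length else 0)
    else if a = 1 then ((List.ofFn L).flatten.map Fin.val).getD i 0
    else 0

/-- The memory `s` holds the function `p` as output, in array `2`. -/
def Outputs {n : ℕ} (s : Store) (p : Fin n → Fin n) : Prop := ∀ v : Fin n, s.arr 2 v = p v

end RAM

/-! Everything happens in H = `simplify G`. Given k disjoint cycles among the leaves, let K be their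
vertex set, so |K| ≥ 3k. Vertices of K are never expanded, and the parent of such a vertex lies
outside K, so K has degree at least 3 in H (`CycleCover`). It therefore suffices to show n + |K| ≤
4t, where t counts the childless vertices (`tips`) of the final tree; this is
`card_add_card_le_four_mul`.

The proof is an amortized count with potential 6·|tips| − 2·|verts| + Σ weight(u) over tips u. The
weight records how much is known about the future of u. A `Doomed` vertex, which will never be
expanded, has weight 2 outside K and 0 in K. A vertex that is not doomed has weight 0 outside K; in
K it has −2 if both its cycle neighbours are in the tree, and −1 otherwise. In a spanning tree every
tip is doomed and the potential is 8t − 2n − 2|K|. So the potential has to be nonnegative whenever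
O1 applies nowhere.

As long as only O1 has been used, |verts| ≤ 2·|tips|, and this is enough. An O2 that does not enable
O1 costs 2 for its new vertex x. This is repaid by x being doomed, or by another tree neighbour of x
that loses its last outside neighbour (`potential_le_expand`). Otherwise O3, or O2 followed by O1 at
x, opens a series of operations O1. During the series every new tip is booked at −2, the least
possible weight (`balance`). The opening with k children of x changes the account by 2k − 8, and an
O1 with k new vertices by 2k − 4. Hence the deficit is at most 4, and at most 2 unless every k was
2.

At the end of the series true weights replace the booked ones (`InSeries.potential_nonneg`). If the
last added vertices are all doomed, two of them gain 2 each. If not, the DFS rule makes one of them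
the next to be expanded; it lies outside K and gains 2. If 2 are still missing, consider the new
vertices of K. They cannot be closed under the cyclic successor: the earliest of them would see its
two cycle neighbours and an outside neighbour arrive no earlier than itself, whereas the
largest-first and last-first rules allow only two such neighbours (`later`). So the cycles cross
from new to other vertices in both directions, and each crossing gains 1.

The final tree spans (`verts_eq_univ`): all its vertices are doomed, so the outside vertices next to
it have degree 2 and would form a forbidden separator, or else some deleted edge would survive in H.

For linear time, each new vertex with c outside neighbours is pushed onto the stacks 1, …, c. The
program only inspects the top of the highest relevant stack and discards stale entries when it meets
them. An O3 appears as two successive expansions, because after the first one x is the only place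
where O1 applies (`Reached`). The invariant `Inv` links memory and execution, and `Mem.pot` bounds
the steps to go. -/

namespace Branching

variable {V : Type u} {H : SimpleGraph V} {s : State V} {r v w x : V}

/-! ### Expansions -/

lemma mem_outer : w ∈ outer H s v ↔ H.Adj v w ∧ w ∉ s.verts := Iff.rfl

lemma mem_expand_verts : w ∈ (expand H s v).verts ↔ w ∈ s.verts ∨ w ∈ outer H s v := Iff.rfl

lemma subset_expand : s.verts ⊆ (expand H s v).verts := fun _ h => Or.inl h

lemma outer_expand : outer H (expand H s v) w = outer H s w \ outer H s v := by
  ext y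
  simp only [mem_outer, Set.mem_sdiff, mem_expand_verts]
  tauto

lemma outer_expand_self : outer H (expand H s v) v = ∅ := by simp [outer_expand]

lemma outer_expand_subset : outer H (expand H s v) w ⊆ outer H s w := by
  rw [outer_expand]; exact Set.sdiff_subset

lemma expand_parent_of_mem (h : w ∈ outer H s v) : (expand H s v).parent w = v := by
  simp [expand, h]

lemma expand_parent_of_notMem (h : w ∉ outer H s v) : (expand H s v).parent w = s.parent w := by
  simp [expand, h]

lemma expand_stamp_of_mem (h : w ∈ outer H s v) : (expand H s v).stamp w = s.clock + 1 := by
  simp [expand, h]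

lemma expand_stamp_of_notMem (h : w ∉ outer H s v) : (expand H s v).stamp w = s.stamp w := by
  simp [expand, h]

lemma notMem_outer (h : w ∈ s.verts) : w ∉ outer H s v := fun h' => h'.2 h

@[simp] lemma expand_clock : (expand H s v).clock = s.clock + 1 := rfl

/-- The structural invariants of the trees built by expansions from the root `r`. -/
structure Valid (H : SimpleGraph V) (r : V) (s : State V) : Prop where
  root_mem : r ∈ s.verts
  root_parent : s.parent r = r
  parent_out : ∀ w, w ∉ s.verts → s.parent w = w
  parent_mem : ∀ w ∈ s.verts, w ≠ r → s.parent w ∈ s.verts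
  parent_adj : ∀ w ∈ s.verts, w ≠ r → H.Adj (s.parent w) w
  parent_stamp : ∀ w ∈ s.verts, w ≠ r → s.stamp (s.parent w) < s.stamp w
  stamp_le : ∀ w ∈ s.verts, s.stamp w ≤ s.clock
  outer_parent : ∀ w, s.parent w ≠ w → outer H s (s.parent w) = ∅
  root_children : s.verts = {r} ∨ ∀ w, H.Adj r w → s.parent w = r

lemma Valid.init (H : SimpleGraph V) (r : V) : Valid H r (init r) where
  root_mem := rfl
  root_parent := rfl
  parent_out _ _ := rfl
  parent_mem _ hw hr := absurd hw hr
  parent_adj _ hw hr := absurd hw hr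
  parent_stamp _ hw hr := absurd hw hr
  stamp_le _ _ := le_rfl
  outer_parent _ hw := absurd rfl hw
  root_children := Or.inl rfl

lemma Valid.valid_expand (h : Valid H r s) (hv : v ∈ s.verts) : Valid H r (expand H s v) where
  root_mem := subset_expand h.root_mem
  root_parent := by rw [expand_parent_of_notMem (notMem_outer h.root_mem), h.root_parent]
  parent_out w hw := by
    rw [mem_expand_verts, not_or] at hw
    rw [expand_parent_of_notMem hw.2, h.parent_out w hw.1]
  parent_mem w hw hr := by
    by_cases hwo : w ∈ outer H s v
    · rw [expand_parent_of_mem hwo]; exact subset_expand hv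
    · rw [expand_parent_of_notMem hwo]
      exact subset_expand (h.parent_mem w (hw.resolve_right hwo) hr)
  parent_adj w hw hr := by
    by_cases hwo : w ∈ outer H s v
    · rw [expand_parent_of_mem hwo]; exact hwo.1
    · rw [expand_parent_of_notMem hwo]
      exact h.parent_adj w (hw.resolve_right hwo) hr
  parent_stamp w hw hr := by
    by_cases hwo : w ∈ outer H s v
    · rw [expand_parent_of_mem hwo, expand_stamp_of_mem hwo,
        expand_stamp_of_notMem (notMem_outer hv)]
      exact Nat.lt_succ_of_le (h.stamp_le v hv)
    · have hw' := hw.resolve_right hwo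
      rw [expand_parent_of_notMem hwo, expand_stamp_of_notMem hwo,
        expand_stamp_of_notMem (notMem_outer (h.parent_mem w hw' hr))]
      exact h.parent_stamp w hw' hr
  stamp_le w hw := by
    by_cases hwo : w ∈ outer H s v
    · rw [expand_stamp_of_mem hwo]; exact le_rfl
    · rw [expand_stamp_of_notMem hwo]
      exact (h.stamp_le w (hw.resolve_right hwo)).trans (Nat.le_succ _)
  outer_parent w hw := by
    by_cases hwo : w ∈ outer H s v
    · rw [expand_parent_of_mem hwo]; exact outer_expand_self
    · rw [expand_parent_of_notMem hwo] at hw ⊢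
      have := h.outer_parent w hw
      rw [outer_expand, this, Set.empty_sdiff]
  root_children := by
    by_cases hvr : (outer H s v) = ∅
    · rcases h.root_children with h1 | h1
      · left
        ext w
        simp [mem_expand_verts, hvr, h1]
      · right
        intro w hw
        rw [expand_parent_of_notMem (by simp [hvr]), h1 w hw]
    right
    intro w hw
    rcases h.root_children with h1 | h1
    · have : v = r := by simpa [h1] using hv
      subst this
      have : w ∈ outer H s v := ⟨hw, by rw [h1]; exact hw.ne'⟩
      rw [expand_parent_of_mem this]
    · have hw' := h1 w hw
      have : w ∈ s.verts := by
        by_contra hn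
        have := h.parent_out w hn
        exact hw.ne (hw'.symm.trans this)
      rw [expand_parent_of_notMem (notMem_outer this), hw']

/-! ### Executions -/

/-- Operation O1 applies nowhere. -/
def NoO1 (H : SimpleGraph V) (s : State V) : Prop := ∀ w, ¬ O1 H s w

lemma NoO1.ncard_le (h : NoO1 H s) (hv : v ∈ s.verts) : (outer H s v).ncard ≤ 1 := by
  by_contra hc
  exact h v ⟨hv, by omega⟩

lemma O3.mem_expand (h : O3 H s v x) : x ∈ (expand H s v).verts :=
  Or.inr (by rw [h.2.1]; rfl)

lemma Step.valid {t : State V} (h : Valid H r s) (hst : Step H s t) : Valid H r t := by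
  cases hst with
  | o1 v hv => exact h.valid_expand hv.1
  | o2 v x _ hv => exact h.valid_expand hv.1
  | o3 v x _ hv => exact (h.valid_expand hv.1).valid_expand hv.mem_expand

lemma Valid.of_reflTransGen {t : State V} (h : Valid H r s)
    (hst : Relation.ReflTransGen (Step H) s t) : Valid H r t := by
  induction hst with
  | refl => exact h
  | tail _ h1 ih => exact h1.valid ih

/-- `t` arises from `s` by adding vertices. -/
def Extends (s t : State V) : Prop :=
  s.verts ⊆ t.verts ∧ ∀ w ∈ s.verts, t.parent w = s.parent w

lemma Extends.trans {t t' : State V} (h : Extends s t) (h' : Extends t t') : Extends s t' :=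
  ⟨h.1.trans h'.1, fun w hw => (h'.2 w (h.1 hw)).trans (h.2 w hw)⟩

lemma extends_expand : Extends s (expand H s v) :=
  ⟨subset_expand, fun _ hw => expand_parent_of_notMem (notMem_outer hw)⟩

lemma Step.extends {t : State V} (h : Step H s t) : Extends s t := by
  cases h with
  | o1 v hv => exact extends_expand
  | o2 v x _ hv => exact extends_expand
  | o3 v x _ hv => exact extends_expand.trans extends_expand

lemma extends_of_reflTransGen {t : State V} (h : Relation.ReflTransGen (Step H) s t) :
    Extends s t := by
  induction h with
  | refl => exact ⟨subset_rfl, fun _ _ => rfl⟩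
  | tail _ h1 ih => exact ih.trans h1.extends

/-- If `v` is expanded with effect, it has a child in every later tree. -/
lemma exists_child {t : State V} (h : Extends (expand H s v) t) (hv : v ∈ s.verts)
    (ho : (outer H s v).Nonempty) : ∃ w, t.parent w = v ∧ w ≠ v := by
  obtain ⟨w, hw⟩ := ho
  refine ⟨w, ?_, fun h' => hw.2 (h' ▸ hv)⟩
  rw [h.2 w (Or.inr hw), expand_parent_of_mem hw]

lemma outer_nonempty_of_eq_singleton (h : outer H s v = {x}) : (outer H s v).Nonempty := by
  rw [h]; exact Set.singleton_nonempty x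

lemma outer_nonempty_of_two_le (h : 2 ≤ (outer H s v).ncard) : (outer H s v).Nonempty :=
  Set.nonempty_of_ncard_ne_zero (by omega)

lemma outer_expand_of_singleton (h : outer H s v = {x}) :
    outer H (expand H s v) x = outer H s x := by
  rw [outer_expand, h]
  refine Set.sdiff_singleton_eq_self (fun hx => hx.1.ne rfl)

variable [Finite V]

lemma ncard_outer_mono {t : State V} (h : s.verts ⊆ t.verts) (v : V) :
    (outer H t v).ncard ≤ (outer H s v).ncard :=
  Set.ncard_le_ncard (fun _ hw => ⟨hw.1, fun h' => hw.2 (h h')⟩) (Set.toFinite _)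

/-- Every operation expands a vertex that has something to add; this gives termination. -/
lemma Step.ncard_lt {t : State V} (h : Step H s t) : s.verts.ncard < t.verts.ncard := by
  have key : ∀ (s : State V) v, (outer H s v).Nonempty →
      s.verts.ncard < (expand H s v).verts.ncard := by
    rintro s v ⟨w, hw⟩
    refine Set.ncard_lt_ncard ⟨subset_expand, fun hh => hw.2 (hh (Or.inr hw))⟩ (Set.toFinite _)
  cases h with
  | o1 v hv => exact key _ _ (outer_nonempty_of_two_le hv.2)
  | o2 v x _ hv => exact key _ _ (outer_nonempty_of_eq_singleton hv.2.1)
  | o3 v x _ hv =>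
    exact (key _ _ (outer_nonempty_of_eq_singleton hv.2.1)).trans_le
      (Set.ncard_le_ncard subset_expand (Set.toFinite _))

lemma exists_isResult (H : SimpleGraph V) (r : V) : ∃ s, IsResult H r s := by
  have key : ∀ (k : ℕ) (s : State V), Nat.card V ≤ s.verts.ncard + k →
      ∃ t, Relation.ReflTransGen (Step H) s t ∧ ∀ t', ¬ Step H t t' := by
    intro k
    induction k with
    | zero =>
      intro s hs
      refine ⟨s, .refl, fun t' ht => ?_⟩
      have h1 := ht.ncard_lt
      have h2 := Set.ncard_le_card t'.verts
      omega
    | succ k ih =>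
      intro s hs
      by_cases h : ∃ t, Step H s t
      · obtain ⟨t, ht⟩ := h
        obtain ⟨t', h1, h2⟩ := ih t (by have := ht.ncard_lt; omega)
        exact ⟨t', .head ht h1, h2⟩
      · push Not at h
        exact ⟨s, .refl, h⟩
  exact key (Nat.card V) _ (by omega)

lemma noO1_of_final (h : ∀ t, ¬ Step H s t) : NoO1 H s := by
  intro w hw
  -- A lexicographic maximum of (number of new vertices, stamp) meets both selection rules of O1 at
  -- once.
  obtain ⟨v, hv, hmax⟩ := Set.exists_max_image {v | O1 H s v}
    (fun v => toLex ((outer H s v).ncard, s.stamp v)) (Set.toFinite _) ⟨w, hw⟩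
  refine h _ (Step.o1 s v hv (fun y hy => ?_) (fun y hy he => ?_))
  · have := hmax y hy
    rw [Prod.Lex.toLex_le_toLex] at this
    rcases this with h | h
    · exact h.le
    · exact h.1.le
  · have := hmax y hy
    rw [Prod.Lex.toLex_le_toLex] at this
    rcases this with h | h
    · simp only at h; omega
    · exact h.2

lemma no_O2_O3_of_final (h : ∀ t, ¬ Step H s t) : ¬ (O2 H s v x ∨ O3 H s v x) := by
  intro hvx
  obtain ⟨w, ⟨y, hw⟩, hmax⟩ := Set.exists_max_image {v | ∃ x, O2 H s v x ∨ O3 H s v x}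
    s.stamp (Set.toFinite _) ⟨v, x, hvx⟩
  have hl : Latest H s w := fun z y hz => hmax z ⟨y, hz⟩
  rcases hw with hw | hw
  · exact h _ (Step.o2 s w y (noO1_of_final h) hw hl)
  · exact h _ (Step.o3 s w y (noO1_of_final h) hw hl)

end Branching

/-! ### Permanence of doom, and the effect of an expansion on the childless vertices -/

namespace Branching

variable {V : Type u} {H : SimpleGraph V} {s : State V} {r v w x y : V}

/-! ### Doomed vertices -/

/-- A vertex `y` of the tree is doomed if it has no neighbour outside, or only one, `z`, which has
degree `2`, and the other neighbour of `z` is outside or was added later than `y`. Doomed vertices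
are never expanded. -/
def Doomed (H : SimpleGraph V) (s : State V) (y : V) : Prop :=
  outer H s y = ∅ ∨ ∃ z w, outer H s y = {z} ∧ H.neighborSet z = {y, w} ∧ w ≠ y ∧
    (w ∉ s.verts ∨ s.stamp y < s.stamp w)

/-- An expansion may absorb z, leaving y with no outside neighbour, or absorb w, which then carries
a newer stamp than y. -/
lemma Doomed.doomed_expand (h : Doomed H s y) (hy : y ∈ s.verts) (hst : s.stamp y ≤ s.clock) :
    Doomed H (expand H s v) y := by
  by_cases h0 : outer H (expand H s v) y = ∅
  · exact Or.inl h0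
  rcases h with h | ⟨z, w, h1, h2, h3, h4⟩
  · exact absurd (Set.subset_eq_empty outer_expand_subset h) h0
  refine Or.inr ⟨z, w, ?_, h2, h3, ?_⟩
  · have : outer H (expand H s v) y ⊆ {z} := h1 ▸ outer_expand_subset
    rcases Set.subset_singleton_iff_eq.1 this with h | h
    · exact absurd h h0
    · exact h
  · by_cases hw : w ∈ outer H s v
    · right
      rw [expand_stamp_of_mem hw, expand_stamp_of_notMem (notMem_outer hy)]
      omega
    · rw [expand_stamp_of_notMem hw, expand_stamp_of_notMem (notMem_outer hy), mem_expand_verts]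
      tauto

lemma Doomed.neighborSet_eq (h : Doomed H s y) (hx : outer H s y = {x}) :
    ∃ w, H.neighborSet x = {y, w} ∧ w ≠ y ∧ (w ∉ s.verts ∨ s.stamp y < s.stamp w) := by
  rcases h with h | ⟨z, w, h1, h2⟩
  · rw [h] at hx; exact absurd hx.symm (Set.singleton_ne_empty x)
  · rw [h1, Set.singleton_eq_singleton_iff] at hx
    subst hx
    exact ⟨w, h2⟩

section Finite

variable [Finite V]

lemma NoO1.eq_singleton (h : NoO1 H s) (hv : v ∈ s.verts) (hx : x ∈ outer H s v) :
    outer H s v = {x} := by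
  have h1 := h.ncard_le hv
  rw [Set.ncard_le_one_iff_eq] at h1
  rcases h1 with h1 | ⟨a, h1⟩
  · simp [h1] at hx
  · rw [h1] at hx ⊢
    rw [Set.mem_singleton_iff.1 hx]

lemma NoO1.eq_empty (h : NoO1 H s) (hv : v ∈ s.verts) (hx : x ∈ outer H s v) {t : State V}
    (hst : s.verts ⊆ t.verts) (hxt : x ∈ t.verts) : outer H t v = ∅ := by
  ext z
  simp only [Set.mem_empty_iff_false, iff_false]
  intro hz
  have : z ∈ outer H s v := ⟨hz.1, fun h' => hz.2 (hst h')⟩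
  rw [h.eq_singleton hv hx] at this
  exact hz.2 (this ▸ hxt)

/-- Where O1 applies nowhere, O2 or O3 applies at every vertex that is not doomed. -/
lemma exists_O2_or_O3 (h : NoO1 H s) (hy : y ∈ s.verts) (hd : ¬ Doomed H s y) :
    ∃ x, O2 H s y x ∨ O3 H s y x := by
  have hne : (outer H s y).Nonempty := by
    rw [Set.nonempty_iff_ne_empty]; exact fun h => hd (Or.inl h)
  obtain ⟨x, hx⟩ := hne
  have hsx := h.eq_singleton hy hx
  refine ⟨x, ?_⟩
  by_contra hc
  rw [not_or] at hc
  have h2 : ¬ (outer H s x = ∅ ∨ 2 ≤ (H.neighborSet x ∩ s.verts).ncard) :=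
    fun h' => hc.1 ⟨hy, hsx, h'⟩
  have h3 : ¬ 2 ≤ (outer H s x).ncard := fun h' => hc.2 ⟨hy, hsx, h'⟩
  rw [not_or] at h2
  have h4 : (outer H s x).ncard ≤ 1 := by omega
  have h5 : (H.neighborSet x ∩ s.verts).ncard ≤ 1 := by omega
  -- Since O2 and O3 both fail, x has exactly one outside neighbour w and only y in the tree, which
  -- is the second form of doom.
  rw [Set.ncard_le_one_iff_eq] at h4 h5
  obtain ⟨w, hw⟩ := h4.resolve_left h2.1
  have hyx : y ∈ H.neighborSet x ∩ s.verts := ⟨hx.1.symm, hy⟩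
  have h6 : H.neighborSet x ∩ s.verts = {y} := by
    rcases h5 with h5 | ⟨a, h5⟩
    · simp [h5] at hyx
    · rw [h5] at hyx ⊢; rw [Set.mem_singleton_iff.1 hyx]
  have hwo : w ∈ outer H s x := by rw [hw]; rfl
  refine hd (Or.inr ⟨x, w, hsx, ?_, fun h' => hwo.2 (h' ▸ hy), Or.inl hwo.2⟩)
  ext z
  by_cases hz : z ∈ s.verts
  · have : z ∈ H.neighborSet x ∩ s.verts ↔ z ∈ ({y} : Set V) := by rw [h6]
    have hzw : z ≠ w := fun h' => hwo.2 (h' ▸ hz)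
    simpa [hz, hzw] using this
  · have : z ∈ outer H s x ↔ z ∈ ({w} : Set V) := by rw [hw]
    have hzy : z ≠ y := fun h' => hz (h' ▸ hy)
    simpa [mem_outer, hz, hzy] using this

lemma O3.not_doomed (h : O3 H s v x) : ¬ Doomed H s v := by
  intro hd
  obtain ⟨w, h1, h2, -⟩ := hd.neighborSet_eq h.2.1
  have : outer H s x ⊆ {w} := by
    intro z hz
    have hz' : z ∈ H.neighborSet x := hz.1
    rw [h1] at hz'
    rcases hz' with rfl | hz'
    · exact absurd h.1 hz.2
    · exact hz'
  have := Set.ncard_le_ncard this (Set.toFinite _)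
  rw [Set.ncard_singleton] at this
  have := h.2.2
  omega

/-- A doomed vertex at which O2 applies was added earlier than some vertex at which O2 applies and
which is not doomed. -/
lemma O2.exists_later (h : O2 H s v x) (hN : NoO1 H s) (hd : Doomed H s v) :
    ∃ w, O2 H s w x ∧ s.stamp v < s.stamp w ∧ ¬ Doomed H s w := by
  obtain ⟨w, h1, h2, h3⟩ := hd.neighborSet_eq h.2.1
  have hxo : x ∈ outer H s v := by rw [h.2.1]; rfl
  have hwx : H.Adj x w := by
    have : w ∈ H.neighborSet x := by rw [h1]; simp
    exact this
  have hw : w ∈ s.verts := by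
    by_contra hw
    rcases h.2.2 with h4 | h4
    · have : w ∈ outer H s x := ⟨hwx, hw⟩
      simp [h4] at this
    · have : H.neighborSet x ∩ s.verts ⊆ {v} := by
        rintro z ⟨hz, hz'⟩
        rw [h1] at hz
        rcases hz with rfl | rfl
        · rfl
        · exact absurd hz' hw
      have := Set.ncard_le_ncard this (Set.toFinite _)
      rw [Set.ncard_singleton] at this
      omega
  have hst := h3.resolve_left (not_not_intro hw)
  have how := hN.eq_singleton hw (⟨hwx.symm, hxo.2⟩ : x ∈ outer H s w)
  refine ⟨w, ⟨hw, how, h.2.2⟩, hst, fun hdw => ?_⟩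
  obtain ⟨w', h4, h5, h6⟩ := hdw.neighborSet_eq how
  have : v ∈ H.neighborSet x := by rw [h1]; simp
  rw [h4] at this
  rcases this with rfl | rfl
  · exact h2 rfl
  · rcases h6 with h6 | h6
    · exact h6 h.1
    · omega

/-- Here the DFS rule justifies the stamp condition in `Doomed`: O2 would also apply at the later
neighbour of x, and that one takes precedence. -/
lemma O2.not_doomed (h : O2 H s v x) (hN : NoO1 H s) (hl : Latest H s v) : ¬ Doomed H s v := by
  intro hd
  obtain ⟨w, h1, h2, -⟩ := h.exists_later hN hd
  have := hl w x (Or.inl h1)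
  omega

lemma card_verts_expand :
    ((expand H s v).verts.ncard : ℤ) = s.verts.ncard + (outer H s v).ncard := by
  have : (expand H s v).verts = s.verts ∪ outer H s v := rfl
  rw [this, Set.ncard_union_eq _ (Set.toFinite _) (Set.toFinite _)]
  · push_cast; rfl
  · rw [Set.disjoint_left]; exact fun a ha hb => hb.2 ha

end Finite

/-! ### Unexpanded vertices -/

section Tips

variable [Fintype V]

open Classical in
/-- The vertices of the tree without children. -/
noncomputable def tips (s : State V) : Finset V :=
  {u | u ∈ s.verts ∧ ∀ w, s.parent w = u → w = u}

lemma mem_tips : v ∈ tips s ↔ v ∈ s.verts ∧ ∀ w, s.parent w = v → w = v := by simp [tips]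

lemma Valid.mem_tips_of_outer (h : Valid H r s) (hv : v ∈ s.verts)
    (ho : (outer H s v).Nonempty) : v ∈ tips s := by
  rw [mem_tips]
  refine ⟨hv, fun w hw => ?_⟩
  by_contra hc
  have := h.outer_parent w (by rw [hw]; exact fun h' => hc h'.symm)
  rw [hw] at this
  simp [this] at ho

open Classical in
lemma Valid.tips_expand (h : Valid H r s) (hv : v ∈ s.verts) (ho : (outer H s v).Nonempty) :
    tips (expand H s v) = (tips s).erase v ∪ (outer H s v).toFinset := by
  ext u
  simp only [mem_tips, Finset.mem_union, Finset.mem_erase, Set.mem_toFinset, mem_expand_verts]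
  constructor
  · rintro ⟨h1 | h1, h2⟩
    · left
      refine ⟨?_, h1, fun w hw => ?_⟩
      · rintro rfl
        obtain ⟨w, hw⟩ := ho
        have := h2 w (expand_parent_of_mem hw)
        exact hw.2 (this ▸ hv)
      · by_cases hwo : w ∈ outer H s v
        · have := h.parent_out w hwo.2
          rw [this] at hw; exact hw
        · exact h2 w (by rw [expand_parent_of_notMem hwo, hw])
    · exact Or.inr h1
  · rintro (⟨h1, h2, h3⟩ | h1)
    · refine ⟨Or.inl h2, fun w hw => ?_⟩
      by_cases hwo : w ∈ outer H s v
      · rw [expand_parent_of_mem hwo] at hw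
        exact absurd hw.symm h1
      · rw [expand_parent_of_notMem hwo] at hw
        exact h3 w hw
    · refine ⟨Or.inr h1, fun w hw => ?_⟩
      by_cases hwo : w ∈ outer H s v
      · rw [expand_parent_of_mem hwo] at hw
        exact absurd (hw ▸ hv) h1.2
      · rw [expand_parent_of_notMem hwo] at hw
        by_cases hws : w ∈ s.verts
        · exfalso
          by_cases hwr : w = r
          · subst hwr
            rw [h.root_parent] at hw
            exact h1.2 (hw ▸ hws)
          · exact h1.2 (hw ▸ h.parent_mem w hws hwr)
        · rw [h.parent_out w hws] at hw; exact hw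

open Classical in
lemma Valid.sum_tips_expand (h : Valid H r s) (hv : v ∈ s.verts) (ho : (outer H s v).Nonempty)
    (g : V → ℤ) : ∑ u ∈ tips (expand H s v), g u =
      ∑ u ∈ (tips s).erase v, g u + ∑ u ∈ (outer H s v).toFinset, g u := by
  rw [h.tips_expand hv ho, Finset.sum_union]
  rw [Finset.disjoint_left]
  intro a ha hb
  rw [Finset.mem_erase, mem_tips] at ha
  exact (Set.mem_toFinset.1 hb).2 ha.2.1

open Classical in
lemma Valid.sum_tips_expand_const (h : Valid H r s) (hv : v ∈ s.verts)
    (ho : (outer H s v).Nonempty) (g : V → ℤ) (c : ℤ) (hg : ∀ u ∈ outer H s v, g u = c) :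
    ∑ u ∈ tips (expand H s v), g u =
      ∑ u ∈ tips s, g u - g v + (outer H s v).ncard * c := by
  rw [h.sum_tips_expand hv ho, ← Finset.sum_erase_eq_sub (h.mem_tips_of_outer hv ho),
    Finset.sum_congr rfl (fun u hu => hg u (Set.mem_toFinset.1 hu)), Finset.sum_const,
    Set.ncard_eq_toFinset_card']
  simp

lemma Valid.card_tips_expand (h : Valid H r s) (hv : v ∈ s.verts) (ho : (outer H s v).Nonempty) :
    ((tips (expand H s v)).card : ℤ) = (tips s).card - 1 + (outer H s v).ncard := by
  have := h.sum_tips_expand_const hv ho (fun _ => 1) 1 (fun _ _ => rfl)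
  simpa using this

end Tips

end Branching

/-! ### Cycle covers, weights and the potential -/

namespace Branching

variable {V : Type u} {H : SimpleGraph V} {s s₀ t : State V} {r u v w x y : V}

/-! ### The potential -/

/-- A set `K` of vertices covered by disjoint cycles of `H`, given by the successor and the
predecessor of each vertex, such that every vertex of `K` has a neighbour outside `K`. -/
structure CycleCover (H : SimpleGraph V) where
  K : Finset V
  nxt : V → V
  prv : V → V
  nxt_mem : ∀ u ∈ K, nxt u ∈ K
  prv_mem : ∀ u ∈ K, prv u ∈ K
  nxt_adj : ∀ u ∈ K, H.Adj u (nxt u)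
  prv_adj : ∀ u ∈ K, H.Adj u (prv u)
  nxt_prv : ∀ u ∈ K, nxt (prv u) = u
  prv_nxt : ∀ u ∈ K, prv (nxt u) = u
  nxt_ne_prv : ∀ u ∈ K, nxt u ≠ prv u
  exit : ∀ u ∈ K, ∃ p, p ∉ K ∧ H.Adj u p

/-- Steps of BRANCHING that do not expand vertices of `K`. -/
inductive AvoidStep (H : SimpleGraph V) (K : Finset V) : State V → State V → Prop
  | o1 (s : State V) (v : V) (hv : v ∉ K) (h : O1 H s v)
      (largest : ∀ w, O1 H s w → (outer H s w).ncard ≤ (outer H s v).ncard)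
      (dfs : ∀ w, O1 H s w → (outer H s w).ncard = (outer H s v).ncard → s.stamp w ≤ s.stamp v) :
      AvoidStep H K s (expand H s v)
  | o2 (s : State V) (v x : V) (hv : v ∉ K) (noO1 : ∀ w, ¬ O1 H s w) (h : O2 H s v x)
      (dfs : Latest H s v) : AvoidStep H K s (expand H s v)
  | o3 (s : State V) (v x : V) (hv : v ∉ K) (hx : x ∉ K) (noO1 : ∀ w, ¬ O1 H s w)
      (h : O3 H s v x) (dfs : Latest H s v) : AvoidStep H K s (expand H (expand H s v) x)

/-- The execution ends in `s` or goes on without expanding a vertex of `K`. -/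
def Proceeds (H : SimpleGraph V) (K : Finset V) (s : State V) : Prop :=
  (∀ t, ¬ Step H s t) ∨ ∃ t, AvoidStep H K s t

/-- A vertex that is not doomed admits O2 or O3, so the execution is not over. The vertex expanded
next is at least as recent by the DFS rule, and avoids K. -/
lemma Proceeds.exists_later [Finite V] {K : Finset V} (h : Proceeds H K s) (hN : NoO1 H s)
    (hy : y ∈ s.verts) (hd : ¬ Doomed H s y) :
    ∃ v ∈ s.verts, v ∉ K ∧ s.stamp y ≤ s.stamp v := by
  obtain ⟨x, hx⟩ := exists_O2_or_O3 hN hy hd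
  rcases h with h | ⟨t, h⟩
  · exact absurd hx (no_O2_O3_of_final h)
  · cases h with
    | o1 v hv h l d => exact absurd h (hN v)
    | o2 v z hv n h d => exact ⟨v, h.1, hv, d y x hx⟩
    | o3 v z hv hz n h d => exact ⟨v, h.1, hv, d y x hx⟩

namespace CycleCover

variable (C : CycleCover H)

/-- Successor, predecessor and exit are three distinct neighbours. -/
lemma neighborSet_ne {z : V} (hz : z ∈ C.K) : H.neighborSet z ≠ {y, w} := by
  intro h
  obtain ⟨p, hp, hzp⟩ := C.exit z hz
  have h1 : C.nxt z ∈ H.neighborSet z := C.nxt_adj z hz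
  have h2 : C.prv z ∈ H.neighborSet z := C.prv_adj z hz
  have h3 : p ∈ H.neighborSet z := hzp
  have h4 := C.nxt_ne_prv z hz
  have h5 : p ≠ C.nxt z := fun h' => hp (h' ▸ C.nxt_mem z hz)
  have h6 : p ≠ C.prv z := fun h' => hp (h' ▸ C.prv_mem z hz)
  rw [h] at h1 h2 h3
  simp only [Set.mem_insert_iff, Set.mem_singleton_iff] at h1 h2 h3
  grind

lemma notMem_of_doomed (hd : Doomed H s u) (hx : x ∈ outer H s u) : x ∉ C.K := by
  intro hxK
  rcases hd with h | ⟨z, w, h1, h2, -⟩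
  · simp [h] at hx
  · rw [h1, Set.mem_singleton_iff] at hx
    subst hx
    exact C.neighborSet_ne hxK h2

open Classical in
/-- The contribution of an unexpanded vertex to the potential. -/
noncomputable def weight (s : State V) (u : V) : ℤ :=
  if u ∈ C.K then
    if Doomed H s u then 0 else if C.nxt u ∈ s.verts ∧ C.prv u ∈ s.verts then -2 else -1
  else if Doomed H s u then 2 else 0

lemma weight_ge : -2 ≤ C.weight s u := by
  unfold weight; split_ifs <;> norm_num

lemma weight_nonneg (h : u ∉ C.K) : 0 ≤ C.weight s u := by
  unfold weight; split_ifs <;> norm_num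

lemma weight_nonneg_of_doomed (h : Doomed H s u) : 0 ≤ C.weight s u := by
  simp only [weight, h, if_true]; split_ifs <;> norm_num

lemma weight_eq_zero (hu : u ∉ C.K) (h : ¬ Doomed H s u) : C.weight s u = 0 := by
  simp [weight, hu, h]

lemma weight_eq_two (hu : u ∉ C.K) (h : Doomed H s u) : C.weight s u = 2 := by
  simp [weight, hu, h]

lemma weight_eq_neg_one (hu : u ∈ C.K) (h : ¬ Doomed H s u)
    (h' : C.nxt u ∉ s.verts ∨ C.prv u ∉ s.verts) : C.weight s u = -1 := by
  simp only [weight, hu, h, if_true, if_false]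
  rw [if_neg]
  tauto

lemma weight_eq_neg_two (hu : u ∈ C.K) (h : ¬ Doomed H s u)
    (h1 : C.nxt u ∈ s.verts) (h2 : C.prv u ∈ s.verts) : C.weight s u = -2 := by
  simp [weight, hu, h, h1, h2]

/-- Becoming doomed can only raise the weight. If u stays undoomed, its single outside neighbour is
still outside, so none of its neighbours has entered the tree and nothing changes. -/
lemma weight_mono_expand [Finite V] (hu : u ∈ s.verts) (ho : (outer H s u).ncard ≤ 1)
    (hst : s.stamp u ≤ s.clock) : C.weight s u ≤ C.weight (expand H s v) u := by
  by_cases hd : Doomed H s u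
  · have := hd.doomed_expand (v := v) hu hst
    simp [weight, hd, this]
  by_cases hd' : Doomed H (expand H s v) u
  · simp only [weight, hd, hd', if_true, if_false]; split_ifs <;> norm_num
  have heq : outer H (expand H s v) u = outer H s u := by
    have hne : outer H (expand H s v) u ≠ ∅ := fun h => hd' (Or.inl h)
    refine Set.eq_of_subset_of_ncard_le outer_expand_subset (ho.trans ?_) (Set.toFinite _)
    rw [Nat.one_le_iff_ne_zero]
    rwa [Ne, Set.ncard_eq_zero (Set.toFinite _)]
  have key : ∀ z, H.Adj u z → (z ∈ (expand H s v).verts ↔ z ∈ s.verts) := by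
    intro z hz
    have : z ∈ outer H (expand H s v) u ↔ z ∈ outer H s u := by rw [heq]
    simp only [mem_outer, hz, true_and] at this
    exact not_iff_not.1 this
  by_cases hK : u ∈ C.K
  · have h1 := key _ (C.nxt_adj u hK)
    have h2 := key _ (C.prv_adj u hK)
    simp only [weight, hd, hd', hK, if_true, if_false]
    split_ifs <;> first | (exfalso; tauto) | norm_num
  · simp [weight, hd, hd', hK]

open Classical in
/-- The contribution of an unexpanded vertex to the balance since the state `s₀`. -/
noncomputable def oldWeight (s₀ : State V) (u : V) : ℤ :=
  if u ∈ s₀.verts then C.weight s₀ u else -2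

lemma oldWeight_of_mem (h : u ∈ s₀.verts) : C.oldWeight s₀ u = C.weight s₀ u := by
  simp [oldWeight, h]

lemma oldWeight_of_notMem (h : u ∉ s₀.verts) : C.oldWeight s₀ u = -2 := by
  simp [oldWeight, h]

/-- The neighbours of `w` that were not in the tree when the vertices of the tree added together
with `w` were added, and those in `K` that were added together with `w`. -/
def later (s : State V) (w : V) : Set V :=
  {u | H.Adj w u ∧ (u ∉ s.verts ∨ s.stamp w < s.stamp u ∨ s.stamp u = s.stamp w ∧ u ∈ C.K)}

/-- A vertex added from now on gets a larger stamp than w, so it merely moves from the first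
alternative to the second: the set is fixed once w is in the tree. -/
lemma later_expand (hval : Valid H r s) (hw : w ∈ s.verts) :
    C.later (expand H s v) w = C.later s w := by
  ext u
  simp only [later, Set.mem_ofPred_eq]
  refine and_congr_right fun _ => ?_
  rw [expand_stamp_of_notMem (notMem_outer hw)]
  have := hval.stamp_le w hw
  by_cases huo : u ∈ outer H s v
  · rw [expand_stamp_of_mem huo, mem_expand_verts]
    have h1 := huo.2
    simp only [huo, or_true, not_true_eq_false, h1, not_false_eq_true, false_or, true_or, iff_true]
    left; omega
  · rw [expand_stamp_of_notMem huo, mem_expand_verts]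
    tauto

lemma gain_ge_two (hu : u ∉ s₀.verts) (h : u ∉ C.K ∨ Doomed H s u) :
    2 ≤ C.weight s u - C.oldWeight s₀ u := by
  rw [C.oldWeight_of_notMem hu]
  rcases h with h | h
  · linarith [C.weight_nonneg (s := s) h]
  · linarith [C.weight_nonneg_of_doomed h]

variable [Fintype V]

/-- The potential of a state in which O1 applies nowhere. -/
noncomputable def potential (s : State V) : ℤ :=
  6 * (tips s).card - 2 * s.verts.ncard + ∑ u ∈ tips s, C.weight s u

/-- The potential during a series of operations that started from the state `s₀`. -/
noncomputable def balance (s₀ s : State V) : ℤ :=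
  6 * (tips s).card - 2 * s.verts.ncard + ∑ u ∈ tips s, C.oldWeight s₀ u

/-- With weights at least −2 the potential is at least 6t − 4t − 2t for t tips. -/
lemma potential_nonneg_of_root (h : (s.verts.ncard : ℤ) ≤ 2 * (tips s).card) :
    0 ≤ C.potential s := by
  have : ∑ u ∈ tips s, (-2 : ℤ) ≤ ∑ u ∈ tips s, C.weight s u :=
    Finset.sum_le_sum fun u _ => C.weight_ge
  rw [Finset.sum_const, nsmul_eq_mul] at this
  unfold potential
  linarith

lemma potential_eq (s₀ s : State V) : C.potential s =
    C.balance s₀ s + ∑ u ∈ tips s, (C.weight s u - C.oldWeight s₀ u) := by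
  rw [Finset.sum_sub_distrib, potential, balance]
  ring

/-- The vertices added by the last expansion. -/
def lastGroup (s : State V) : Set V := {u | u ∈ s.verts ∧ s.stamp u = s.clock}

end CycleCover

open CycleCover

lemma Valid.lastGroup_expand (h : Valid H r s) : lastGroup (expand H s v) = outer H s v := by
  ext u
  simp only [lastGroup, Set.mem_ofPred_eq, expand_clock]
  constructor
  · rintro ⟨h1, h2⟩
    by_contra hc
    rw [expand_stamp_of_notMem hc] at h2
    have := h.stamp_le u (h1.resolve_right hc)
    omega
  · exact fun hu => ⟨Or.inr hu, expand_stamp_of_mem hu⟩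

end Branching

/-! ### The account kept during a series of operations O1 -/

namespace Branching

open CycleCover

variable {V : Type u} [Fintype V] {H : SimpleGraph V} {s s₀ t : State V} {r u v w x y : V}

/-! ### Series of operations between two states in which O1 applies nowhere -/

/-- The state `s` was reached from `s₀`, where O1 applies nowhere, by an operation that expanded
two vertices in succession and operations O1. -/
structure InSeries (C : CycleCover H) (s₀ s : State V) : Prop where
  noO1 : NoO1 H s₀
  subset : s₀.verts ⊆ s.verts
  mono : ∀ u ∈ s₀.verts, C.weight s₀ u ≤ C.weight s u
  last_tips : ∀ u ∈ lastGroup s, u ∉ s₀.verts ∧ u ∈ tips s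
  last_card : 2 ≤ (lastGroup s).ncard
  bal : -2 ≤ C.balance s₀ s ∨ -4 ≤ C.balance s₀ s ∧ (lastGroup s).ncard = 2 ∧
    ∀ w ∈ C.K, w ∈ s.verts → w ∉ s₀.verts → s.stamp w < s.clock → (C.later s w).ncard ≤ 2

lemma NoO1.ncard_outer_le {s₀ s : State V} (h : NoO1 H s₀) (hs : s₀.verts ⊆ s.verts)
    (hu : u ∈ s₀.verts) : (outer H s u).ncard ≤ 1 :=
  (ncard_outer_mono hs u).trans (h.ncard_le hu)

lemma Valid.lastGroup_subset_tips (hval : Valid H r s) (hv : v ∈ s.verts)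
    (ho : (outer H s v).Nonempty) : ∀ u ∈ lastGroup (expand H s v), u ∈ tips (expand H s v) := by
  classical
  intro u hu
  rw [hval.lastGroup_expand] at hu
  rw [hval.tips_expand hv ho, Finset.mem_union]
  exact Or.inr (Set.mem_toFinset.2 hu)

/-- With k children of x there are k − 1 more tips, k + 1 more vertices and k tips booked at −2,
while v leaves with weight 0. The change is 6(k − 1) − 2(k + 1) − 2k = 2k − 8. -/
lemma InSeries.start (C : CycleCover H) (hval : Valid H r s) (hN : NoO1 H s)
    (hpot : 0 ≤ C.potential s) (hv : v ∈ s.verts) (hvK : v ∉ C.K) (hvd : ¬ Doomed H s v)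
    (hx : outer H s v = {x}) (hxK : x ∉ C.K) (hk : 2 ≤ (outer H s x).ncard) :
    InSeries C s (expand H (expand H s v) x) := by
  have hxv : x ∈ outer H s v := by rw [hx]; rfl
  have hx1 : x ∈ (expand H s v).verts := Or.inr hxv
  have hval1 := hval.valid_expand hv
  have hox := outer_expand_of_singleton hx
  have hov := outer_nonempty_of_eq_singleton hx
  have hox' : (outer H (expand H s v) x).Nonempty := by
    rw [hox]; exact outer_nonempty_of_two_le hk
  have hbal : C.balance s (expand H (expand H s v) x) =
      C.potential s + 2 * (outer H s x).ncard - 8 := by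
    have e1 := hval1.sum_tips_expand_const hx1 hox' (C.oldWeight s) (-2)
      (fun u hu => C.oldWeight_of_notMem (fun h => hu.2 (subset_expand h)))
    have e2 := hval.sum_tips_expand_const hv hov (C.oldWeight s) (-2)
      (fun u hu => C.oldWeight_of_notMem hu.2)
    have e3 : ∑ u ∈ tips s, C.oldWeight s u = ∑ u ∈ tips s, C.weight s u :=
      Finset.sum_congr rfl fun u hu => C.oldWeight_of_mem (mem_tips.1 hu).1
    have e4 := hval1.card_tips_expand hx1 hox'
    have e5 := hval.card_tips_expand hv hov
    have e6 := card_verts_expand (H := H) (s := expand H s v) (v := x)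
    have e7 := card_verts_expand (H := H) (s := s) (v := v)
    have e8 : C.oldWeight s v = 0 := by
      rw [C.oldWeight_of_mem hv, C.weight_eq_zero hvK hvd]
    have e9 : C.oldWeight s x = -2 := C.oldWeight_of_notMem hxv.2
    have e10 : (outer H s v).ncard = 1 := by rw [hx, Set.ncard_singleton]
    rw [hox] at e1 e4 e6
    rw [e10] at e2 e5 e7
    rw [balance, potential, e4, e5, e6, e7, e1, e2, e3, e8, e9]
    push_cast
    ring
  refine ⟨hN, subset_expand.trans subset_expand, fun u hu => ?_, fun u hu => ⟨?_, ?_⟩, ?_, ?_⟩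
  · refine (C.weight_mono_expand (v := v) hu (hN.ncard_le hu) (hval.stamp_le u hu)).trans
      (C.weight_mono_expand (subset_expand hu) (hN.ncard_outer_le subset_expand hu) ?_)
    exact hval1.stamp_le u (subset_expand hu)
  · rw [hval1.lastGroup_expand] at hu
    exact fun h => hu.2 (subset_expand h)
  · exact hval1.lastGroup_subset_tips hx1 hox' u hu
  · rwa [hval1.lastGroup_expand, hox]
  · rw [hval1.lastGroup_expand, hox, hbal]
    rcases hk.lt_or_eq with hk | hk
    · left
      have : (3 : ℤ) ≤ (outer H s x).ncard := by exact_mod_cast hk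
      linarith
    · right
      -- The condition on `later` is vacuous here: x is not in K, so all new vertices of K belong to
      -- the last group.
      refine ⟨by rw [← hk]; push_cast; linarith, hk.symm, fun w hwK hw hw0 hst => ?_⟩
      rcases hw with hw | hw
      · rcases hw with hw | hw
        · exact absurd hw hw0
        · rw [hx] at hw
          rw [hw] at hwK
          exact absurd hwK hxK
      · rw [expand_stamp_of_mem hw] at hst
        exact absurd hst (lt_irrefl _)

/-- An O1 with k new vertices changes the account by 6(k − 1) − 2k − 2k + 2 = 2k − 4. For k ≥ 3 a
deficit of 4 drops to 2. For k = 2 the bound on `later` must be established for the group that has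
just ceased to be the last one. -/
lemma InSeries.expand {C : CycleCover H} (h : InSeries C s₀ s) (hval : Valid H r s)
    (hvK : v ∉ C.K) (hv : O1 H s v)
    (largest : ∀ w, O1 H s w → (outer H s w).ncard ≤ (outer H s v).ncard)
    (dfs : ∀ w, O1 H s w → (outer H s w).ncard = (outer H s v).ncard → s.stamp w ≤ s.stamp v) :
    InSeries C s₀ (expand H s v) := by
  -- Vertices of the starting state have at most one outside neighbour, so O1 only acts on new
  -- vertices.
  have hv0 : v ∉ s₀.verts := fun h' => by
    have := h.noO1.ncard_outer_le h.subset h'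
    have := hv.2
    omega
  have ho := outer_nonempty_of_two_le hv.2
  have hbal : C.balance s₀ (Branching.expand H s v) =
      C.balance s₀ s + 2 * (outer H s v).ncard - 4 := by
    have e1 := hval.sum_tips_expand_const hv.1 ho (C.oldWeight s₀) (-2)
      (fun u hu => C.oldWeight_of_notMem (fun h' => hu.2 (h.subset h')))
    have e2 := hval.card_tips_expand hv.1 ho
    have e3 := card_verts_expand (H := H) (s := s) (v := v)
    have e4 : C.oldWeight s₀ v = -2 := C.oldWeight_of_notMem hv0
    rw [balance, balance, e1, e2, e3, e4]
    ring
  refine ⟨h.noO1, h.subset.trans subset_expand, fun u hu => ?_, fun u hu => ⟨?_, ?_⟩, ?_, ?_⟩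
  · exact (h.mono u hu).trans (C.weight_mono_expand (h.subset hu)
      (h.noO1.ncard_outer_le h.subset hu) (hval.stamp_le u (h.subset hu)))
  · rw [hval.lastGroup_expand] at hu
    exact fun h' => hu.2 (h.subset h')
  · exact hval.lastGroup_subset_tips hv.1 ho u hu
  · rw [hval.lastGroup_expand]; exact hv.2
  rw [hval.lastGroup_expand, hbal]
  have h2 : (2 : ℤ) ≤ (outer H s v).ncard := by exact_mod_cast hv.2
  rcases h.bal with hb | ⟨hb, hcard, hlater⟩
  · left; linarith
  rcases hv.2.lt_or_eq with hk | hk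
  · left
    have : (3 : ℤ) ≤ (outer H s v).ncard := by exact_mod_cast hk
    linarith
  right
  refine ⟨by linarith, hk.symm, fun w hwK hw hw0 hst => ?_⟩
  have hwv : w ∉ outer H s v := fun hwv => by
    rw [expand_stamp_of_mem hwv] at hst
    exact lt_irrefl _ hst
  have hws := hw.resolve_right hwv
  rw [C.later_expand hval hws]
  rw [expand_stamp_of_notMem hwv, expand_clock] at hst
  rcases (hval.stamp_le w hws).lt_or_eq with hst' | hst'
  · exact hlater w hwK hws hw0 hst'
  -- Now w is in the group that was last before this expansion: what is `later` than w is still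
  -- outside or is a sibling in K.
  have hsub : C.later s w ⊆ outer H s w ∪ ({u ∈ lastGroup s | u ∈ C.K} \ {w}) := by
    rintro u ⟨hu1, hu2⟩
    by_cases hus : u ∈ s.verts
    · right
      have := hval.stamp_le u hus
      rcases hu2 with hu2 | hu2 | hu2
      · exact absurd hus hu2
      · omega
      · exact ⟨⟨⟨hus, hu2.1.trans hst'⟩, hu2.2⟩, hu1.ne'⟩
    · exact Or.inl ⟨hu1, hus⟩
  have hle := (Set.ncard_le_ncard hsub (Set.toFinite _)).trans (Set.ncard_union_le _ _)
  have how : (outer H s w).ncard ≤ 2 := by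
    by_contra hc
    have := largest w ⟨hws, by omega⟩
    omega
  have hwl : w ∈ lastGroup s := ⟨hws, hst'⟩
  -- If v is the sibling of w, it is not in K and only outside neighbours count, at most two because
  -- v was a largest choice. If v is older, w cannot have two outside neighbours, or it would have
  -- been preferred to v; so there is one at most, plus one sibling.
  by_cases hvl : v ∈ lastGroup s
  · have : {u ∈ lastGroup s | u ∈ C.K} \ {w} = ∅ := by
      have hne : v ≠ w := fun h => hvK (h ▸ hwK)
      have h3 : ({v, w} : Set V) ⊆ lastGroup s := by
        rintro a (rfl | rfl)
        · exact hvl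
        · exact hwl
      have h4 := Set.eq_of_subset_of_ncard_le h3 (by rw [hcard, Set.ncard_pair hne])
        (Set.toFinite _)
      ext a
      simp only [← h4, Set.mem_sdiff, Set.mem_insert_iff, Set.mem_singleton_iff,
        Set.mem_empty_iff_false, iff_false]
      rintro ⟨⟨rfl | rfl, h5⟩, h6⟩
      · exact hvK h5
      · exact h6 rfl
    rw [this, Set.ncard_empty] at hle
    omega
  · have how1 : (outer H s w).ncard ≤ 1 := by
      by_contra hc
      have := dfs w ⟨hws, by omega⟩ (by omega)
      exact hvl ⟨hv.1, le_antisymm (hval.stamp_le v hv.1) (hst' ▸ this)⟩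
    have h3 : ({u ∈ lastGroup s | u ∈ C.K} \ {w}).ncard ≤ 1 := by
      have h4 : {u ∈ lastGroup s | u ∈ C.K} \ {w} ⊆ lastGroup s \ {w} :=
        fun a ha => ⟨ha.1.1, ha.2⟩
      have h5 := Set.ncard_le_ncard h4 (Set.toFinite _)
      rw [Set.ncard_sdiff_singleton_of_mem hwl] at h5
      omega
    omega

end Branching

/-- Being injective on the finite set A, f permutes it, and g is the inverse permutation there. -/
lemma Finset.mapsTo_leftInverse {α : Type*} {A : Finset α} {f g : α → α}
    (hgf : ∀ a ∈ A, g (f a) = a) (hf : ∀ a ∈ A, f a ∈ A) : ∀ a ∈ A, g a ∈ A := by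
  classical
  intro a ha
  have hinj : Set.InjOn f A := fun x hx y hy h => by rw [← hgf x hx, ← hgf y hy, h]
  have himg : A.image f = A :=
    Finset.eq_of_subset_of_card_le (Finset.image_subset_iff.2 hf)
      (by rw [Finset.card_image_of_injOn hinj])
  rw [← himg, Finset.mem_image] at ha
  obtain ⟨b, hb, rfl⟩ := ha
  rwa [hgf b hb]

/-! ### Recovering the deficit, and the resulting bound on the number of leaves -/

namespace Branching

open CycleCover

variable {V : Type u} [Fintype V] {H : SimpleGraph V} {s s₀ t : State V} {r u v w x y : V}

section Gain

variable {C : CycleCover H}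

lemma InSeries.gain_nonneg (h : InSeries C s₀ s) (u : V) :
    0 ≤ C.weight s u - C.oldWeight s₀ u := by
  by_cases hu : u ∈ s₀.verts
  · rw [C.oldWeight_of_mem hu]; linarith [h.mono u hu]
  · rw [C.oldWeight_of_notMem hu]; linarith [C.weight_ge (s := s) (u := u)]

lemma InSeries.potential_ge (h : InSeries C s₀ s) (A : Finset V) (hA : A ⊆ tips s) :
    C.balance s₀ s + ∑ u ∈ A, (C.weight s u - C.oldWeight s₀ u) ≤ C.potential s := by
  rw [C.potential_eq s₀ s]
  have := Finset.sum_le_sum_of_subset_of_nonneg hA (fun u _ _ => h.gain_nonneg u)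
  linarith

/-- A successor (or predecessor) that is not new yields a gain. -/
lemma InSeries.exists_gain (h : InSeries C s₀ s)
    {f g : V → V} (hfg : f = C.nxt ∧ g = C.prv ∨ f = C.prv ∧ g = C.nxt)
    {e : V} (heK : e ∈ C.K) (hes : e ∈ s.verts) (he0 : e ∉ s₀.verts) (hed : ¬ Doomed H s e)
    (hfe : ¬ (f e ∈ s.verts ∧ f e ∉ s₀.verts)) :
    ∃ a ∈ C.K, a ∈ s.verts ∧ 1 ≤ C.weight s a - C.oldWeight s₀ a ∧
      (a ∉ s₀.verts ∧ f a ∉ s.verts ∨ a ∈ s₀.verts ∧ g a ∉ s₀.verts) := by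
  have hfK : f e ∈ C.K := by
    rcases hfg with ⟨rfl, rfl⟩ | ⟨rfl, rfl⟩
    · exact C.nxt_mem e heK
    · exact C.prv_mem e heK
  have hadj : H.Adj e (f e) := by
    rcases hfg with ⟨rfl, rfl⟩ | ⟨rfl, rfl⟩
    · exact C.nxt_adj e heK
    · exact C.prv_adj e heK
  have hgf : g (f e) = e := by
    rcases hfg with ⟨rfl, rfl⟩ | ⟨rfl, rfl⟩
    · exact C.prv_nxt e heK
    · exact C.nxt_prv e heK
  -- If f e is an old vertex, e was its only outside neighbour, so its weight rises from −1 to that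
  -- of a doomed vertex. If f e is outside, e itself has weight −1 instead of the booked −2.
  by_cases hfs : f e ∈ s.verts
  · have hf0 : f e ∈ s₀.verts := by tauto
    have heo : e ∈ outer H s₀ (f e) := ⟨hadj.symm, he0⟩
    refine ⟨f e, hfK, hfs, ?_, Or.inr ⟨hf0, by rwa [hgf]⟩⟩
    have h1 : Doomed H s (f e) := Or.inl (h.noO1.eq_empty hf0 heo h.subset hes)
    have h2 : ¬ Doomed H s₀ (f e) := fun hd => C.notMem_of_doomed hd heo heK
    have h3 : C.weight s₀ (f e) = -1 := by
      refine C.weight_eq_neg_one hfK h2 ?_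
      rcases hfg with ⟨rfl, rfl⟩ | ⟨rfl, rfl⟩
      · right; rwa [hgf]
      · left; rwa [hgf]
    rw [C.oldWeight_of_mem hf0, h3]
    linarith [C.weight_nonneg_of_doomed h1]
  · refine ⟨e, heK, hes, ?_, Or.inl ⟨he0, hfs⟩⟩
    have : C.weight s e = -1 := by
      refine C.weight_eq_neg_one heK hed ?_
      rcases hfg with ⟨rfl, rfl⟩ | ⟨rfl, rfl⟩
      · exact Or.inl hfs
      · exact Or.inr hfs
    rw [C.oldWeight_of_notMem he0, this]
    norm_num

lemma InSeries.potential_nonneg (h : InSeries C s₀ s) (hval : Valid H r s) (hN : NoO1 H s)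
    (hP : Proceeds H C.K s) (hK : ∀ u ∈ C.K, u ∈ s.verts → u ∈ tips s) :
    0 ≤ C.potential s := by
  classical
  have pair : ∀ a b, a ≠ b → a ∈ tips s → b ∈ tips s →
      C.balance s₀ s + ((C.weight s a - C.oldWeight s₀ a) + (C.weight s b - C.oldWeight s₀ b)) ≤
        C.potential s := by
    intro a b hab ha hb
    have := h.potential_ge {a, b} (by
      intro z hz
      rcases Finset.mem_insert.1 hz with rfl | hz
      · exact ha
      · rwa [Finset.mem_singleton.1 hz])
    rwa [Finset.sum_pair hab] at this
  have hbal : -4 ≤ C.balance s₀ s := by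
    rcases h.bal with hb | hb
    · linarith
    · exact hb.1
  -- The last group has at least two vertices; if they are doomed, they gain 2 each and cover the
  -- whole deficit.
  by_cases hall : ∀ y ∈ lastGroup s, Doomed H s y
  · obtain ⟨a, b, ha, hb, hab⟩ := (Set.one_lt_ncard_iff (Set.toFinite _)).1 h.last_card
    have h1 := pair a b hab (h.last_tips a ha).2 (h.last_tips b hb).2
    have h2 := C.gain_ge_two (h.last_tips a ha).1 (Or.inr (hall a ha))
    have h3 := C.gain_ge_two (h.last_tips b hb).1 (Or.inr (hall b hb))
    linarith
  push Not at hall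
  obtain ⟨y₀, hy₀, hy₀d⟩ := hall
  obtain ⟨v, hv, hvK, hvst⟩ := hP.exists_later hN hy₀.1 hy₀d
  have hvl : v ∈ lastGroup s := ⟨hv, le_antisymm (hval.stamp_le v hv) (hy₀.2 ▸ hvst)⟩
  have hgv := C.gain_ge_two (s := s) (h.last_tips v hvl).1 (Or.inl hvK)
  have hvt := (h.last_tips v hvl).2
  have two : ∀ a, a ≠ v → a ∈ tips s → 2 ≤ C.weight s a - C.oldWeight s₀ a →
      0 ≤ C.potential s := by
    intro a hav ha hg
    have := pair v a hav.symm hvt ha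
    linarith
  rcases h.bal with hb | ⟨-, hcard, hlater⟩
  · have := h.potential_ge {v} (by simpa using hvt)
    rw [Finset.sum_singleton] at this
    linarith
  obtain ⟨y, hyl, hyv⟩ := Set.exists_ne_of_one_lt_ncard h.last_card v
  by_cases hyK : y ∈ C.K
  swap
  · exact two y hyv (h.last_tips y hyl).2 (C.gain_ge_two (h.last_tips y hyl).1 (Or.inl hyK))
  -- The vertices of K added during the series; the 2 units still missing come from the places where
  -- the cycles enter and leave A.
  let A : Finset V := C.K.filter fun u => u ∈ s.verts ∧ u ∉ s₀.verts
  have hA : ∀ {u}, u ∈ A ↔ u ∈ C.K ∧ u ∈ s.verts ∧ u ∉ s₀.verts := by simp [A]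
  have hyA : y ∈ A := hA.2 ⟨hyK, hyl.1, (h.last_tips y hyl).1⟩
  by_cases hdA : ∃ u ∈ A, Doomed H s u
  · obtain ⟨u, hu, hud⟩ := hdA
    rw [hA] at hu
    exact two u (fun h => hvK (h ▸ hu.1)) (hK u hu.1 hu.2.1) (C.gain_ge_two hu.2.2 (Or.inr hud))
  push Not at hdA
  by_cases hcl : ∀ u ∈ A, C.nxt u ∈ A
  · exfalso
    have hcl' : ∀ u ∈ A, C.prv u ∈ A :=
      Finset.mapsTo_leftInverse (fun a ha => C.prv_nxt a (hA.1 ha).1) hcl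
    obtain ⟨w, hwA, hmin⟩ := Finset.exists_min_image A s.stamp ⟨y, hyA⟩
    have hw := hA.1 hwA
    have hn := hA.1 (hcl w hwA)
    have hp := hA.1 (hcl' w hwA)
    -- Otherwise v, w and the successor of w would be three members of the last group, which has
    -- two.
    have hst : s.stamp w < s.clock := by
      refine lt_of_le_of_ne (hval.stamp_le w hw.2.1) fun heq => ?_
      have h1 : C.nxt w ∈ lastGroup s :=
        ⟨hn.2.1, le_antisymm (hval.stamp_le _ hn.2.1) (heq ▸ hmin _ (hcl w hwA))⟩
      have h2 : w ∈ lastGroup s := ⟨hw.2.1, heq⟩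
      have h3 : ({v, w, C.nxt w} : Set V) ⊆ lastGroup s := by
        rintro a (rfl | rfl | rfl)
        · exact hvl
        · exact h2
        · exact h1
      have h4 := Set.ncard_le_ncard h3 (Set.toFinite _)
      rw [Set.ncard_eq_three.2 ⟨v, w, C.nxt w, fun h => hvK (h ▸ hw.1),
        fun h => hvK (h ▸ hn.1), (C.nxt_adj w hw.1).ne, rfl⟩] at h4
      omega
    have hle := hlater w hw.1 hw.2.1 hw.2.2 hst
    have hne : (outer H s w).Nonempty := by
      rw [Set.nonempty_iff_ne_empty]
      exact fun h => hdA w hwA (Or.inl h)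
    obtain ⟨x, hx⟩ := hne
    -- As w is the earliest vertex of A, its cycle neighbours are added later or together with it;
    -- the clause on K in `later` is there for the second case.
    have h3 : ({x, C.nxt w, C.prv w} : Set V) ⊆ C.later s w := by
      rintro a (rfl | rfl | rfl)
      · exact ⟨hx.1, Or.inl hx.2⟩
      · refine ⟨C.nxt_adj w hw.1, Or.inr ?_⟩
        have := hmin _ (hcl w hwA)
        rcases this.lt_or_eq with h | h
        · exact Or.inl h
        · exact Or.inr ⟨h.symm, hn.1⟩
      · refine ⟨C.prv_adj w hw.1, Or.inr ?_⟩
        have := hmin _ (hcl' w hwA)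
        rcases this.lt_or_eq with h | h
        · exact Or.inl h
        · exact Or.inr ⟨h.symm, hp.1⟩
    have h4 := Set.ncard_le_ncard h3 (Set.toFinite _)
    rw [Set.ncard_eq_three.2 ⟨x, C.nxt w, C.prv w, fun h => hx.2 (h ▸ hn.2.1),
      fun h => hx.2 (h ▸ hp.2.1), C.nxt_ne_prv w hw.1, rfl⟩] at h4
    omega
  have hcl' : ¬ ∀ u ∈ A, C.prv u ∈ A := fun h =>
    hcl (Finset.mapsTo_leftInverse (fun a ha => C.nxt_prv a (hA.1 ha).1) h)
  push Not at hcl hcl'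
  obtain ⟨e₁, he₁, hn₁⟩ := hcl
  obtain ⟨e₂, he₂, hn₂⟩ := hcl'
  have he₁' := hA.1 he₁
  have he₂' := hA.1 he₂
  obtain ⟨a, haK, has, hga, ha⟩ := h.exists_gain (Or.inl ⟨rfl, rfl⟩) he₁'.1 he₁'.2.1 he₁'.2.2
    (hdA _ he₁) (fun h' => hn₁ (hA.2 ⟨C.nxt_mem _ he₁'.1, h'⟩))
  obtain ⟨b, hbK, hbs, hgb, hb⟩ := h.exists_gain (Or.inr ⟨rfl, rfl⟩) he₂'.1 he₂'.2.1 he₂'.2.2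
    (hdA _ he₂) (fun h' => hn₂ (hA.2 ⟨C.prv_mem _ he₂'.1, h'⟩))
  -- One vertex cannot provide both gains: it would have two cycle neighbours outside the tree, now
  -- or at the start of the series, and O1 would apply to it.
  have hab : a ≠ b := by
    rintro rfl
    rcases ha with ha | ha <;> rcases hb with hb | hb
    · have h1 := hN.eq_singleton has (⟨C.nxt_adj a haK, ha.2⟩ : C.nxt a ∈ outer H s a)
      have h2 : C.prv a ∈ outer H s a := ⟨C.prv_adj a haK, hb.2⟩
      rw [h1] at h2
      exact C.nxt_ne_prv a haK h2.symm
    · exact ha.1 hb.1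
    · exact hb.1 ha.1
    · have h1 := h.noO1.eq_singleton ha.1 (⟨C.nxt_adj a haK, hb.2⟩ : C.nxt a ∈ outer H s₀ a)
      have h2 : C.prv a ∈ outer H s₀ a := ⟨C.prv_adj a haK, ha.2⟩
      rw [h1] at h2
      exact C.nxt_ne_prv a haK h2.symm
  have hva : v ≠ a := fun h => hvK (h ▸ haK)
  have hvb : v ≠ b := fun h => hvK (h ▸ hbK)
  have := h.potential_ge {v, a, b} (by
    intro z hz
    simp only [Finset.mem_insert, Finset.mem_singleton] at hz
    rcases hz with rfl | rfl | rfl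
    · exact hvt
    · exact hK _ haK has
    · exact hK _ hbK hbs)
  rw [Finset.sum_insert (by simp [hva, hvb]), Finset.sum_pair hab] at this
  linarith

/-- An operation O2 after which O1 applies nowhere does not decrease the potential. -/
lemma potential_le_expand (C : CycleCover H) (hval : Valid H r s) (hN : NoO1 H s)
    (hvK : v ∉ C.K) (hO : O2 H s v x) (hd : ¬ Doomed H s v)
    (hN' : NoO1 H (expand H s v)) (hP : Proceeds H C.K (expand H s v)) :
    C.potential s ≤ C.potential (expand H s v) := by
  classical
  obtain ⟨hv, hx, hO⟩ := hO
  have hxv : x ∈ outer H s v := by rw [hx]; rfl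
  have hval' := hval.valid_expand hv
  have ho := outer_nonempty_of_eq_singleton hx
  have hxs : x ∈ (expand H s v).verts := Or.inr hxv
  set t := expand H s v with ht
  have e1 := hval.sum_tips_expand hv ho (C.weight t)
  have e2 := hval.card_tips_expand hv ho
  have e3 := card_verts_expand (H := H) (s := s) (v := v)
  have e4 : (outer H s v).toFinset = {x} := by ext z; simp [hx]
  have e5 : (outer H s v).ncard = 1 := by rw [hx, Set.ncard_singleton]
  rw [e4, Finset.sum_singleton, ← ht] at e1
  rw [e5, ← ht] at e2 e3
  have e6 := Finset.sum_erase_eq_sub (f := C.weight s) (hval.mem_tips_of_outer hv ho)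
  rw [C.weight_eq_zero hvK hd] at e6
  have e7 : ∑ u ∈ (tips s).erase v, C.weight t u - ∑ u ∈ (tips s).erase v, C.weight s u =
      ∑ u ∈ (tips s).erase v, (C.weight t u - C.weight s u) := by rw [Finset.sum_sub_distrib]
  have hmono : ∀ u ∈ (tips s).erase v, 0 ≤ C.weight t u - C.weight s u := by
    intro u hu
    have hus := (mem_tips.1 (Finset.mem_of_mem_erase hu)).1
    linarith [C.weight_mono_expand (v := v) hus (hN.ncard_le hus) (hval.stamp_le u hus)]
  -- The number of tips is unchanged and v had weight 0, so only the cost 2 of the vertex x has to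
  -- be repaid.
  have suff : 2 ≤ C.weight t x + ∑ u ∈ (tips s).erase v, (C.weight t u - C.weight s u) →
      C.potential s ≤ C.potential t := by
    intro h
    rw [potential, potential, e1, e2, e3]
    push_cast
    linarith
  have hempty : ∀ u ∈ s.verts, H.Adj u x → Doomed H t u := fun u hu hux =>
    Or.inl (hN.eq_empty hu ⟨hux, hxv.2⟩ subset_expand hxs)
  have herase : ∀ u ∈ s.verts, H.Adj u x → u ≠ v → u ∈ (tips s).erase v := fun u hu hux huv =>
    Finset.mem_erase.2 ⟨huv, hval.mem_tips_of_outer hu ⟨x, hux, hxv.2⟩⟩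
  have hsum0 := Finset.sum_nonneg hmono
  by_cases hxK : x ∈ C.K
  -- Since x alone carries the newest stamp, an undoomed x would have to be expanded next, contrary
  -- to x ∈ K. Both cycle neighbours of x then lie in the tree, and they gain 1 each by losing their
  -- last outside neighbour.
  · have hxd : Doomed H t x := by
      by_contra hxd
      obtain ⟨w, hw, hwK, hst⟩ := hP.exists_later hN' hxs hxd
      rw [ht, expand_stamp_of_mem hxv] at hst
      have : w ∈ outer H s v := by
        rw [← hval.lastGroup_expand]
        exact ⟨hw, le_antisymm (hval'.stamp_le w hw) hst⟩
      rw [hx] at this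
      exact hwK (this ▸ hxK)
    have hin : ∀ z ∈ C.K, H.Adj x z → z ∈ s.verts := by
      intro z hz hxz
      by_contra hzs
      have hzt : z ∉ t.verts := by
        rintro (h | h)
        · exact hzs h
        · rw [hx] at h
          exact hxz.ne h.symm
      exact C.notMem_of_doomed hxd ⟨hxz, hzt⟩ hz
    have hgain : ∀ z ∈ C.K, H.Adj x z → (C.nxt z = x ∨ C.prv z = x) →
        z ∈ (tips s).erase v ∧ 1 ≤ C.weight t z - C.weight s z := by
      intro z hz hxz hzx
      have hzs := hin z hz hxz
      refine ⟨herase z hzs hxz.symm (fun h => hvK (h ▸ hz)), ?_⟩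
      have h1 : ¬ Doomed H s z := fun hd =>
        C.notMem_of_doomed hd (⟨hxz.symm, hxv.2⟩ : x ∈ outer H s z) hxK
      have h2 : C.weight s z = -1 := by
        refine C.weight_eq_neg_one hz h1 ?_
        rcases hzx with h | h
        · left; rw [h]; exact hxv.2
        · right; rw [h]; exact hxv.2
      linarith [C.weight_nonneg_of_doomed (hempty z hzs hxz.symm)]
    obtain ⟨h1, h2⟩ := hgain _ (C.nxt_mem x hxK) (C.nxt_adj x hxK) (Or.inr (C.prv_nxt x hxK))
    obtain ⟨h3, h4⟩ := hgain _ (C.prv_mem x hxK) (C.prv_adj x hxK) (Or.inl (C.nxt_prv x hxK))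
    refine suff ?_
    have h5 := Finset.sum_le_sum_of_subset_of_nonneg
      (Finset.insert_subset h1 (Finset.singleton_subset_iff.2 h3)) (fun u hu _ => hmono u hu)
    rw [Finset.sum_pair (C.nxt_ne_prv x hxK)] at h5
    linarith [C.weight_nonneg_of_doomed hxd]
  by_cases hxd : Doomed H t x
  · exact suff (by linarith [C.weight_eq_two hxK hxd])
  refine suff ?_
  have hox : outer H t x = outer H s x := outer_expand_of_singleton hx
  -- Now O2 must owe its applicability to a second tree neighbour u of x, and u becomes doomed: from
  -- 0 to 2 outside K, from −2 to at least 0 in K.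
  have hO2 : 2 ≤ (H.neighborSet x ∩ s.verts).ncard := by
    refine hO.resolve_left fun h => hxd (Or.inl (by rw [hox, h]))
  obtain ⟨u, hu, huv⟩ := Set.exists_ne_of_one_lt_ncard hO2 v
  have hux : H.Adj u x := hu.1.symm
  -- If u was doomed before, x had only the neighbours u and v, and would now be doomed itself.
  have hud : ¬ Doomed H s u := by
    intro hd
    obtain ⟨w, h1, h2, -⟩ := hd.neighborSet_eq
      (hN.eq_singleton hu.2 (⟨hux, hxv.2⟩ : x ∈ outer H s u))
    apply hxd
    left
    rw [hox]
    ext z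
    simp only [Set.mem_empty_iff_false, iff_false]
    intro hz
    have h3 : z ∈ H.neighborSet x := hz.1
    have h4 : v ∈ H.neighborSet x := hxv.1.symm
    rw [h1] at h3 h4
    have h5 : z ≠ u := fun h => hz.2 (h ▸ hu.2)
    have h6 : z ≠ v := fun h => hz.2 (h ▸ hv)
    simp only [Set.mem_insert_iff, Set.mem_singleton_iff] at h3 h4
    grind
  have h5 := Finset.sum_le_sum_of_subset_of_nonneg
      (Finset.singleton_subset_iff.2 (herase u hu.2 hux huv)) (fun u hu _ => hmono u hu)
  rw [Finset.sum_singleton] at h5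
  have hud' := hempty u hu.2 hux
  have h6 := C.weight_nonneg (s := t) hxK
  by_cases huK : u ∈ C.K
  · have hin : ∀ z ∈ C.K, H.Adj u z → z ∈ s.verts := by
      intro z hz huz
      by_contra hzs
      have : z ∈ outer H s u := ⟨huz, hzs⟩
      rw [hN.eq_singleton hu.2 (⟨hux, hxv.2⟩ : x ∈ outer H s u)] at this
      exact hxK (this ▸ hz)
    have h7 := C.weight_eq_neg_two huK hud (hin _ (C.nxt_mem u huK) (C.nxt_adj u huK))
      (hin _ (C.prv_mem u huK) (C.prv_adj u huK))
    linarith [C.weight_nonneg_of_doomed hud']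
  · linarith [C.weight_eq_two huK hud', C.weight_eq_zero huK hud]

end Gain

/-! ### The number of leaves -/

/-- The invariant of executions that do not expand vertices of `C.K`. -/
def Invariant (C : CycleCover H) (r : V) (s : State V) : Prop :=
  (s.verts.ncard : ℤ) ≤ 2 * (tips s).card ∨
  (NoO1 H s ∧ 0 ≤ C.potential s) ∨
  (∃ s₀, InSeries C s₀ s) ∨
  ∃ s₀ v x, NoO1 H s₀ ∧ 0 ≤ C.potential s₀ ∧ v ∉ C.K ∧ ¬ Doomed H s₀ v ∧ v ∈ s₀.verts ∧
    outer H s₀ v = {x} ∧ Valid H r s₀ ∧ s = expand H s₀ v ∧ ¬ NoO1 H s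

section

variable {C : CycleCover H}

lemma Invariant.potential_nonneg (h : Invariant C r s) (hval : Valid H r s) (hN : NoO1 H s)
    (hP : Proceeds H C.K s) (hK : ∀ u ∈ C.K, u ∈ s.verts → u ∈ tips s) :
    0 ≤ C.potential s := by
  rcases h with h | h | ⟨s₀, h⟩ | ⟨s₀, v, x, h⟩
  · exact C.potential_nonneg_of_root h
  · exact h.2
  · exact h.potential_nonneg hval hN hP hK
  · exact absurd hN h.2.2.2.2.2.2.2.2

lemma Invariant.step (h : Invariant C r s) (hval : Valid H r s) (hst : AvoidStep H C.K s t)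
    (hK : ∀ u ∈ C.K, u ∈ s.verts → u ∈ tips s) (hP : Proceeds H C.K t) : Invariant C r t := by
  have hP0 : Proceeds H C.K s := Or.inr ⟨t, hst⟩
  cases hst with
  | o1 v hvK hv largest dfs =>
    rcases h with h | h | ⟨s₀, h⟩ | ⟨s₀, v', x, h1, h2, h3, h4, h5, h6, h7, rfl, -⟩
    · left
      have ho := outer_nonempty_of_two_le hv.2
      rw [hval.card_tips_expand hv.1 ho, card_verts_expand]
      have : (2 : ℤ) ≤ (outer H s v).ncard := by exact_mod_cast hv.2
      linarith
    · exact absurd hv (h.1 v)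
    · exact Or.inr (Or.inr (Or.inl ⟨s₀, h.expand hval hvK hv largest dfs⟩))
    · refine Or.inr (Or.inr (Or.inl ⟨s₀, ?_⟩))
      -- After an O2 that enables O1, only x can have two outside neighbours; the pair of expansions
      -- is accounted for like an O3.
      have hvx : v = x := by
        rcases hv.1 with h | h
        · have := h1.ncard_outer_le (subset_expand (H := H) (v := v')) h
          have := hv.2
          omega
        · rw [h6] at h; exact h
      subst hvx
      have := hv.2
      rw [outer_expand_of_singleton h6] at this
      exact InSeries.start C h7 h1 h2 h5 h3 h4 h6 hvK this
  | o2 v x hvK hN hv dfs =>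
    have hpot := h.potential_nonneg hval hN hP0 hK
    have hd := hv.not_doomed hN dfs
    by_cases hN' : NoO1 H (expand H s v)
    · exact Or.inr (Or.inl ⟨hN', hpot.trans (potential_le_expand C hval hN hvK hv hd hN' hP)⟩)
    · exact Or.inr (Or.inr (Or.inr ⟨s, v, x, hN, hpot, hvK, hd, hv.1, hv.2.1, hval, rfl, hN'⟩))
  | o3 v x hvK hxK hN hv dfs =>
    have hpot := h.potential_nonneg hval hN hP0 hK
    exact Or.inr (Or.inr (Or.inl ⟨s,
      InSeries.start C hval hN hpot hv.1 hvK hv.not_doomed hv.2.1 hxK hv.2.2⟩))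

end

/-- An expanded vertex keeps a child forever, so a tip of the final tree was never expanded. -/
lemma Step.avoidStep {f : State V} {K : Finset V} (hst : Step H s t)
    (htf : Relation.ReflTransGen (Step H) t f) (hK : ∀ u ∈ K, u ∈ tips f) :
    AvoidStep H K s t := by
  have hext := extends_of_reflTransGen htf
  have key : ∀ (s' : State V) v, Extends (expand H s' v) f → v ∈ s'.verts →
      (outer H s' v).Nonempty → v ∉ K := by
    intro s' v he hv ho hvK
    obtain ⟨w, hw, hne⟩ := exists_child he hv ho
    exact hne ((mem_tips.1 (hK v hvK)).2 w hw)
  cases hst with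
  | o1 v hv l d => exact .o1 s v (key _ _ hext hv.1 (outer_nonempty_of_two_le hv.2)) hv l d
  | o2 v x n hv d =>
    exact .o2 s v x (key _ _ hext hv.1 (outer_nonempty_of_eq_singleton hv.2.1)) n hv d
  | o3 v x n hv d =>
    refine .o3 s v x (key _ _ (extends_expand.trans hext) hv.1
      (outer_nonempty_of_eq_singleton hv.2.1)) (key _ _ hext hv.mem_expand ?_) n hv d
    rw [outer_expand_of_singleton hv.2.1]
    exact outer_nonempty_of_two_le hv.2.2

/-- The bound on the number of leaves, for the final tree `f` of an execution. -/
theorem card_add_card_le_four_mul {f : State V} (hf : IsResult H r f) (huniv : f.verts = Set.univ)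
    (C : CycleCover H) (hC : ∀ u ∈ C.K, u ∈ tips f) :
    Fintype.card V + C.K.card ≤ 4 * (tips f).card := by
  classical
  have hproc : ∀ s, Relation.ReflTransGen (Step H) s f → Proceeds H C.K s := by
    intro s hs
    rcases hs.cases_head with rfl | ⟨t, h1, h2⟩
    · exact Or.inl hf.2
    · exact Or.inr ⟨t, h1.avoidStep h2 hC⟩
  have hKt : ∀ s, Relation.ReflTransGen (Step H) s f → Valid H r s →
      ∀ u ∈ C.K, u ∈ s.verts → u ∈ tips s := by
    intro s hs hval u hu hus
    refine mem_tips.2 ⟨hus, fun w hw => ?_⟩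
    by_cases hws : w ∈ s.verts
    · exact (mem_tips.1 (hC u hu)).2 w (((extends_of_reflTransGen hs).2 w hws).trans hw)
    · rw [← hval.parent_out w hws, hw]
  have hinv : ∀ s, Relation.ReflTransGen (Step H) (init r) s →
      Relation.ReflTransGen (Step H) s f → Invariant C r s := by
    intro s hs
    induction hs with
    | refl =>
      intro _
      left
      have h1 : r ∈ tips (init r) := mem_tips.2 ⟨rfl, fun w hw => hw⟩
      have h2 := Finset.card_pos.2 ⟨r, h1⟩
      have h3 : (init r).verts.ncard = 1 := Set.ncard_singleton r
      rw [h3]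
      push_cast
      omega
    | @tail s t h1 h2 ih =>
      intro h3
      have hval := (Valid.init H r).of_reflTransGen h1
      have h4 := Relation.ReflTransGen.head h2 h3
      exact (ih h4).step hval (h2.avoidStep h3 hC) (hKt s h4 hval) (hproc t h3)
  have hval := (Valid.init H r).of_reflTransGen hf.1
  have hpot := (hinv f hf.1 .refl).potential_nonneg hval (noO1_of_final hf.2)
    (hproc f .refl) (hKt f .refl hval)
  have hd : ∀ u, Doomed H f u := fun u => Or.inl (by ext z; simp [mem_outer, huniv])
  have hw : ∀ u, C.weight f u = 2 - if u ∈ C.K then 2 else 0 := by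
    intro u
    simp only [weight, hd u, if_true]
    split_ifs <;> norm_num
  have hsum : ∑ u ∈ tips f, C.weight f u = 2 * (tips f).card - 2 * C.K.card := by
    simp_rw [hw, Finset.sum_sub_distrib, Finset.sum_ite_mem]
    rw [Finset.inter_eq_right.2 hC, Finset.sum_const, Finset.sum_const, nsmul_eq_mul, nsmul_eq_mul]
    ring
  rw [potential, hsum, huniv, Set.ncard_univ, Nat.card_eq_fintype_card] at hpot
  have : (Fintype.card V : ℤ) + C.K.card ≤ 4 * (tips f).card := by linarith
  exact_mod_cast this

end Branching

/-! ### Connectivity of the simplified graph -/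

section Simplify

variable {V : Type u} {G : SimpleGraph V} {a b u v : V}

/-! ### Deleting the edges between vertices of degree 2 -/

lemma simplify_le (G : SimpleGraph V) : simplify G ≤ G := fun _ _ h => h.1

lemma neighborSet_simplify (h : deg G v ≠ 2) : (simplify G).neighborSet v = G.neighborSet v := by
  ext w
  exact ⟨fun h' => h'.1, fun h' => ⟨h', fun h'' => h h''.1⟩⟩

lemma deg_of_deg_simplify (h : deg (simplify G) v = 2) : deg G v = 2 := by
  by_contra hc
  apply hc
  rw [← h, deg, deg, neighborSet_simplify hc]

lemma SimpleGraph.Reachable.exists_adj_crossing {W : Type*} {F : SimpleGraph W} {a b : W}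
    (h : F.Reachable a b) (S : Set W) (ha : a ∈ S) (hb : b ∉ S) :
    ∃ x y, F.Adj x y ∧ x ∈ S ∧ y ∉ S := by
  obtain ⟨p⟩ := h
  obtain ⟨d, -, h1, h2⟩ := p.exists_boundary_dart S ha hb
  exact ⟨d.fst, d.snd, d.adj, h1, h2⟩

/-- Unless `G` is a triangle, a vertex of degree `2` has a neighbour of another degree. -/
lemma exists_adj_deg_ne_two [Fintype V] (hG : NoTwoVertexSeparator G)
    (ht : ¬ IsTriangle G) (hu : deg G u = 2) : ∃ w, G.Adj u w ∧ deg G w ≠ 2 := by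
  by_contra hc
  push Not at hc
  obtain ⟨a, b, hab, hN⟩ := Set.ncard_eq_two.1 hu
  have hua : G.Adj u a := by have : a ∈ G.neighborSet u := by rw [hN]; simp
                             exact this
  have hub : G.Adj u b := by have : b ∈ G.neighborSet u := by rw [hN]; simp
                             exact this
  have hS := hG {a, b} (by rintro v (rfl | rfl); exacts [hc _ hua, hc _ hub])
  rw [IsSeparator, not_not] at hS
  have huS : u ∈ ({a, b} : Set V)ᶜ := by simp [hua.ne, hub.ne]
  -- If both neighbours of u have degree 2, they may not separate u from anything, so there is no
  -- further vertex.
  have hall : ∀ v, v = u ∨ v = a ∨ v = b := by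
    intro v
    by_contra hv
    rw [not_or] at hv
    have hvS : v ∈ ({a, b} : Set V)ᶜ := by simpa using hv.2
    obtain ⟨x, y, h1, h2, h3⟩ := (hS ⟨u, huS⟩ ⟨v, hvS⟩).exists_adj_crossing {⟨u, huS⟩} rfl
      (fun h => hv.1 (congrArg Subtype.val h))
    rw [Set.mem_singleton_iff] at h2
    subst h2
    have : y.1 ∈ G.neighborSet u := h1
    rw [hN] at this
    exact y.2 this
  have hadj : G.Adj a b := by
    have h2 : (G.neighborSet a).ncard = 2 := hc a hua
    obtain ⟨w, hw, hwu⟩ := Set.exists_ne_of_one_lt_ncard (by omega : 1 < (G.neighborSet a).ncard) u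
    have hw : G.Adj a w := hw
    rcases hall w with rfl | rfl | rfl
    · exact absurd rfl hwu
    · exact absurd rfl hw.ne
    · exact hw
  apply ht
  constructor
  · have : (Finset.univ : Finset V).card = 3 := by
      classical
      rw [Finset.card_eq_three]
      refine ⟨u, a, b, hua.ne, hub.ne, hab, ?_⟩
      ext v
      simpa using hall v
    exact this
  · ext x y
    rw [SimpleGraph.top_adj]
    refine ⟨fun h => h.ne, fun h => ?_⟩
    rcases hall x with rfl | rfl | rfl <;> rcases hall y with rfl | rfl | rfl <;>
      first | exact absurd rfl h | assumption | (apply SimpleGraph.Adj.symm; assumption)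

/-- Vertices of degree other than 2 are connected to one another avoiding all vertices of degree 2,
by edges that survive in H. Every remaining vertex of degree 2 hangs on one of them by a surviving
edge. -/
lemma simplify_induce_preconnected [Fintype V] (hG : NoTwoVertexSeparator G)
    (ht : ¬ IsTriangle G) (X : Set V) (hX : ∀ x ∈ X, deg G x = 2) :
    ((simplify G).induce Xᶜ).Preconnected := by
  have hD := hG {v | deg G v = 2} (fun v hv => hv)
  rw [IsSeparator, not_not] at hD
  have hDX : ∀ w, deg G w ≠ 2 → w ∈ Xᶜ := fun w hw hwX => hw (hX w hwX)
  have key : ∀ a b (ha : deg G a ≠ 2) (hb : deg G b ≠ 2),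
      ((simplify G).induce Xᶜ).Reachable ⟨a, hDX a ha⟩ ⟨b, hDX b hb⟩ := by
    intro a b ha hb
    let φ : G.induce {v | deg G v = 2}ᶜ →g (simplify G).induce Xᶜ :=
      ⟨fun w => ⟨w.1, hDX w.1 w.2⟩, fun {x y} h => ⟨h, fun h' => x.2 h'.1⟩⟩
    exact (hD ⟨a, ha⟩ ⟨b, hb⟩).map φ
  have key2 : ∀ a : ↥Xᶜ, ∃ (b : V) (hb : deg G b ≠ 2),
      ((simplify G).induce Xᶜ).Reachable a ⟨b, hDX b hb⟩ := by
    intro a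
    by_cases ha : deg G a.1 = 2
    · obtain ⟨b, h1, h2⟩ := exists_adj_deg_ne_two hG ht ha
      refine ⟨b, h2, SimpleGraph.Adj.reachable ?_⟩
      exact ⟨h1, fun h => h2 h.2⟩
    · exact ⟨a.1, ha, SimpleGraph.Reachable.refl _⟩
  intro a b
  obtain ⟨a', ha', h1⟩ := key2 a
  obtain ⟨b', hb', h2⟩ := key2 b
  exact (h1.trans (key a' b' ha' hb')).trans h2.symm

lemma parentGraph_adj {p : V → V} : (parentGraph p).Adj a b ↔ a ≠ b ∧ (p a = b ∨ p b = a) := by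
  rw [parentGraph, SimpleGraph.fromRel_adj]

end Simplify

/-! ### The final tree spans, and its leaves are essentially the unexpanded vertices -/

namespace Branching

variable {V : Type u} {G H : SimpleGraph V} {s f : State V} {r u v w x y : V}

lemma Valid.parentGraph_le (h : Valid H r s) : parentGraph s.parent ≤ H := by
  have key : ∀ a, s.parent a ≠ a → H.Adj (s.parent a) a := by
    intro a ha
    have has : a ∈ s.verts := by
      by_contra hc; exact ha (h.parent_out a hc)
    have har : a ≠ r := fun h' => ha (by rw [h', h.root_parent])
    exact h.parent_adj a has har
  intro a b hab
  rw [parentGraph_adj] at hab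
  obtain ⟨h1, rfl | rfl⟩ := hab
  · exact (key a h1.symm).symm
  · exact key b h1

variable [Fintype V]

/-- BRANCHING ends with a spanning tree. -/
lemma verts_eq_univ (hG : NoTwoVertexSeparator G) (ht : ¬ IsTriangle G)
    (hf : IsResult (simplify G) r f) : f.verts = Set.univ := by
  set H := simplify G with hH
  have hval := (Valid.init H r).of_reflTransGen hf.1
  have hN := noO1_of_final hf.2
  by_contra hne
  let X : Set V := {x | x ∉ f.verts ∧ ∃ v ∈ f.verts, H.Adj v x}
  have hX : ∀ x ∈ X, deg H x = 2 ∧ (outer H f x).Nonempty := by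
    rintro x ⟨hx, v, hv, hvx⟩
    have hxo : x ∈ outer H f v := ⟨hvx, hx⟩
    have hd : Doomed H f v := by
      by_contra hd
      obtain ⟨z, hz⟩ := exists_O2_or_O3 hN hv hd
      exact no_O2_O3_of_final hf.2 hz
    obtain ⟨w, h1, h2, h3⟩ := hd.neighborSet_eq (hN.eq_singleton hv hxo)
    refine ⟨by rw [deg, h1, Set.ncard_pair h2.symm], ?_⟩
    have hnot : ¬ O2 H f v x := fun h => no_O2_O3_of_final hf.2 (Or.inl h)
    rw [Set.nonempty_iff_ne_empty]
    exact fun h => hnot ⟨hv, hN.eq_singleton hv hxo, Or.inl h⟩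
  -- All of X has degree 2, so removing it does not cut the root off from y; but a path between them
  -- must leave the tree through X.
  by_cases hy : ∃ y, y ∉ f.verts ∧ y ∉ X
  · obtain ⟨y, hy1, hy2⟩ := hy
    have hpre := simplify_induce_preconnected hG ht X
      (fun x hx => deg_of_deg_simplify (hX x hx).1)
    have hrX : r ∈ Xᶜ := fun h => h.1 hval.root_mem
    obtain ⟨a, b, h1, h2, h3⟩ := (hpre ⟨r, hrX⟩ ⟨y, hy2⟩).exists_adj_crossing
      {z | z.1 ∈ f.verts} hval.root_mem hy1
    exact b.2 ⟨h3, a.1, h2, h1⟩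
  · push Not at hy
    rw [Set.eq_univ_iff_forall] at hne
    push Not at hne
    obtain ⟨x, hx⟩ := hne
    -- Everything outside lies in X, so x and an outside neighbour of it both have degree 2, and
    -- their edge was deleted.
    obtain ⟨h1, y, hy1⟩ := hX x (hy x hx)
    have h2 := (hX y (hy y hy1.2)).1
    exact hy1.1.2 ⟨deg_of_deg_simplify h1, deg_of_deg_simplify h2⟩

/-! ### The spanning tree given by the parents -/

/-- Stamps decrease towards the root, so each vertex is joined to it; and there is at most one edge
per vertex other than the root. -/
lemma Valid.isTree (h : Valid H r s) (huniv : s.verts = Set.univ) :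
    (parentGraph s.parent).IsTree := by
  classical
  have hm : ∀ v, v ∈ s.verts := fun v => by rw [huniv]; trivial
  have hadj : ∀ v, v ≠ r → (parentGraph s.parent).Adj v (s.parent v) := by
    intro v hv
    exact parentGraph_adj.2 ⟨(h.parent_adj v (hm v) hv).ne', Or.inl rfl⟩
  have hreach : ∀ (k : ℕ) v, s.stamp v ≤ k → (parentGraph s.parent).Reachable v r := by
    intro k
    induction k with
    | zero =>
      intro v hv
      by_cases hvr : v = r
      · rw [hvr]
      · have := h.parent_stamp v (hm v) hvr
        omega
    | succ k ih =>
      intro v hv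
      by_cases hvr : v = r
      · rw [hvr]
      · have := h.parent_stamp v (hm v) hvr
        exact (hadj v hvr).reachable.trans (ih _ (by omega))
  have : Nonempty V := ⟨r⟩
  have hconn : (parentGraph s.parent).Connected :=
    ⟨fun a b => (hreach _ a le_rfl).trans (hreach _ b le_rfl).symm⟩
  rw [SimpleGraph.isTree_iff_connected_and_card]
  refine ⟨hconn, ?_⟩
  have h1 := hconn.card_vert_le_card_edgeSet_add_one
  have h2 : (parentGraph s.parent).edgeSet ⊆
      (fun v => s(v, s.parent v)) '' ({r}ᶜ : Set V) := by
    intro e he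
    induction e using Sym2.ind with
    | _ a b =>
      rw [SimpleGraph.mem_edgeSet, parentGraph_adj] at he
      have hr : ∀ c d, c ≠ d → s.parent c = d → c ∈ ({r}ᶜ : Set V) := by
        rintro c d hcd hc rfl
        exact hcd (by rw [← hc, h.root_parent])
      obtain ⟨hab, h3 | h3⟩ := he
      · exact ⟨a, hr a b hab h3, by simp [h3]⟩
      · exact ⟨b, hr b a hab.symm h3, by simp [h3, Sym2.eq_swap]⟩
  have h3 := (Set.ncard_le_ncard h2 (Set.toFinite _)).trans (Set.ncard_image_le (Set.toFinite _))
  rw [Set.ncard_compl, Set.ncard_singleton] at h3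
  rw [Nat.card_coe_set_eq] at h1 ⊢
  have : 0 < Nat.card V := Nat.card_pos
  omega

lemma tips_subset_leaves (s : State V) : (tips s : Set V) ⊆ leaves (parentGraph s.parent) := by
  intro u hu
  have hu' := mem_tips.1 hu
  have : (parentGraph s.parent).neighborSet u ⊆ {s.parent u} := by
    intro w hw
    obtain ⟨h1, h2 | h2⟩ := parentGraph_adj.1 hw
    · exact h2.symm
    · exact absurd (hu'.2 w h2).symm h1
  have := Set.ncard_le_ncard this (Set.toFinite _)
  rw [Set.ncard_singleton] at this
  exact this

/-- A leaf that was expanded is the root, and has degree `1` in `H`. -/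
lemma Valid.mem_tips_of_leaf (h : Valid H r s) (huniv : s.verts = Set.univ)
    (hu : u ∈ leaves (parentGraph s.parent)) (hd : 2 ≤ (H.neighborSet u).ncard) :
    u ∈ tips s := by
  have hm : ∀ v, v ∈ s.verts := fun v => by rw [huniv]; trivial
  refine mem_tips.2 ⟨hm u, fun w hw => ?_⟩
  by_contra hne
  have hu1 : ((parentGraph s.parent).neighborSet u).ncard ≤ 1 := hu
  by_cases hur : u = r
  -- The root has no parent, but all its H-neighbours are its children, so expanded it has tree
  -- degree at least 2.
  · subst hur
    rcases h.root_children with h1 | h1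
    · exact hne (by have := hm w; rw [h1] at this; exact this)
    · have hsub : H.neighborSet u ⊆ (parentGraph s.parent).neighborSet u := by
        intro z hz
        have hz : H.Adj u z := hz
        exact parentGraph_adj.2 ⟨hz.ne, Or.inr (h1 z hz)⟩
      have := Set.ncard_le_ncard hsub (Set.toFinite _)
      omega
  · have hpu := h.parent_adj u (hm u) hur
    have hst := h.parent_stamp u (hm u) hur
    have hwr : w ≠ r := by
      rintro rfl
      rw [h.root_parent] at hw
      exact hne hw
    have hst' := h.parent_stamp w (hm w) hwr
    rw [hw] at hst'
    have hne' : s.parent u ≠ w := by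
      intro h'
      rw [h'] at hst
      omega
    have hsub : ({s.parent u, w} : Set V) ⊆ (parentGraph s.parent).neighborSet u := by
      rintro z (rfl | rfl)
      · exact parentGraph_adj.2 ⟨hpu.ne', Or.inl rfl⟩
      · exact parentGraph_adj.2 ⟨fun h' => hne h'.symm, Or.inr hw⟩
    have := Set.ncard_le_ncard hsub (Set.toFinite _)
    rw [Set.ncard_pair hne'] at this
    omega

end Branching

/-! ### Disjoint cycles -/

section Cycles

variable {V : Type u} {G : SimpleGraph V}

-- The tail of the support lists the vertices of the cycle once each, so its `formPerm` is the
-- successor map; the length being at least 3, two successions do not return to u.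
open Classical in
lemma SimpleGraph.Walk.IsCycle.formPerm_support {a u : V} {p : G.Walk a a} (hp : p.IsCycle)
    (hu : u ∈ p.support.tail) : G.Adj u (p.support.tail.formPerm u) ∧
      p.support.tail.formPerm (p.support.tail.formPerm u) ≠ u := by
  have hnd := hp.support_nodup
  have hlen : p.support.tail.length = p.length := by simp
  have h3 : 3 ≤ p.length := hp.three_le_length
  have hget : ∀ j (hj : j < p.support.tail.length), p.support.tail[j] = p.getVert (j + 1) := by
    intro j hj
    rw [p.getVert_eq_support_getElem (by omega)]
    simp
  generalize p.support.tail = l at *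
  obtain ⟨j, hj, rfl⟩ := List.getElem_of_mem hu
  rw [List.formPerm_apply_getElem _ hnd, List.formPerm_apply_getElem _ hnd]
  constructor
  · by_cases hj' : j + 1 < l.length
    · simp only [Nat.mod_eq_of_lt hj']
      rw [hget, hget]
      exact p.adj_getVert_succ (by omega)
    · have hj2 : j + 1 = l.length := by omega
      simp only [hj2, Nat.mod_self]
      rw [hget, hget, hj2, hlen, p.getVert_length]
      simpa using p.adj_getVert_succ (i := 0) (by omega)
  · intro h
    have := (List.Nodup.getElem_inj_iff hnd).1 h
    by_cases h1 : j + 1 < l.length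
    · rw [Nat.mod_eq_of_lt h1] at this
      by_cases h2 : j + 1 + 1 < l.length
      · rw [Nat.mod_eq_of_lt h2] at this; omega
      · have h2 : j + 1 + 1 = l.length := by omega
        rw [h2, Nat.mod_self] at this
        omega
    · have h2 : j + 1 = l.length := by omega
      rw [h2, Nat.mod_self, Nat.mod_eq_of_lt (by omega)] at this
      omega

/-- Disjoint cycles in `G[S]` cover a set `K` of vertices on which successors and predecessors are
defined. -/
lemma HasDisjointCycles.exists_cover [Fintype V] {S : Set V} {k : ℕ}
    (h : HasDisjointCycles (G.induce S) k) :
    ∃ (K : Finset V) (nxt prv : V → V), 3 * k ≤ K.card ∧ (∀ u ∈ K, u ∈ S) ∧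
      ∀ u ∈ K, nxt u ∈ K ∧ prv u ∈ K ∧ G.Adj u (nxt u) ∧ nxt (prv u) = u ∧ prv (nxt u) = u ∧
        nxt u ≠ prv u := by
  classical
  obtain ⟨a, c, hc, hdisj⟩ := h
  let φ : G.induce S →g G := (SimpleGraph.Embedding.induce S).toHom
  have hφ : Function.Injective φ := Subtype.val_injective
  let p : ∀ i, G.Walk (φ (a i)) (φ (a i)) := fun i => (c i).map φ
  have hp : ∀ i, (p i).IsCycle := fun i => (hc i).map hφ
  let l : Fin k → List V := fun i => (p i).support.tail
  have hmemS : ∀ i u, u ∈ l i → ∃ w ∈ (c i).support, w.1 = u := by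
    intro i u hu
    have := List.mem_of_mem_tail hu
    rw [SimpleGraph.Walk.support_map, List.mem_map] at this
    exact this
  have huniq : ∀ i j u, u ∈ l i → u ∈ l j → i = j := by
    intro i j u hi hj
    by_contra hij
    obtain ⟨w, hw, hwu⟩ := hmemS i u hi
    obtain ⟨w', hw', hwu'⟩ := hmemS j u hj
    have : w = w' := Subtype.ext (hwu.trans hwu'.symm)
    exact hdisj i j hij hw (this ▸ hw')
  let K : Finset V := Finset.univ.biUnion fun i => (l i).toFinset
  have hK : ∀ {u}, u ∈ K ↔ ∃ i, u ∈ l i := by simp [K]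
  let nxt : V → V := fun u => if h : ∃ i, u ∈ l i then (l h.choose).formPerm u else u
  let prv : V → V := fun u => if h : ∃ i, u ∈ l i then (l h.choose).formPerm.symm u else u
  have hnxt : ∀ i u, u ∈ l i → nxt u = (l i).formPerm u := by
    intro i u hu
    have h : ∃ i, u ∈ l i := ⟨i, hu⟩
    simp only [nxt, dif_pos h]
    rw [huniq _ _ u h.choose_spec hu]
  have hprv : ∀ i u, u ∈ l i → prv u = (l i).formPerm.symm u := by
    intro i u hu
    have h : ∃ i, u ∈ l i := ⟨i, hu⟩
    simp only [prv, dif_pos h]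
    rw [huniq _ _ u h.choose_spec hu]
  refine ⟨K, nxt, prv, ?_, ?_, ?_⟩
  · rw [Finset.card_biUnion]
    · have : ∀ i ∈ (Finset.univ : Finset (Fin k)), 3 ≤ (l i).toFinset.card := by
        intro i _
        rw [List.toFinset_card_of_nodup (hp i).support_nodup]
        have := (hp i).three_le_length
        simp only [List.length_tail, SimpleGraph.Walk.length_support]
        omega
      have := Finset.card_nsmul_le_sum _ _ _ this
      simpa [mul_comm] using this
    · intro i _ j _ hij
      rw [Function.onFun, Finset.disjoint_left]
      intro u hi hj
      exact hij (huniq i j u (List.mem_toFinset.1 hi) (List.mem_toFinset.1 hj))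
  · intro u hu
    obtain ⟨i, hi⟩ := hK.1 hu
    obtain ⟨w, -, rfl⟩ := hmemS i u hi
    exact w.2
  · intro u hu
    obtain ⟨i, hi⟩ := hK.1 hu
    have h1 : nxt u ∈ l i := by rw [hnxt i u hi]; exact List.formPerm_apply_mem_of_mem hi
    have h2 : prv u ∈ l i := by
      rw [hprv i u hi]
      apply List.mem_of_formPerm_apply_mem
      rwa [Equiv.apply_symm_apply]
    obtain ⟨h3, h4⟩ := (hp i).formPerm_support hi
    refine ⟨hK.2 ⟨i, h1⟩, hK.2 ⟨i, h2⟩, ?_, ?_, ?_, ?_⟩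
    · rw [hnxt i u hi]; exact h3
    · rw [hnxt i _ h2, hprv i u hi, Equiv.apply_symm_apply]
    · rw [hprv i _ h1, hnxt i u hi, Equiv.symm_apply_apply]
    · rw [hnxt i u hi, hprv i u hi]
      intro h
      exact h4 (by rw [h, Equiv.apply_symm_apply])

/-- In a connected graph with at least three vertices, no two leaves are adjacent. -/
lemma leaves_not_adj [Finite V] {T : SimpleGraph V} (hT : T.Connected) {a b c : V}
    (ha : a ∈ leaves T) (hb : b ∈ leaves T) (hca : c ≠ a) (hcb : c ≠ b) : ¬ T.Adj a b := by
  intro hab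
  have key : ∀ {x y z : V}, x ∈ leaves T → T.Adj x y → T.Adj x z → y = z := by
    intro x y z hx hy hz
    by_contra hne
    have hsub : ({y, z} : Set V) ⊆ T.neighborSet x := by
      rintro w (rfl | rfl)
      · exact hy
      · exact hz
    have h1 := Set.ncard_le_ncard hsub (Set.toFinite _)
    rw [Set.ncard_pair hne] at h1
    have h2 : (T.neighborSet x).ncard ≤ 1 := hx
    omega
  obtain ⟨x, y, h1, h2, h3⟩ := (hT.preconnected a c).exists_adj_crossing {a, b} (by simp)
    (by simp [hca, hcb])
  rcases h2 with rfl | rfl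
  · exact h3 (Or.inr (key ha h1 hab))
  · exact h3 (Or.inl (key hb h1 hab.symm))

end Cycles

/-! ### Every result of BRANCHING is good -/

namespace Branching

variable {V : Type u} [Fintype V] {G : SimpleGraph V} {f : State V} {r : V}

/-- The trees found by BRANCHING have many leaves. -/
theorem isManyLeafTree (hG : NoTwoVertexSeparator G) (ht : ¬ IsTriangle G)
    (hf : IsResult (simplify G) r f) : IsManyLeafTree G (parentGraph f.parent) := by
  have huniv := verts_eq_univ hG ht hf
  set H := simplify G with hH
  have hval := (Valid.init H r).of_reflTransGen hf.1
  have hle := hval.parentGraph_le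
  have htree := hval.isTree huniv
  have hm : ∀ v, v ∈ f.verts := fun v => by rw [huniv]; trivial
  refine ⟨hle.trans (simplify_le G), htree, fun k hk => ?_⟩
  obtain ⟨K, nxt, prv, hcard, hKS, hK⟩ := hk.exists_cover
  have hnxt : ∀ u ∈ K, H.Adj u (nxt u) := by
    intro u hu
    obtain ⟨h1, h2, h3, h4, h5, h6⟩ := hK u hu
    have h7 : G.Adj u (prv u) := by
      have := (hK _ h2).2.2.1
      rw [h4] at this
      exact this.symm
    refine ⟨h3, fun hd => ?_⟩
    -- If the cycle edge was deleted, u has only its cycle neighbours. A tree edge at u would then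
    -- be the deleted edge or join two leaves of a tree on at least three vertices.
    have hN : G.neighborSet u = {nxt u, prv u} := by
      refine (Set.eq_of_subset_of_ncard_le ?_ ?_ (Set.toFinite _)).symm
      · rintro w (rfl | rfl)
        · exact h3
        · exact h7
      · rw [Set.ncard_pair h6]; exact hd.1.le
    obtain ⟨x, y, e1, e2, e3⟩ := (htree.connected.preconnected u (nxt u)).exists_adj_crossing {u}
      rfl (fun h => h3.ne h.symm)
    rw [Set.mem_singleton_iff] at e2
    subst e2
    have hy : y ∈ G.neighborSet x := (hle e1).1
    rw [hN] at hy
    rcases hy with rfl | rfl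
    · exact (hle e1).2 hd
    · exact leaves_not_adj htree.connected (hKS x hu) (hKS _ h2) h3.ne' h6 e1
  have hprv : ∀ u ∈ K, H.Adj u (prv u) := by
    intro u hu
    obtain ⟨h1, h2, h3, h4, h5, h6⟩ := hK u hu
    have := hnxt _ h2
    rw [h4] at this
    exact this.symm
  have htips : ∀ u ∈ K, u ∈ tips f := by
    intro u hu
    refine hval.mem_tips_of_leaf huniv (hKS u hu) ?_
    rw [← Set.ncard_pair (hK u hu).2.2.2.2.2]
    refine Set.ncard_le_ncard ?_ (Set.toFinite _)
    rintro w (rfl | rfl)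
    · exact hnxt u hu
    · exact hprv u hu
  let C : CycleCover H :=
    { K := K
      nxt := nxt
      prv := prv
      nxt_mem := fun u hu => (hK u hu).1
      prv_mem := fun u hu => (hK u hu).2.1
      nxt_adj := hnxt
      prv_adj := hprv
      nxt_prv := fun u hu => (hK u hu).2.2.2.1
      prv_nxt := fun u hu => (hK u hu).2.2.2.2.1
      nxt_ne_prv := fun u hu => (hK u hu).2.2.2.2.2
      exit := fun u hu => by
        have hut := (mem_tips.1 (htips u hu)).2
        by_cases hur : u = r
        · subst hur
          exfalso
          have hadj := hnxt u hu
          rcases hval.root_children with h | h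
          · have := hm (nxt u)
            rw [h] at this
            exact hadj.ne this.symm
          · exact hadj.ne (hut _ (h _ hadj)).symm
        -- The exit from K is the parent, which has a child and hence is not a tip.
        · have hadj := hval.parent_adj u (hm u) hur
          refine ⟨f.parent u, fun hp => ?_, hadj.symm⟩
          exact hadj.ne ((mem_tips.1 (htips _ hp)).2 u rfl).symm }
  have hmain := card_add_card_le_four_mul hf huniv C htips
  have hleaf : (tips f).card ≤ (leaves (parentGraph f.parent)).ncard := by
    rw [← Set.ncard_coe_finset]
    exact Set.ncard_le_ncard (tips_subset_leaves f) (Set.toFinite _)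
  have hfin : Fintype.card V + 3 * k ≤ 4 * (leaves (parentGraph f.parent)).ncard := by
    have : C.K.card = K.card := rfl
    omega
  have : (Fintype.card V + 3 * k : ℝ) ≤ 4 * (leaves (parentGraph f.parent)).ncard := by
    exact_mod_cast hfin
  rw [ge_iff_le, div_le_iff₀ (by norm_num)]
  linarith

/-- A star is a spanning tree of the triangle with many leaves. -/
lemma isManyLeafTree_of_isTriangle (hG : IsTriangle G) (r : V) :
    IsManyLeafTree G (parentGraph fun _ => r) := by
  obtain ⟨hcard, rfl⟩ := hG
  set s := expand (⊤ : SimpleGraph V) (init r) r with hs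
  have hval : Valid ⊤ r s := (Valid.init ⊤ r).valid_expand rfl
  have hverts : s.verts = Set.univ := by
    ext w
    simp only [hs, mem_expand_verts, mem_outer, SimpleGraph.top_adj, Set.mem_univ, iff_true]
    by_cases h : w = r
    · left; rw [h]; exact rfl
    · right; exact ⟨fun h' => h h'.symm, h⟩
  have hpar : s.parent = fun _ => r := by
    funext w
    by_cases h : w = r
    · rw [h, hval.root_parent]
    · exact expand_parent_of_mem ⟨fun h' => h h'.symm, h⟩
  have htree := hval.isTree hverts
  rw [hpar] at htree
  refine ⟨le_top, htree, fun k hk => ?_⟩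
  obtain ⟨K, nxt, prv, h3, hKS, -⟩ := hk.exists_cover
  have h4 : K.card ≤ (leaves (parentGraph fun _ : V => r)).ncard := by
    rw [← Set.ncard_coe_finset]
    exact Set.ncard_le_ncard hKS (Set.toFinite _)
  have h5 : 0 < (leaves (parentGraph fun _ : V => r)).ncard := by
    obtain ⟨w, hw⟩ := Fintype.exists_ne_of_one_lt_card (by omega : 1 < Fintype.card V) r
    refine (Set.ncard_pos (Set.toFinite _)).2 ⟨w, ?_⟩
    rw [← hpar]
    refine tips_subset_leaves s (mem_tips.2 ⟨by rw [hverts]; trivial, fun z hz => ?_⟩)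
    rw [hpar] at hz
    exact absurd hz.symm hw
  -- With ℓ ≥ 1 leaves, 3k ≤ ℓ and n = 3 ≤ 3ℓ.
  have hfin : Fintype.card V + 3 * k ≤ 4 * (leaves (parentGraph fun _ : V => r)).ncard := by
    omega
  have : (Fintype.card V + 3 * k : ℝ) ≤ 4 * (leaves (parentGraph fun _ : V => r)).ncard := by
    exact_mod_cast hfin
  rw [ge_iff_le, div_le_iff₀ (by norm_num)]
  linarith

theorem exists_and_forall_isManyLeafTree (hconn : G.Connected) (hG : NoTwoVertexSeparator G) :
    (∃ T : SimpleGraph V, IsManyLeafTree G T) ∧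
      (¬ IsTriangle G → ∀ r : V, (∃ s, IsResult (simplify G) r s) ∧
        ∀ s, IsResult (simplify G) r s → IsManyLeafTree G (parentGraph s.parent)) := by
  refine ⟨?_, fun ht r => ⟨exists_isResult _ r, fun s hs => isManyLeafTree hG ht hs⟩⟩
  obtain ⟨r⟩ := hconn.nonempty
  by_cases ht : IsTriangle G
  · exact ⟨_, isManyLeafTree_of_isTriangle ht r⟩
  · obtain ⟨s, hs⟩ := exists_isResult (simplify G) r
    exact ⟨_, isManyLeafTree hG ht hs⟩

end Branching

/-! ### The linear-time half: halting with a bound on the number of steps -/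

/-! ### Reasoning about programs -/

namespace RAM

variable {p q : Prog} {b : Test} {s s' : Store} {c c' : ℕ} {Q Q' : Store → Prop}

/-- Started with memory `s`, the program `p` halts after at most `c` steps, and `Q` holds then. -/
def Runs (p : Prog) (s : Store) (c : ℕ) (Q : Store → Prop) : Prop :=
  ∃ s' t, Exec p s s' t ∧ t ≤ c ∧ Q s'

lemma Runs.mono (h : Runs p s c Q) (hc : c ≤ c') (hQ : ∀ s', Q s' → Q' s') : Runs p s c' Q' := by
  obtain ⟨s', t, h1, h2, h3⟩ := h
  exact ⟨s', t, h1, h2.trans hc, hQ s' h3⟩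

lemma Runs.skip (h : Q s) : Runs .skip s 1 Q := ⟨s, 1, .skip s, le_rfl, h⟩

lemma Runs.instr {i : Instr} (h : Q (i.run s)) : Runs (.instr i) s 1 Q :=
  ⟨_, 1, .instr i s, le_rfl, h⟩

lemma Runs.seq (h : Runs p s c (fun s' => Runs q s' c' Q)) : Runs (.seq p q) s (c + c') Q := by
  obtain ⟨s', t, h1, h2, s'', t', h3, h4, h5⟩ := h
  exact ⟨s'', t + t', .seq h1 h3, by omega, h5⟩

lemma Runs.cond (h1 : b.holds s → Runs p s c Q) (h2 : ¬ b.holds s → Runs q s c Q) :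
    Runs (.cond b p q) s (c + 1) Q := by
  by_cases hb : b.holds s
  · obtain ⟨s', t, h3, h4, h5⟩ := h1 hb
    exact ⟨s', t + 1, .condTrue hb h3, by omega, h5⟩
  · obtain ⟨s', t, h3, h4, h5⟩ := h2 hb
    exact ⟨s', t + 1, .condFalse hb h3, by omega, h5⟩

/-- The rule for loops: `I k s` says that the invariant holds for `s` and that `k` steps are left.
-/
lemma Runs.loop {I : ℕ → Store → Prop}
    (h : ∀ k s, I k s → b.holds s →
      ∃ c, Runs p s c (fun s' => ∃ k', I k' s' ∧ c + 1 + k' ≤ k)) :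
    ∀ k s, I k s → Runs (.loop b p) s (k + 1) (fun s' => (∃ k', I k' s') ∧ ¬ b.holds s') := by
  intro k
  induction k using Nat.strong_induction_on with
  | _ k ih =>
    intro s hs
    by_cases hb : b.holds s
    · obtain ⟨c, s', t, h1, h2, k', h3, h4⟩ := h k s hs hb
      obtain ⟨s'', t', h5, h6, h7⟩ := ih k' (by omega) s' h3
      exact ⟨s'', t + t' + 1, .loopTrue hb h1 h5, by omega, h7⟩
    · exact ⟨s, 1, .loopFalse hb, by omega, ⟨k, hs⟩, hb⟩

/-- Instructions to be executed one after the other. -/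
def block : List Instr → Prog
  | [] => .skip
  | i :: l => .seq (.instr i) (block l)

lemma Runs.block : ∀ (l : List Instr) {s : Store},
    Q (l.foldl (fun s i => i.run s) s) → Runs (block l) s (l.length + 1) Q
  | [], _, h => .skip h
  | i :: l, s, h => by
    have h1 : Runs (RAM.block l) (i.run s) (l.length + 1) Q := Runs.block l h
    exact (Runs.seq (.instr h1)).mono (by simp [add_comm]) fun _ h => h

lemma Store.setReg_reg (s : Store) (x k y : ℕ) :
    (s.setReg x k).reg y = if y = x then k else s.reg y := by
  simp [Store.setReg, Function.update_apply]

lemma Store.setReg_arr (s : Store) (x k : ℕ) : (s.setReg x k).arr = s.arr := rfl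

lemma Store.setArr_reg (s : Store) (a i k : ℕ) : (s.setArr a i k).reg = s.reg := rfl

lemma Store.setArr_arr (s : Store) (a i k b : ℕ) :
    (s.setArr a i k).arr b = if b = a then Function.update (s.arr a) i k else s.arr b := by
  simp only [Store.setArr, Function.update_apply]

/-! ### Adjacency lists -/

section Input

variable {n : ℕ} (L : Fin n → List (Fin n))

lemma inputStore_arr_zero_succ (v : Fin n) :
    (inputStore L).arr 0 (v + 1) = (inputStore L).arr 0 v + (L v).length := by
  have h1 : (v : ℕ) + 1 ≤ n := v.2
  have h2 : (v : ℕ) ≤ n := v.2.le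
  simp only [inputStore, if_true, h1, h2]
  rw [List.take_add_one]
  simp

lemma inputStore_arr_one (v : Fin n) (j : ℕ) (hj : j < (L v).length) :
    (inputStore L).arr 1 ((inputStore L).arr 0 v + j) = ((L v)[j] : ℕ) := by
  have h2 : (v : ℕ) ≤ n := v.2.le
  have hsplit : List.ofFn L = (List.ofFn L).take v ++ L v :: (List.ofFn L).drop (v + 1) := by
    have h3 : (v : ℕ) < (List.ofFn L).length := by simp
    conv_lhs => rw [← List.take_append_drop v (List.ofFn L)]
    rw [List.drop_eq_getElem_cons h3]
    simp
  have h4 : (inputStore L).arr 1 = fun i => ((List.ofFn L).flatten.map Fin.val).getD i 0 := by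
    funext i; simp [inputStore]
  have h5 : (inputStore L).arr 0 v = ((List.ofFn L).take v).flatten.length := by
    simp [inputStore, h2]
  have h6 : ∀ A B : List (Fin n), ((A ++ (L v ++ B)).map Fin.val).getD (A.length + j) 0 =
      ((L v)[j] : ℕ) := by
    intro A B
    rw [List.getD_eq_getElem _ _ (by simp; omega)]
    simp [List.getElem_append_right, List.getElem_append_left, hj]
  rw [h4, h5]
  conv_lhs =>
    rw [hsplit]
  simp only [List.flatten_append, List.flatten_cons]
  convert h6 _ _ using 3
  rw [List.take_left']
  simp

/-- The neighbours of `v` in the graph without the edges between vertices of degree `2`. -/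
def nbrs (v : Fin n) : List (Fin n) :=
  (L v).filter fun w => ¬ ((L v).length = 2 ∧ (L w).length = 2)

end Input

end RAM

/-! ### Representation of the data in memory, and the inner loop over neighbours -/

namespace RAM

/-! ### The memory of the program

Registers: `0` the number of vertices, `1` the constant `1`, `2` the constant `0`, `3` the current
level, `4` the number of vertices of the tree, `5` the next free list cell; the others are for
temporary use. Arrays: `2` parents, `3` membership in the tree, `4` numbers of neighbours outside
the tree, `5` the first cells of the stacks, `6` and `7` the links and contents of the cells, `8`
marks of the vertices of degree `2`, `9` the vertices of the tree in the order in which they were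
added. -/

variable {n : ℕ}

/-- The data that the program maintains. -/
structure Mem (n : ℕ) where
  /-- the vertex set of the tree -/
  tree : Finset (Fin n)
  /-- the parents -/
  par : Fin n → ℕ
  /-- the number of neighbours outside the tree -/
  cnt : Fin n → ℕ
  /-- the stacks, one for each level -/
  stk : ℕ → List (Fin n)
  /-- the current level -/
  cur : ℕ
  /-- the vertices of the tree in the order in which they were added -/
  ord : List (Fin n)

/-- The cell `p` is the first of a linked list with contents `l`; all cells are below `f`. -/
def Chain (nx vl : ℕ → ℕ) (f : ℕ) : ℕ → List (Fin n) → Prop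
  | p, [] => p = 0
  | p, u :: l => 0 < p ∧ p < f ∧ vl p = u ∧ Chain nx vl f (nx p) l

/-- All stacks share the two arrays of cells. Writing to the fresh cell f disturbs no existing list,
as these lie below f; cell 0 serves as the null pointer. -/
lemma Chain.update {nx vl : ℕ → ℕ} {f a b : ℕ} : ∀ {p : ℕ} {l : List (Fin n)},
    Chain nx vl f p l → Chain (Function.update nx f a) (Function.update vl f b) (f + 1) p l
  | _, [], h => h
  | p, u :: l, ⟨h1, h2, h3, h4⟩ => by
    refine ⟨h1, by omega, ?_, ?_⟩
    · rw [Function.update_of_ne (by omega), h3]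
    · rw [Function.update_of_ne (by omega)]; exact h4.update

/-- The store `s` holds the data `m` and the adjacency lists `L`. -/
structure Rep (L : Fin n → List (Fin n)) (m : Mem n) (s : Store) : Prop where
  size : s.reg 0 = n
  one : s.reg 1 = 1
  zero : s.reg 2 = 0
  cur : s.reg 3 = m.cur
  top : s.reg 4 = m.ord.length
  free : 0 < s.reg 5
  off : s.arr 0 = (inputStore L).arr 0
  adj : s.arr 1 = (inputStore L).arr 1
  par : ∀ v : Fin n, s.arr 2 v = m.par v
  tree : ∀ v : Fin n, s.arr 3 v = if v ∈ m.tree then 1 else 0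
  cnt : ∀ v : Fin n, s.arr 4 v = m.cnt v
  stk : ∀ j, Chain (s.arr 6) (s.arr 7) (s.reg 5) (s.arr 5 j) (m.stk j)
  two : ∀ v : Fin n, s.arr 8 v = if (L v).length = 2 then 1 else 0
  ord : ∀ i (h : i < m.ord.length), s.arr 9 i = m.ord[i]

section Rep

variable {L : Fin n → List (Fin n)} {m : Mem n} {s s' : Store}

lemma Rep.congr (h : Rep L m s) (ha : s'.arr = s.arr) (hr : ∀ x < 6, s'.reg x = s.reg x) :
    Rep L m s' := by
  obtain ⟨h1, h2, h3, h4, h5, h6, h7, h8, h9, h10, h11, h12, h13, h14⟩ := h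
  constructor <;> simp only [ha, hr _ (show 0 < 6 by norm_num), hr _ (show 1 < 6 by norm_num),
    hr _ (show 2 < 6 by norm_num), hr _ (show 3 < 6 by norm_num), hr _ (show 4 < 6 by norm_num),
    hr _ (show 5 < 6 by norm_num)] <;> assumption

lemma Rep.setReg (h : Rep L m s) {x k : ℕ} (hx : 6 ≤ x) : Rep L m (s.setReg x k) :=
  h.congr rfl fun y hy => by rw [Store.setReg_reg, if_neg (by omega)]

lemma update_fin {α : Type*} (f : ℕ → α) (w v : Fin n) (k : α) :
    Function.update f (w : ℕ) k v = if v = w then k else f v := by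
  rw [Function.update_apply]
  simp only [Fin.val_inj]

lemma Rep.setCnt (h : Rep L m s) (w : Fin n) (k : ℕ) :
    Rep L { m with cnt := Function.update m.cnt w k } (s.setArr 4 w k) := by
  obtain ⟨h1, h2, h3, h4, h5, h6, h7, h8, h9, h10, h11, h12, h13, h14⟩ := h
  constructor <;> simp only [Store.setArr_arr, Store.setArr_reg] <;> try assumption
  intro v
  rw [if_pos trivial, update_fin, Function.update_apply, h11]

lemma Rep.setPar (h : Rep L m s) (w : Fin n) (k : ℕ) :
    Rep L { m with par := Function.update m.par w k } (s.setArr 2 w k) := by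
  obtain ⟨h1, h2, h3, h4, h5, h6, h7, h8, h9, h10, h11, h12, h13, h14⟩ := h
  constructor <;> simp only [Store.setArr_arr, Store.setArr_reg] <;> try assumption
  intro v
  rw [if_pos trivial, update_fin, Function.update_apply, h9]

lemma Rep.setTree (h : Rep L m s) (w : Fin n) :
    Rep L { m with tree := insert w m.tree } (s.setArr 3 w 1) := by
  obtain ⟨h1, h2, h3, h4, h5, h6, h7, h8, h9, h10, h11, h12, h13, h14⟩ := h
  constructor <;> simp only [Store.setArr_arr, Store.setArr_reg] <;> try assumption
  intro v
  by_cases hv : v = w <;> simp [update_fin, hv, h10]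

lemma Rep.pushOrd (h : Rep L m s) (w : Fin n) :
    Rep L { m with ord := m.ord ++ [w] }
      ((s.setArr 9 m.ord.length w).setReg 4 (m.ord.length + 1)) := by
  obtain ⟨h1, h2, h3, h4, h5, h6, h7, h8, h9, h10, h11, h12, h13, h14⟩ := h
  constructor <;> simp only [Store.setArr_arr, Store.setArr_reg, Store.setReg_reg,
    Store.setReg_arr] <;> try assumption
  · simp
  · intro i hi
    rw [if_pos trivial, Function.update_apply]
    simp only [List.length_append, List.length_singleton] at hi
    by_cases hi' : i = m.ord.length
    · simp [hi']
    · have : i < m.ord.length := by omega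
      rw [if_neg hi', List.getElem_append_left this]
      exact h14 i this

lemma Rep.setCur (h : Rep L m s) (k : ℕ) : Rep L { m with cur := k } (s.setReg 3 k) := by
  obtain ⟨h1, h2, h3, h4, h5, h6, h7, h8, h9, h10, h11, h12, h13, h14⟩ := h
  constructor <;> simp only [Store.setReg_reg, Store.setReg_arr] <;> first | assumption | simp

lemma Rep.push (h : Rep L m s) (j : ℕ) (u : Fin n) :
    Rep L { m with stk := Function.update m.stk j (u :: m.stk j) }
      ((((s.setArr 7 (s.reg 5) u).setArr 6 (s.reg 5) (s.arr 5 j)).setArr 5 j (s.reg 5)).setReg 5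
        (s.reg 5 + 1)) := by
  obtain ⟨h1, h2, h3, h4, h5, h6, h7, h8, h9, h10, h11, h12, h13, h14⟩ := h
  constructor <;> simp only [Store.setArr_arr, Store.setArr_reg, Store.setReg_reg,
    Store.setReg_arr] <;> try assumption
  · simp
  · intro i
    simp only [if_true, Nat.reduceEqDiff, if_false]
    by_cases hi : i = j
    · subst hi
      simp only [Function.update_self]
      exact ⟨h6, by omega, by simp, by rw [Function.update_self]; exact (h12 i).update⟩
    · simp only [Function.update_of_ne hi]
      exact (h12 i).update

lemma Rep.pop (h : Rep L m s) {j : ℕ} {u : Fin n} {l : List (Fin n)} (hj : m.stk j = u :: l) :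
    Rep L { m with stk := Function.update m.stk j l }
      (s.setArr 5 j (s.arr 6 (s.arr 5 j))) := by
  obtain ⟨h1, h2, h3, h4, h5, h6, h7, h8, h9, h10, h11, h12, h13, h14⟩ := h
  constructor <;> simp only [Store.setArr_arr, Store.setArr_reg] <;> try assumption
  intro i
  simp only [if_true, Nat.reduceEqDiff, if_false]
  by_cases hi : i = j
  · subst hi
    simp only [Function.update_self]
    have := h12 i
    rw [hj] at this
    exact this.2.2.2
  · simp only [Function.update_of_ne hi]
    exact h12 i

end Rep

/-! ### Visiting the neighbours of a vertex -/

/-- Execute `body` for each neighbour, in register `11`, of the vertex in register `8`. -/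
def forNbr (body : Prog) : Prog :=
  .seq (block [.load 9 0 8, .copy 10 8, .succ 10, .load 10 0 10])
    (.loop (.lt 9 10)
      (.seq (block [.load 11 1 9, .load 12 8 8, .load 13 8 11])
        (.seq (.cond (.eq 12 1) (.cond (.eq 13 1) .skip body) body)
          (.instr (.succ 9)))))

/-- The loop walks through `L v` and skips the deleted edges by means of the degree marks, so the
invariant is indexed by the visited part of `nbrs L v`. The hypothesis `hstab` says that the
invariant ignores the registers 9 to 13, which the loop itself uses. -/
lemma runs_forNbr {L : Fin n → List (Fin n)} {body : Prog} {c : ℕ} {v : Fin n} {s : Store}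
    {I : List (Fin n) → Store → Prop}
    (hstab : ∀ l s s', I l s → s'.arr = s.arr → (∀ x, x < 9 ∨ 13 < x → s'.reg x = s.reg x) →
      I l s')
    (hrep : ∀ l s, I l s → s.reg 8 = v ∧ ∃ m, Rep L m s)
    (hbody : ∀ done (w : Fin n) rest s, nbrs L v = done ++ w :: rest → I done s → s.reg 11 = w →
      Runs body s c (fun s' => I (done ++ [w]) s' ∧ s'.reg 9 = s.reg 9 ∧ s'.reg 10 = s.reg 10))
    (h0 : I [] s) : Runs (forNbr body) s ((c + 10) * (L v).length + 10) (I (nbrs L v)) := by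
  obtain ⟨hv, m, hm⟩ := hrep _ _ h0
  set o := (inputStore L).arr 0 v with ho
  let fil : List (Fin n) → List (Fin n) :=
    fun l => l.filter fun w => ¬ ((L v).length = 2 ∧ (L w).length = 2)
  let J : ℕ → Store → Prop := fun k s => ∃ j ≤ (L v).length, I (fil ((L v).take j)) s ∧
    s.reg 9 = o + j ∧ s.reg 10 = o + (L v).length ∧ k = (c + 10) * ((L v).length - j)
  have hloop := Runs.loop (b := .lt 9 10) (p := (.seq (block [.load 11 1 9, .load 12 8 8,
    .load 13 8 11]) (.seq (.cond (.eq 12 1) (.cond (.eq 13 1) .skip body) body)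
          (.instr (.succ 9))))) (I := J) (by
    rintro k s ⟨j, hj, hI, h9, h10, rfl⟩ hlt
    have hj' : j < (L v).length := by
      have : s.reg 9 < s.reg 10 := hlt
      omega
    obtain ⟨h8, m, hm⟩ := hrep _ _ hI
    set w := (L v)[j] with hw
    have hload : s.arr 1 (s.reg 9) = w := by
      rw [hm.adj, h9, ho, inputStore_arr_one L v j hj']
    have htake : (L v).take (j + 1) = (L v).take j ++ [w] := by
      rw [List.take_add_one]; simp [hw, hj']
    refine ⟨4 + (c + 3 + 1), Runs.seq (Runs.block _ ?_)⟩
    simp only [List.foldl_cons, List.foldl_nil, Instr.run, Store.setReg_arr, Store.setReg_reg,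
      Nat.reduceEqDiff, if_true, if_false, hload, h8]
    set s₁ := ((s.setReg 11 w).setReg 12 (s.arr 8 v)).setReg 13 (s.arr 8 w) with hs₁
    have hI₁ : I (fil ((L v).take j)) s₁ := hstab _ _ _ hI rfl (by
      intro x hx
      simp only [hs₁, Store.setReg_reg]
      rw [if_neg (by omega), if_neg (by omega), if_neg (by omega)])
    have r9 : s₁.reg 9 = o + j := by simp [hs₁, Store.setReg_reg, h9]
    have r10 : s₁.reg 10 = o + (L v).length := by simp [hs₁, Store.setReg_reg, h10]
    have r11 : s₁.reg 11 = w := by simp [hs₁, Store.setReg_reg]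
    have r12 : s₁.reg 12 = if (L v).length = 2 then 1 else 0 := by
      simp [hs₁, Store.setReg_reg, hm.two]
    have r13 : s₁.reg 13 = if (L w).length = 2 then 1 else 0 := by
      simp [hs₁, Store.setReg_reg, hm.two]
    have r1 : s₁.reg 1 = 1 := by simp [hs₁, Store.setReg_reg, hm.one]
    have hfin : ∀ s₂, I (fil ((L v).take (j + 1))) s₂ → s₂.reg 9 = o + j →
        s₂.reg 10 = o + (L v).length → Runs (.instr (.succ 9)) s₂ 1
          (fun s' => ∃ k', J k' s' ∧
            4 + (c + 3 + 1) + 1 + k' ≤ (c + 10) * ((L v).length - j)) := by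
      intro s₂ hI₂ h9 h10
      refine Runs.instr ⟨_, ⟨j + 1, hj', ?_, ?_, ?_, rfl⟩, ?_⟩
      · refine hstab _ _ _ hI₂ rfl fun x hx => ?_
        simp only [Instr.run, Store.setReg_reg]
        rw [if_neg (by omega)]
      · simp only [Instr.run, Store.setReg_reg, if_true, h9]; ring
      · simp only [Instr.run, Store.setReg_reg, Nat.reduceEqDiff, if_false, h10]
      · obtain ⟨d, hd⟩ : ∃ d, (L v).length - j = d + 1 := ⟨(L v).length - j - 1, by omega⟩
        have : (L v).length - (j + 1) = d := by omega
        rw [hd, this]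
        ring_nf
        omega
    have hpass : ¬ ((L v).length = 2 ∧ (L w).length = 2) →
        Runs body s₁ c (fun s' => Runs (.instr (.succ 9)) s' 1 (fun s' => ∃ k', J k' s' ∧
            4 + (c + 3 + 1) + 1 + k' ≤ (c + 10) * ((L v).length - j))) := by
      intro hpass
      have hsplit : nbrs L v = fil ((L v).take j) ++ w :: fil ((L v).drop (j + 1)) := by
        have : L v = (L v).take j ++ w :: (L v).drop (j + 1) := by
          rw [← List.drop_eq_getElem_cons hj', List.take_append_drop]
        change fil (L v) = _
        conv_lhs => rw [this]
        simp only [fil, List.filter_append]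
        rw [List.filter_cons_of_pos (by exact decide_eq_true hpass)]
      refine (hbody _ w _ s₁ hsplit hI₁ r11).mono le_rfl ?_
      rintro s₂ ⟨hI₂, e9, e10⟩
      refine hfin s₂ ?_ (e9.trans r9) (e10.trans r10)
      rw [htake]
      simp only [fil, List.filter_append]
      rw [List.filter_cons_of_pos (by exact decide_eq_true hpass)]
      exact hI₂
    have hskip : (L v).length = 2 ∧ (L w).length = 2 →
        Runs (.instr (.succ 9)) s₁ 1 (fun s' => ∃ k', J k' s' ∧
            4 + (c + 3 + 1) + 1 + k' ≤ (c + 10) * ((L v).length - j)) := by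
      intro hskip
      refine hfin s₁ ?_ r9 r10
      rw [htake]
      simp only [fil, List.filter_append]
      rw [List.filter_cons_of_neg (by simp [hskip]), List.filter_nil, List.append_nil]
      exact hI₁
    refine Runs.seq (Runs.cond (c := c + 2) (fun h1 => ?_) fun h1 => ?_)
    · have hL : (L v).length = 2 := by
        by_contra hc
        simp [Test.holds, r12, r1, hc] at h1
      refine Runs.cond (c := c + 1) (fun h2 => ?_) fun h2 => ?_
      · have hLw : (L w).length = 2 := by
          by_contra hc
          simp [Test.holds, r13, r1, hc] at h2
        exact (Runs.skip (hskip ⟨hL, hLw⟩)).mono (by omega) fun _ h => h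
      · refine (hpass fun hc => h2 ?_).mono (by omega) fun _ h => h
        simp [Test.holds, r13, r1, hc.2]
    · refine (hpass fun hc => h1 ?_).mono (by omega) fun _ h => h
      simp [Test.holds, r12, r1, hc.1])
  refine (Runs.seq (Runs.block _ (?_ : Runs _ _ ((c + 10) * (L v).length + 1) _))).mono
    (by simp only [List.length_cons, List.length_nil]; omega) fun _ h => h
  simp only [List.foldl_cons, List.foldl_nil, Instr.run, Store.setReg_arr, Store.setReg_reg,
      Nat.reduceEqDiff, if_true, if_false, hv]
  refine (hloop ((c + 10) * (L v).length) _ ⟨0, Nat.zero_le _, ?_, ?_, ?_, ?_⟩).mono le_rfl ?_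
  · refine hstab _ _ _ h0 rfl fun x hx => ?_
    simp only [Store.setReg_reg]
    rw [if_neg (by omega), if_neg (by omega), if_neg (by omega), if_neg (by omega)]
  · simp [Store.setReg_reg, hm.off, ho]
  · simp [Store.setReg_reg, hm.off, ho, inputStore_arr_zero_succ]
  · simp
  · rintro s' ⟨⟨k, j, hj, hI, h9, h10, -⟩, hlt⟩
    have : ¬ s'.reg 9 < s'.reg 10 := hlt
    have : j = (L v).length := by omega
    rw [this, List.take_length] at hI
    exact hI

end RAM

/-! ### Subroutines: adding neighbours, updating counts, filling the stacks -/

namespace RAM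

variable {n : ℕ} {L : Fin n → List (Fin n)} {m : Mem n} {s : Store}

/-! ### Visiting the new vertices -/

/-- Execute `body` for each vertex of the tree, in register `8`, starting with the one whose number
is in register `6`. -/
def forOrd (body : Prog) : Prog :=
  .loop (.lt 6 4) (.seq (.instr (.load 8 9 6)) (.seq body (.instr (.succ 6))))

/-- The new vertices are the end of the insertion order. The cost is a sum over them, not a maximum,
so that it can be charged to their degrees. -/
lemma runs_forOrd {body : Prog} {c : Fin n → ℕ} {pre new : List (Fin n)}
    {I : List (Fin n) → Store → Prop}
    (hstab : ∀ l s s', I l s → s'.arr = s.arr → (∀ x, x ≠ 6 → x ≠ 8 → s'.reg x = s.reg x) →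
      I l s')
    (hrep : ∀ l s, I l s → ∃ m, Rep L m s ∧ m.ord = pre ++ new)
    (hbody : ∀ done (u : Fin n) rest s, new = done ++ u :: rest → I done s → s.reg 8 = u →
      Runs body s (c u) (fun s' => I (done ++ [u]) s' ∧ s'.reg 6 = s.reg 6))
    (h0 : I [] s) (h6 : s.reg 6 = pre.length) :
    Runs (forOrd body) s ((new.map fun u => c u + 3).sum + 1) (I new) := by
  let J : ℕ → Store → Prop := fun k s => ∃ done rest, new = done ++ rest ∧ I done s ∧
    s.reg 6 = pre.length + done.length ∧ k = (rest.map fun u => c u + 3).sum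
  have hloop := Runs.loop (b := .lt 6 4) (I := J)
    (p := .seq (.instr (.load 8 9 6)) (.seq body (.instr (.succ 6)))) (by
    rintro k s ⟨done, rest, hnew, hI, h6, rfl⟩ hlt
    obtain ⟨m, hm, hord⟩ := hrep _ _ hI
    have hlt : s.reg 6 < s.reg 4 := hlt
    rw [hm.top, h6, hord, hnew] at hlt
    cases rest with
    | nil => simp at hlt
    | cons u rest =>
      have hload : s.arr 9 (s.reg 6) = u := by
        have : pre.length + done.length < m.ord.length := by rw [hord, hnew]; exact hlt
        rw [h6, hm.ord _ this]
        simp [hord, hnew]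
      refine ⟨1 + (c u + 1), Runs.seq (Runs.instr (Runs.seq ?_))⟩
      have hI' : I done (s.setReg 8 u) := hstab _ _ _ hI rfl fun x _ hx => by
        rw [Store.setReg_reg, if_neg hx]
      simp only [Instr.run, hload]
      refine (hbody done u rest _ hnew hI' (by simp [Store.setReg_reg])).mono le_rfl ?_
      rintro s' ⟨h1, h2⟩
      refine Runs.instr ⟨_, ⟨done ++ [u], rest, by simp [hnew], ?_, ?_, rfl⟩, ?_⟩
      · refine hstab _ _ _ h1 rfl fun x hx _ => ?_
        simp [Instr.run, Store.setReg_reg, hx]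
      · simp [Instr.run, Store.setReg_reg, h2, h6, add_assoc]
      · simp only [List.map_cons, List.sum_cons]
        omega)
  refine (hloop _ s ⟨[], new, rfl, h0, by simpa using h6, rfl⟩).mono le_rfl ?_
  rintro s' ⟨⟨k, done, rest, hnew, hI, h6, -⟩, hlt⟩
  obtain ⟨m, hm, hord⟩ := hrep _ _ hI
  have hlt : ¬ s'.reg 6 < s'.reg 4 := hlt
  rw [hm.top, h6, hord, hnew] at hlt
  have : rest = [] := by
    rw [← List.length_eq_zero_iff]
    simp only [List.length_append] at hlt
    omega
  rw [hnew, this, List.append_nil]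
  exact hI

/-! ### Expanding a vertex -/

/-- Add the vertices of `l` outside the tree as children of `v`. -/
def Mem.add (m : Mem n) (v : Fin n) (l : List (Fin n)) : Mem n :=
  { m with
    tree := m.tree ∪ l.toFinset
    par := fun w => if w ∈ l ∧ w ∉ m.tree then v else m.par w
    ord := m.ord ++ l.filter (· ∉ m.tree) }

/-- Add the neighbours of the vertex in register `8` to the tree. -/
def addNbrs : Prog :=
  forNbr (.seq (.instr (.load 14 3 11))
    (.cond (.eq 14 2) (block [.store 3 11 1, .store 2 11 8, .store 9 4 11, .succ 4]) .skip))

lemma runs_addNbrs (h : Rep L m s) {v : Fin n} (h8 : s.reg 8 = v) (hnd : (L v).Nodup) :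
    Runs addNbrs s (17 * (L v).length + 10)
      (fun s' => Rep L (m.add v (nbrs L v)) s' ∧ s'.reg 7 = s.reg 7) := by
  refine (runs_forNbr (c := 7) (v := v) (L := L) (I := fun l s' => Rep L (m.add v l) s' ∧
    s'.reg 8 = v ∧ s'.reg 7 = s.reg 7) ?_ ?_ ?_ ?_).mono le_rfl ?_
  · rintro l s s' ⟨h1, h2, h3⟩ ha hr
    exact ⟨h1.congr ha fun x hx => hr x (by omega), by rw [hr _ (by norm_num), h2],
      by rw [hr _ (by norm_num), h3]⟩
  · exact fun l s ⟨h1, h2, _⟩ => ⟨h2, _, h1⟩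
  · rintro done w rest s' hsplit ⟨h1, h2, h3⟩ h11
    have hw : w ∉ done := by
      have : (nbrs L v).Nodup := hnd.filter _
      rw [hsplit, List.nodup_append] at this
      intro hw
      exact this.2.2 w hw w (by simp) rfl
    refine (Runs.seq (Runs.instr (Runs.cond (c := 5) (fun hb => ?_) fun hb => ?_))).mono
      (c := 1 + (5 + 1)) (by norm_num) fun _ h => h
    · have hwt : w ∉ m.tree := by
        intro hwt
        have := h1.tree w
        simp only [Test.holds, Instr.run, Store.setReg_reg, if_true, Nat.reduceEqDiff, if_false,
          h11, this, h1.zero] at hb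
        simp [Mem.add, hwt] at hb
      refine Runs.block _ ?_
      have e1 := h1.one
      have e4 := h1.top
      simp only [List.foldl_cons, List.foldl_nil, Instr.run, Store.setReg_reg,
        Store.setArr_reg, Nat.reduceEqDiff, if_false, h11, h2, e1, e4]
      refine ⟨⟨?_, ?_, ?_⟩, ?_, ?_⟩
      · have := ((((h1.setReg (x := 14) (k := s'.arr 3 w) (by norm_num)).setTree w).setPar w
          v).pushOrd w)
        convert this using 1
        simp only [Mem.add, Mem.mk.injEq, true_and]
        refine ⟨?_, ?_, ?_⟩
        · ext z; simp
        · funext z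
          by_cases hz : z = w
          · subst hz; simp [hwt]
          · simp [hz]
        · simp [hwt]
      all_goals simp [h3]
    · have hwt : w ∈ m.tree := by
        by_contra hwt
        have := h1.tree w
        simp only [Test.holds, Instr.run, Store.setReg_reg, if_true, Nat.reduceEqDiff, if_false,
          h11, this, h1.zero] at hb
        simp [Mem.add, hwt, hw] at hb
      refine (Runs.skip ?_).mono (by norm_num) fun _ h => h
      refine ⟨⟨?_, ?_, ?_⟩, ?_, ?_⟩
      · have := h1.setReg (x := 14) (k := s'.arr 3 (s'.reg 11)) (by norm_num)
        change Rep L _ (s'.setReg 14 (s'.arr 3 (s'.reg 11)))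
        convert this using 1
        simp only [Mem.add, Mem.mk.injEq, true_and]
        refine ⟨?_, ?_, ?_⟩
        · ext z; simp; rintro rfl; exact Or.inl hwt
        · funext z
          by_cases hz : z = w
          · subst hz; simp [hwt]
          · simp [hz]
        · simp [hwt]
      all_goals simp [Instr.run, Store.setReg_reg, h2, h3]
  · refine ⟨?_, h8, rfl⟩
    convert h using 1
    simp [Mem.add]
  · exact fun s' ⟨h1, _, h3⟩ => ⟨h1, h3⟩

/-- Take into account that the vertices of `l` are in the tree. -/
def Mem.decr (L : Fin n → List (Fin n)) (m : Mem n) (l : List (Fin n)) : Mem n :=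
  { m with cnt := fun z => m.cnt z - l.countP fun u => z ∈ nbrs L u }

/-- Update the numbers of neighbours outside the tree. -/
def decrNbrs : Prog := forNbr (block [.load 14 4 11, .pred 14, .store 4 11 14])

lemma runs_decrNbrs (h : Rep L m s) {u : Fin n} (h8 : s.reg 8 = u) (hnd : (L u).Nodup) :
    Runs decrNbrs s (14 * (L u).length + 10) (fun s' =>
      Rep L { m with cnt := fun z => m.cnt z - if z ∈ nbrs L u then 1 else 0 } s' ∧
        s'.reg 6 = s.reg 6 ∧ s'.reg 7 = s.reg 7) := by
  refine (runs_forNbr (c := 4) (v := u) (L := L) (I := fun l s' =>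
    Rep L { m with cnt := fun z => m.cnt z - if z ∈ l then 1 else 0 } s' ∧
    s'.reg 8 = u ∧ s'.reg 6 = s.reg 6 ∧ s'.reg 7 = s.reg 7) ?_ ?_ ?_ ?_).mono le_rfl ?_
  · rintro l s s' ⟨h1, h2, h3, h4⟩ ha hr
    exact ⟨h1.congr ha fun x hx => hr x (by omega), by rw [hr _ (by norm_num), h2],
      by rw [hr _ (by norm_num), h3], by rw [hr _ (by norm_num), h4]⟩
  · exact fun l s ⟨h1, h2, _⟩ => ⟨h2, _, h1⟩
  · rintro done w rest s' hsplit ⟨h1, h2, h3, h4⟩ h11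
    have hw : w ∉ done := by
      have : (nbrs L u).Nodup := hnd.filter _
      rw [hsplit, List.nodup_append] at this
      intro hw
      exact this.2.2 w hw w (by simp) rfl
    refine Runs.block _ ?_
    simp only [List.foldl_cons, List.foldl_nil, Instr.run, Store.setReg_reg,
        Store.setArr_reg, Nat.reduceEqDiff, if_true, if_false, h11, h1.cnt, hw]
    refine ⟨⟨?_, ?_, ?_, ?_⟩, ?_, ?_⟩
    · have := (((h1.setReg (x := 14) (k := m.cnt w - 0) (by norm_num)).setReg (x := 14)
        (k := m.cnt w - 0 - 1) (by norm_num)).setCnt w (m.cnt w - 0 - 1))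
      convert this using 1
      simp only [Mem.mk.injEq, true_and, and_true]
      funext z
      by_cases hz : z = w
      · subst hz; simp
      · simp [hz]
    all_goals simp [h2, h3, h4]
  · exact ⟨by simpa using h, h8, rfl, rfl⟩
  · exact fun s' ⟨h1, _, h3⟩ => ⟨h1, h3⟩

lemma runs_forOrd_decrNbrs (h : Rep L m s) {pre new : List (Fin n)} (hord : m.ord = pre ++ new)
    (h6 : s.reg 6 = pre.length) (hnd : ∀ u, (L u).Nodup) :
    Runs (forOrd decrNbrs) s ((new.map fun u => 14 * (L u).length + 10 + 3).sum + 1)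
      (fun s' => Rep L (m.decr L new) s' ∧ s'.reg 7 = s.reg 7) := by
  refine runs_forOrd (L := L) (c := fun u => 14 * (L u).length + 10) (pre := pre) (I := fun l s' =>
    Rep L (m.decr L l) s' ∧ s'.reg 7 = s.reg 7) ?_ ?_ ?_ ?_ h6
  · rintro l s s' ⟨h1, h2⟩ ha hr
    exact ⟨h1.congr ha fun x hx => hr x (by omega) (by omega), by
      rw [hr _ (by norm_num) (by norm_num), h2]⟩
  · exact fun l s ⟨h1, h2⟩ => ⟨_, h1, hord⟩
  · rintro done u rest s' hnew ⟨h1, h2⟩ h8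
    refine (runs_decrNbrs h1 h8 (hnd u)).mono le_rfl ?_
    rintro s'' ⟨h3, h4, h5⟩
    refine ⟨⟨?_, h5.trans h2⟩, h4⟩
    convert h3 using 1
    simp only [Mem.decr, Mem.mk.injEq, true_and, and_true]
    funext z
    rw [List.countP_append, List.countP_singleton, Nat.sub_add_eq]
    simp
  · exact ⟨by simpa [Mem.decr] using h, rfl⟩

/-- Push each vertex `u` of `l` onto the stacks of the levels from `1` to `cnt u`. -/
def Mem.push (m : Mem n) (l : List (Fin n)) : Mem n :=
  { m with
    stk := fun j => (l.filter fun u => 1 ≤ j ∧ j ≤ m.cnt u).reverse ++ m.stk j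
    cur := l.foldl (fun c u => max c (m.cnt u)) m.cur }

/-- Push the vertex in register `8` onto the stacks. -/
def pushStacks : Prog :=
  .seq (block [.load 14 4 8, .const 15 0])
    (.seq (.loop (.lt 15 14)
        (block [.succ 15, .store 7 5 8, .load 12 5 15, .store 6 5 12, .store 5 15 5, .succ 5]))
      (.cond (.lt 3 14) (.instr (.copy 3 14)) .skip))

/-- A copy goes to every level up to the present count: counts only fall later, and then a copy on a
lower stack takes over without any entry having to be moved. -/
lemma runs_pushStacks (h : Rep L m s) {u : Fin n} (h8 : s.reg 8 = u) :
    Runs pushStacks s (8 * m.cnt u + 6) (fun s' => Rep L (m.push [u]) s' ∧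
      s'.reg 6 = s.reg 6) := by
  let J : ℕ → Store → Prop := fun k s' => ∃ j ≤ m.cnt u,
    Rep L { m with stk := fun i => if 1 ≤ i ∧ i ≤ j then u :: m.stk i else m.stk i } s' ∧
    s'.reg 8 = u ∧ s'.reg 6 = s.reg 6 ∧ s'.reg 14 = m.cnt u ∧ s'.reg 15 = j ∧
    k = 8 * (m.cnt u - j)
  have hloop := Runs.loop (b := .lt 15 14) (I := J) (p := block [.succ 15, .store 7 5 8,
    .load 12 5 15, .store 6 5 12, .store 5 15 5, .succ 5]) (by
    rintro k s' ⟨j, hj, h1, h2, h3, h4, h5, rfl⟩ hlt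
    have hlt : s'.reg 15 < s'.reg 14 := hlt
    rw [h4, h5] at hlt
    refine ⟨7, Runs.block _ ⟨_, ⟨j + 1, hlt, ?_, ?_, ?_, ?_, ?_, rfl⟩, by omega⟩⟩
    · simp only [List.foldl_cons, List.foldl_nil, Instr.run, Store.setReg_arr, Store.setReg_reg,
        Store.setArr_reg, Store.setArr_arr, Nat.reduceEqDiff, if_true, if_false, h2, h5]
      have := (h1.setReg (x := 15) (k := j + 1) (by norm_num)).push (j + 1) u
      have he : (fun i => if 1 ≤ i ∧ i ≤ j + 1 then u :: m.stk i else m.stk i) =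
          Function.update (fun i => if 1 ≤ i ∧ i ≤ j then u :: m.stk i else m.stk i) (j + 1)
            (u :: if 1 ≤ j + 1 ∧ j + 1 ≤ j then u :: m.stk (j + 1) else m.stk (j + 1)) := by
        funext i
        by_cases hi : i = j + 1
        · subst hi
          simp
        · rw [Function.update_of_ne hi]
          have : (1 ≤ i ∧ i ≤ j + 1) ↔ (1 ≤ i ∧ i ≤ j) := by omega
          simp only [this]
      rw [he]
      refine this.congr rfl fun x hx => ?_
      simp only [Store.setReg_reg, Store.setArr_reg]
      simp [show x ≠ 12 by omega, show x ≠ 15 by omega]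
    all_goals simp [Instr.run, Store.setReg_reg, Store.setArr_reg, h2, h3, h4, h5])
  refine (Runs.seq (Runs.block _ (Runs.seq (c := 8 * m.cnt u + 1) (c' := 2) ?_))).mono
    (by simp; omega) fun _ h => h
  simp only [List.foldl_cons, List.foldl_nil, Instr.run, h8, h.cnt]
  refine (hloop (8 * m.cnt u) _ ⟨0, Nat.zero_le _, ?_, ?_, ?_, ?_, ?_, ?_⟩).mono le_rfl ?_
  · have he : (fun i => if 1 ≤ i ∧ i ≤ 0 then u :: m.stk i else m.stk i) = m.stk := by
      funext i
      rw [if_neg (by omega)]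
    rw [he]
    exact (h.setReg (x := 14) (k := m.cnt u) (by norm_num)).setReg (x := 15) (k := 0)
      (by norm_num)
  · simp [Store.setReg_reg, h8]
  · simp [Store.setReg_reg]
  · simp [Store.setReg_reg]
  · simp [Store.setReg_reg]
  · simp
  · rintro s' ⟨⟨k, j, hj, h1, h2, h3, h4, h5, -⟩, hlt⟩
    have hlt : ¬ s'.reg 15 < s'.reg 14 := hlt
    have hj : j = m.cnt u := by omega
    subst hj
    have hstk : (fun i => if 1 ≤ i ∧ i ≤ m.cnt u then u :: m.stk i else m.stk i) =
        (m.push [u]).stk := by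
      funext i
      by_cases hi : 1 ≤ i ∧ i ≤ m.cnt u <;> simp [Mem.push, hi, List.filter_cons]
    rw [hstk] at h1
    refine Runs.cond (c := 1) (fun hb => Runs.instr ⟨?_, ?_⟩) fun hb => Runs.skip ⟨?_, h3⟩
    · have hb : s'.reg 3 < s'.reg 14 := hb
      rw [h1.cur, h4] at hb
      simp only [Instr.run, h4]
      convert h1.setCur (m.cnt u) using 1
      simp only [Mem.push, List.foldl_cons, List.foldl_nil, Mem.mk.injEq, true_and, and_true]
      exact max_eq_right hb.le
    · simp [Instr.run, Store.setReg_reg, h3]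
    · have hb : ¬ s'.reg 3 < s'.reg 14 := hb
      rw [h1.cur, h4] at hb
      convert h1 using 1
      simp only [Mem.push, List.foldl_cons, List.foldl_nil, Mem.mk.injEq, true_and, and_true]
      exact max_eq_left (not_lt.1 hb)

lemma runs_forOrd_pushStacks (h : Rep L m s) {pre new : List (Fin n)} (hord : m.ord = pre ++ new)
    (h6 : s.reg 6 = pre.length) :
    Runs (forOrd pushStacks) s ((new.map fun u => 8 * m.cnt u + 6 + 3).sum + 1)
      (Rep L (m.push new)) := by
  refine runs_forOrd (L := L) (c := fun u => 8 * m.cnt u + 6) (pre := pre) (I := fun l s' =>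
    Rep L (m.push l) s') ?_ ?_ ?_ ?_ h6
  · intro l s s' h1 ha hr
    exact h1.congr ha fun x hx => hr x (by omega) (by omega)
  · exact fun l s h1 => ⟨_, h1, hord⟩
  · intro done u rest s' hnew h1 h8
    refine (runs_pushStacks h1 h8).mono le_rfl ?_
    rintro s'' ⟨h3, h4⟩
    refine ⟨?_, h4⟩
    convert h3 using 1
    simp only [Mem.push, Mem.mk.injEq, true_and, and_true]
    refine ⟨?_, by simp⟩
    funext j
    rw [List.filter_append, List.reverse_append, List.append_assoc]
    rfl
  · simpa [Mem.push] using h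

/-- Take into account the vertices of the tree added last, starting with the one whose number is in
register `7`. -/
def processNew : Prog :=
  .seq (.instr (.copy 6 7)) (.seq (forOrd decrNbrs)
    (.seq (.instr (.copy 6 7)) (forOrd pushStacks)))

/-- Two separate sweeps are needed: new vertices may be adjacent to one another, and the levels must
be read off after all counts are final. -/
lemma runs_processNew (h : Rep L m s) {pre new : List (Fin n)} (hord : m.ord = pre ++ new)
    (h7 : s.reg 7 = pre.length) (hnd : ∀ u, (L u).Nodup) (hcnt : ∀ u, m.cnt u ≤ (L u).length) :
    Runs processNew s (22 * (new.map fun u => (L u).length + 1).sum + 4)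
      (Rep L ((m.decr L new).push new)) := by
  have hcost : ∀ (l : List (Fin n)) (f : Fin n → ℕ), (∀ u, f u ≤ (L u).length) →
      (l.map fun u => 14 * (L u).length + 10 + 3).sum + (l.map fun u => 8 * f u + 6 + 3).sum ≤
      22 * (l.map fun u => (L u).length + 1).sum := by
    intro l f hf
    induction l with
    | nil => simp
    | cons u l ih =>
      simp only [List.map_cons, List.sum_cons]
      have := hf u
      omega
  have hcost := hcost new (m.decr L new).cnt fun u => (Nat.sub_le _ _).trans (hcnt u)
  refine Runs.mono (c := 1 + ((new.map fun u => 14 * (L u).length + 10 + 3).sum + 1 +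
    (1 + ((new.map fun u => 8 * (m.decr L new).cnt u + 6 + 3).sum + 1)))) ?_
    (by simp only [Mem.decr] at *; omega) fun _ h => h
  refine Runs.seq (Runs.instr (Runs.seq ?_))
  refine (runs_forOrd_decrNbrs (h.setReg (x := 6) (k := s.reg 7) (by norm_num)) hord ?_
    hnd).mono le_rfl ?_
  · simp [Store.setReg_reg, h7]
  · rintro s' ⟨h1, h2⟩
    refine Runs.seq (Runs.instr ?_)
    refine runs_forOrd_pushStacks (pre := pre) (h1.setReg (x := 6) (k := s'.reg 7) (by norm_num))
      hord ?_
    rw [Store.setReg_reg] at h2 ⊢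
    simp only [if_true, h2]
    simpa using h7

end RAM

/-! ### The stacks select the operations that BRANCHING prescribes -/

namespace RAM

open Branching

/-! ### The correctness of the program -/

variable {n : ℕ} {G H : SimpleGraph (Fin n)} {L : Fin n → List (Fin n)} {m : Mem n}
  {σ : State (Fin n)} {r v w x : Fin n} {l : List (Fin n)}

lemma IsAdjLists.length_eq (hL : IsAdjLists G L) (v : Fin n) : (L v).length = deg G v := by
  have h : G.neighborSet v = ((L v).toFinset : Set (Fin n)) := by
    ext w; simp [(hL v).2 w]
  rw [deg, h, Set.ncard_coe_finset, List.toFinset_card_of_nodup (hL v).1]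

lemma IsAdjLists.mem_nbrs (hL : IsAdjLists G L) (v w : Fin n) :
    w ∈ nbrs L v ↔ (simplify G).Adj v w := by
  simp only [nbrs, List.mem_filter, (hL v).2 w, simplify, hL.length_eq, decide_eq_true_eq]

lemma IsAdjLists.nodup_nbrs (hL : IsAdjLists G L) (v : Fin n) : (nbrs L v).Nodup :=
  (hL v).1.filter _

/-- The neighbours of `v` outside the tree. -/
def Mem.new (L : Fin n → List (Fin n)) (m : Mem n) (v : Fin n) : List (Fin n) :=
  (nbrs L v).filter (· ∉ m.tree)

/-- The data after the expansion of `v`. -/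
def Mem.expand (L : Fin n → List (Fin n)) (m : Mem n) (v : Fin n) : Mem n :=
  ((m.add v (nbrs L v)).decr L (m.new L v)).push (m.new L v)

/-- Replace the stack of the current level. -/
def Mem.setStk (m : Mem n) (l : List (Fin n)) : Mem n :=
  { m with stk := Function.update m.stk m.cur l }

lemma Mem.setStk_stk_self (m : Mem n) (l : List (Fin n)) : (m.setStk l).stk m.cur = l :=
  Function.update_self _ _ _

lemma Mem.setStk_stk_of_ne (m : Mem n) (l : List (Fin n)) {j : ℕ} (hj : j ≠ m.cur) :
    (m.setStk l).stk j = m.stk j :=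
  Function.update_of_ne hj _ _

/-- The state `σ` is reached by operations, or O3 is being performed. -/
def Reached (H : SimpleGraph (Fin n)) (r : Fin n) (σ : State (Fin n)) : Prop :=
  Relation.ReflTransGen (Step H) (init r) σ ∨
    ∃ s v x, Relation.ReflTransGen (Step H) (init r) s ∧ NoO1 H s ∧ O3 H s v x ∧ Latest H s v ∧
      σ = Branching.expand H s v

/-- The data `m` describe the state `σ` of BRANCHING. -/
structure Inv (H : SimpleGraph (Fin n)) (L : Fin n → List (Fin n)) (r : Fin n) (m : Mem n)
    (σ : State (Fin n)) : Prop where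
  valid : Valid H r σ
  reached : Reached H r σ
  tree : ∀ v, v ∈ m.tree ↔ v ∈ σ.verts
  par : ∀ v ∈ σ.verts, m.par v = σ.parent v
  par_out : ∀ v, v ∉ σ.verts → m.par v = r
  cnt : ∀ v, m.cnt v = (outer H σ v).ncard
  mem : ∀ j, ∀ v ∈ m.stk j, v ∈ σ.verts
  full : ∀ j, 2 ≤ j → ∀ v ∈ σ.verts, j ≤ m.cnt v → v ∈ m.stk j
  full_one : ∀ v ∈ σ.verts, 1 ≤ m.cnt v → v ∈ m.stk 1 ∨ Doomed H σ v
  sorted : ∀ j, (m.stk j).Pairwise fun a b => σ.stamp b ≤ σ.stamp a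
  cur_two : ∀ v ∈ σ.verts, 2 ≤ m.cnt v → m.cnt v ≤ m.cur
  cur_one : ∀ v ∈ σ.verts, 1 ≤ m.cnt v → 1 ≤ m.cur ∨ Doomed H σ v

/-- By `full`, an empty stack at a level j ≥ 2 shows that no tree vertex has j or more outside
neighbours. At level 1, `full_one` shows that those with an outside neighbour are doomed. -/
lemma Inv.pred (h : Inv H L r m σ) (hs : m.stk m.cur = []) :
    Inv H L r { m with cur := m.cur - 1 } σ where
  valid := h.valid
  reached := h.reached
  tree := h.tree
  par := h.par
  par_out := h.par_out
  cnt := h.cnt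
  mem := h.mem
  full := h.full
  full_one := h.full_one
  sorted := h.sorted
  cur_two v hv h2 := by
    have h3 := h.cur_two v hv h2
    by_contra hc
    simp only at h2 hc
    have h4 : m.cnt v = m.cur := by omega
    have := h.full m.cur (by omega) v hv h4.ge
    simp [hs] at this
  cur_one v hv h1 := by
    rcases h.cur_one v hv h1 with h2 | h2
    · by_cases h3 : m.cur = 1
      · have := h.full_one v hv h1
        rw [← h3, hs] at this
        exact Or.inr (this.resolve_left (by simp))
      · left; simp only; omega
    · exact Or.inr h2

/-- An entry is dropped for good only if its count has fallen below the level or, at level 1, if the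
vertex is doomed. -/
lemma Inv.pop (h : Inv H L r m σ) (hs : m.stk m.cur = v :: l) (h2 : 2 ≤ m.cur → m.cnt v < m.cur)
    (h1 : m.cur = 1 → Doomed H σ v) : Inv H L r (m.setStk l) σ where
  valid := h.valid
  reached := h.reached
  tree := h.tree
  par := h.par
  par_out := h.par_out
  cnt := h.cnt
  mem j w hw := by
    by_cases hj : j = m.cur
    · subst hj
      rw [Mem.setStk_stk_self] at hw
      exact h.mem m.cur w (by simp [hs, hw])
    · rw [Mem.setStk_stk_of_ne _ _ hj] at hw
      exact h.mem _ w hw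
  full j hj w hw hc := by
    have hw' := h.full j hj w hw hc
    by_cases hj : j = m.cur
    · subst hj
      rw [hs, List.mem_cons] at hw'
      rw [Mem.setStk_stk_self]
      refine hw'.resolve_left ?_
      rintro rfl
      have := h2 hj
      exact absurd hc (not_le.2 this)
    · rw [Mem.setStk_stk_of_ne _ _ hj]; exact hw'
  full_one w hw hc := by
    have hw' := h.full_one w hw hc
    by_cases hj : 1 = m.cur
    · rw [hj, hs, List.mem_cons] at hw'
      rw [hj, Mem.setStk_stk_self]
      rcases hw' with (rfl | hw') | hw'
      · exact Or.inr (h1 hj.symm)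
      · exact Or.inl hw'
      · exact Or.inr hw'
    · rw [Mem.setStk_stk_of_ne _ _ hj]; exact hw'
  sorted j := by
    by_cases hj : j = m.cur
    · subst hj
      have := h.sorted m.cur
      rw [hs] at this
      rw [Mem.setStk_stk_self]
      exact (List.pairwise_cons.1 this).2
    · rw [Mem.setStk_stk_of_ne _ _ hj]; exact h.sorted j
  cur_two := h.cur_two
  cur_one := h.cur_one

lemma mem_new (hN : ∀ v w, w ∈ nbrs L v ↔ H.Adj v w) (h : ∀ v, v ∈ m.tree ↔ v ∈ σ.verts) :
    w ∈ m.new L v ↔ w ∈ outer H σ v := by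
  simp [Mem.new, mem_outer, hN, h]

lemma countP_eq_ncard {l : List (Fin n)} (hl : l.Nodup) (p : Fin n → Bool) :
    l.countP p = {u | u ∈ l ∧ p u}.ncard := by
  have h : {u | u ∈ l ∧ p u} = ((l.filter p).toFinset : Set (Fin n)) := by
    ext u; simp
  rw [h, Set.ncard_coe_finset, List.toFinset_card_of_nodup (hl.filter _),
    List.countP_eq_length_filter]

lemma foldl_max_ge (f : Fin n → ℕ) : ∀ (l : List (Fin n)) (c : ℕ),
    c ≤ l.foldl (fun c u => max c (f u)) c ∧ ∀ u ∈ l, f u ≤ l.foldl (fun c u => max c (f u)) c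
  | [], c => ⟨le_rfl, by simp⟩
  | a :: l, c => by
    obtain ⟨h1, h2⟩ := foldl_max_ge f l (max c (f a))
    refine ⟨(le_max_left _ _).trans h1, fun u hu => ?_⟩
    rcases List.mem_cons.1 hu with rfl | hu
    · exact (le_max_right _ _).trans h1
    · exact h2 u hu

/-- By symmetry of adjacency the decrements at z count its outside neighbours that were just added,
so the subtraction is never truncated. -/
lemma Inv.expand_cnt (h : Inv H L r m σ) (hN : ∀ v w, w ∈ nbrs L v ↔ H.Adj v w)
    (hnd : ∀ v, (nbrs L v).Nodup) (v z : Fin n) :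
    m.cnt z - (m.new L v).countP (fun u => z ∈ nbrs L u) =
      (outer H (Branching.expand H σ v) z).ncard := by
  have h1 : {u | u ∈ m.new L v ∧ decide (z ∈ nbrs L u) = true} = outer H σ z ∩ outer H σ v := by
    ext u
    simp only [Set.mem_ofPred_eq, mem_new hN h.tree, decide_eq_true_eq, hN, Set.mem_inter_iff,
      mem_outer, H.adj_comm u z]
    tauto
  rw [countP_eq_ncard (l := m.new L v) ((hnd v).filter _), h1, h.cnt, outer_expand,
    ← Set.sdiff_inter_self_eq_sdiff, Set.inter_comm, Set.ncard_sdiff Set.inter_subset_right]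

/-- Counts of old vertices only fall, so their entries remain sufficient; new vertices have the
newest stamp, so putting them on top keeps the stacks sorted; and doom is permanent. -/
lemma Inv.expand (h : Inv H L r m σ) (hN : ∀ v w, w ∈ nbrs L v ↔ H.Adj v w)
    (hnd : ∀ v, (nbrs L v).Nodup) (hs : m.stk m.cur = v :: l)
    (hreach : Reached H r (Branching.expand H σ v)) :
    Inv H L r ((m.setStk l).expand L v) (Branching.expand H σ v) := by
  have hv : v ∈ σ.verts := h.mem m.cur v (by simp [hs])
  classical
  have hcnt : ∀ z, ((m.setStk l).expand L v).cnt z =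
      (outer H (Branching.expand H σ v) z).ncard := fun z => h.expand_cnt hN hnd v z
  have hmn : ∀ w, w ∈ m.new L v ↔ w ∈ outer H σ v := fun w => mem_new hN h.tree
  have hout : ∀ w, (w ∈ nbrs L v ∧ w ∉ m.tree) ↔ w ∈ outer H σ v := fun w => by
    rw [hN, h.tree]; rfl
  have hstk : ∀ j, ((m.setStk l).expand L v).stk j = ((m.new L v).filter fun u => 1 ≤ j ∧
      j ≤ ((m.setStk l).expand L v).cnt u).reverse ++ (m.setStk l).stk j := fun j => rfl
  have hold : ∀ j, ∀ w ∈ (m.setStk l).stk j, w ∈ m.stk j := by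
    intro j w hw
    by_cases hj : j = m.cur
    · subst hj
      rw [Mem.setStk_stk_self] at hw
      simp [hs, hw]
    · rwa [Mem.setStk_stk_of_ne _ _ hj] at hw
  have hkeep : ∀ j, ∀ w ∈ m.stk j, w ≠ v → w ∈ (m.setStk l).stk j := by
    intro j w hw hne
    by_cases hj : j = m.cur
    · subst hj
      rw [hs, List.mem_cons] at hw
      rw [Mem.setStk_stk_self]
      exact hw.resolve_left hne
    · rw [Mem.setStk_stk_of_ne _ _ hj]; exact hw
  have hsorted : ∀ j, ((m.setStk l).stk j).Pairwise fun a b => σ.stamp b ≤ σ.stamp a := by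
    intro j
    by_cases hj : j = m.cur
    · subst hj
      have := h.sorted m.cur
      rw [hs] at this
      rw [Mem.setStk_stk_self]
      exact (List.pairwise_cons.1 this).2
    · rw [Mem.setStk_stk_of_ne _ _ hj]; exact h.sorted j
  have hle : ∀ z, ((m.setStk l).expand L v).cnt z ≤ m.cnt z := fun z => Nat.sub_le _ _
  have hv0 : ((m.setStk l).expand L v).cnt v = 0 := by rw [hcnt, outer_expand_self]; simp
  have hcur := foldl_max_ge ((m.setStk l).expand L v).cnt (m.new L v) m.cur
  change m.cur ≤ ((m.setStk l).expand L v).cur ∧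
    ∀ u ∈ m.new L v, _ ≤ ((m.setStk l).expand L v).cur at hcur
  refine ⟨h.valid.valid_expand hv, hreach, ?_, ?_, ?_, hcnt, ?_, ?_, ?_, ?_, ?_, ?_⟩
  · intro w
    change w ∈ m.tree ∪ (nbrs L v).toFinset ↔ _
    simp only [Finset.mem_union, h.tree, List.mem_toFinset, hN, mem_expand_verts, mem_outer]
    tauto
  · intro w hw
    change (if w ∈ nbrs L v ∧ w ∉ m.tree then (v : ℕ) else m.par w) = _
    rw [if_congr (hout w) rfl rfl]
    by_cases hwo : w ∈ outer H σ v
    · rw [if_pos hwo, expand_parent_of_mem hwo]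
    · rw [if_neg hwo, expand_parent_of_notMem hwo, h.par w (hw.resolve_right hwo)]
  · intro w hw
    change (if w ∈ nbrs L v ∧ w ∉ m.tree then (v : ℕ) else m.par w) = _
    rw [mem_expand_verts, not_or] at hw
    rw [if_congr (hout w) rfl rfl]
    rw [if_neg hw.2, h.par_out w hw.1]
  · intro j w hw
    rw [hstk, List.mem_append, List.mem_reverse, List.mem_filter, hmn] at hw
    rcases hw with hw | hw
    · exact Or.inr hw.1
    · exact Or.inl (h.mem j w (hold j w hw))
  · intro j hj w hw hc
    rw [hstk, List.mem_append, List.mem_reverse, List.mem_filter, hmn]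
    rcases hw with hw | hw
    · right
      refine hkeep j w (h.full j hj w hw (hc.trans (hle w))) ?_
      rintro rfl
      omega
    · left
      refine ⟨hw, ?_⟩
      simp only [decide_eq_true_eq]
      omega
  · intro w hw hc
    rw [hstk, List.mem_append, List.mem_reverse, List.mem_filter, hmn]
    rcases hw with hw | hw
    · rcases h.full_one w hw (hc.trans (hle w)) with h1 | h1
      · left; right
        refine hkeep 1 w h1 ?_
        rintro rfl
        omega
      · exact Or.inr (h1.doomed_expand hw (h.valid.stamp_le w hw))
    · left; left
      refine ⟨hw, ?_⟩
      simp only [decide_eq_true_eq]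
      omega
  · intro j
    rw [hstk, List.pairwise_append]
    refine ⟨?_, ?_, ?_⟩
    · refine List.Pairwise.imp_of_mem (R := fun _ _ => True) ?_ (List.pairwise_of_forall (by simp))
      intro a b ha hb _
      rw [List.mem_reverse, List.mem_filter, hmn] at ha hb
      rw [expand_stamp_of_mem ha.1, expand_stamp_of_mem hb.1]
    · refine (hsorted j).imp_of_mem fun {a b} ha hb hab => ?_
      have ha' := h.mem j a (hold j a ha)
      have hb' := h.mem j b (hold j b hb)
      rwa [expand_stamp_of_notMem (notMem_outer ha'), expand_stamp_of_notMem (notMem_outer hb')]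
    · intro a ha b hb
      rw [List.mem_reverse, List.mem_filter, hmn] at ha
      have hb' := h.mem j b (hold j b hb)
      rw [expand_stamp_of_mem ha.1, expand_stamp_of_notMem (notMem_outer hb')]
      have := h.valid.stamp_le b hb'
      omega
  · intro w hw hc
    rcases hw with hw | hw
    · exact (hle w).trans ((h.cur_two w hw (hc.trans (hle w))).trans hcur.1)
    · exact hcur.2 w ((hmn w).2 hw)
  · intro w hw hc
    rcases hw with hw | hw
    · rcases h.cur_one w hw (hc.trans (hle w)) with h1 | h1
      · exact Or.inl (h1.trans hcur.1)
      · exact Or.inr (h1.doomed_expand hw (h.valid.stamp_le w hw))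
    · exact Or.inl (hc.trans (hcur.2 w ((hmn w).2 hw)))

/-- At a level above `1`, the first vertex of the stack is chosen by O1 or by O3. -/
lemma Inv.reached_of_two_le (h : Inv H L r m σ) (hs : m.stk m.cur = v :: l) (hcur : 2 ≤ m.cur)
    (hv : m.cur ≤ m.cnt v) : Reached H r (Branching.expand H σ v) := by
  have hvT : v ∈ σ.verts := h.mem m.cur v (by simp [hs])
  have hO1 : O1 H σ v := ⟨hvT, by rw [← h.cnt]; omega⟩
  left
  rcases h.reached with h1 | ⟨s, u, x, h1, h2, h3, h4, rfl⟩
  · refine h1.tail (Step.o1 σ v hO1 (fun w hw => ?_) fun w hw hc => ?_)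
    · rw [← h.cnt, ← h.cnt]
      exact (h.cur_two w hw.1 (by rw [h.cnt]; exact hw.2)).trans hv
    · rw [← h.cnt, ← h.cnt] at hc
      have h5 := h.full m.cur hcur w hw.1 (by omega)
      have h6 := h.sorted m.cur
      rw [hs, List.mem_cons] at h5
      rw [hs, List.pairwise_cons] at h6
      rcases h5 with rfl | h5
      · exact le_rfl
      · exact h6.1 w h5
  -- In the middle of an O3 only x can have two outside neighbours, so this expansion completes it.
  · have hvx : v = x := by
      rcases hvT with hvT | hvT
      · have := ncard_outer_mono (H := H) (s := s) (t := Branching.expand H s u) subset_expand v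
        have := h2.ncard_le hvT
        have := hO1.2
        omega
      · rw [h3.2.1] at hvT; exact hvT
    subst hvx
    exact h1.tail (Step.o3 s u v h2 h3 h4)

/-- At level `1`, operation O1 applies nowhere. -/
lemma Inv.noO1 (h : Inv H L r m σ) (hcur : m.cur ≤ 1) : NoO1 H σ := by
  intro w hw
  have := h.cur_two w hw.1 (by rw [h.cnt]; exact hw.2)
  rw [h.cnt] at this
  have := hw.2
  omega

/-- An unfinished O3 leaves O1 applicable at x, which keeps the level above 1. -/
lemma Inv.reachable (h : Inv H L r m σ) (hcur : m.cur ≤ 1) :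
    Relation.ReflTransGen (Step H) (init r) σ := by
  rcases h.reached with h1 | ⟨s, u, x, h1, h2, h3, h4, rfl⟩
  · exact h1
  · exfalso
    refine h.noO1 hcur x ⟨h3.mem_expand, ?_⟩
    rw [outer_expand_of_singleton h3.2.1]
    exact h3.2.2

/-- Stack 1 holds every candidate that is not doomed, latest first. A doomed vertex at which O2
applies is older than such a candidate by `O2.exists_later`, so the top of the stack is latest
overall. -/
lemma Inv.reached_of_eq_one (h : Inv H L r m σ) (hs : m.stk m.cur = v :: l) (hcur : m.cur = 1)
    (hx : O2 H σ v x ∨ O3 H σ v x) : Reached H r (Branching.expand H σ v) := by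
  have hN := h.noO1 hcur.le
  have hlate : ∀ w ∈ σ.verts, 1 ≤ m.cnt w → ¬ Doomed H σ w → σ.stamp w ≤ σ.stamp v := by
    intro w hw hc hd
    have h5 := (h.full_one w hw hc).resolve_right hd
    have h6 := h.sorted m.cur
    rw [← hcur, hs, List.mem_cons] at h5
    rw [hs, List.pairwise_cons] at h6
    rcases h5 with rfl | h5
    · exact le_rfl
    · exact h6.1 w h5
  have hlatest : Latest H σ v := by
    intro w y hw
    have hcnt : ∀ w y, outer H σ w = {y} → 1 ≤ m.cnt w := fun w y hw => by rw [h.cnt, hw]; simp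
    rcases hw with hw | hw
    · by_cases hd : Doomed H σ w
      · obtain ⟨z, h1, h2, h3⟩ := hw.exists_later hN hd
        exact h2.le.trans (hlate z h1.1 (hcnt z y h1.2.1) h3)
      · exact hlate w hw.1 (hcnt w y hw.2.1) hd
    · exact hlate w hw.1 (hcnt w y hw.2.1) hw.not_doomed
  rcases hx with hx | hx
  · exact Or.inl ((h.reachable hcur.le).tail (Step.o2 σ v x hN hx hlatest))
  · exact Or.inr ⟨σ, v, x, h.reachable hcur.le, hN, hx, hlatest, rfl⟩

/-- When the level is `0`, no operation applies. -/
lemma Inv.isResult (h : Inv H L r m σ) (hcur : m.cur = 0) : IsResult H r σ := by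
  refine ⟨h.reachable (by omega), fun t ht => ?_⟩
  have hN := h.noO1 (by omega)
  have hd : ∀ w y, w ∈ σ.verts → outer H σ w = {y} → Doomed H σ w := by
    intro w y hw hy
    refine (h.cur_one w hw (by rw [h.cnt, hy]; simp)).resolve_left (by omega)
  cases ht with
  | o1 v hv => exact hN v hv
  | o2 v x _ hv hl => exact hv.not_doomed hN hl (hd v x hv.1 hv.2.1)
  | o3 v x _ hv hl => exact hv.not_doomed (hd v x hv.1 hv.2.1)

/-- The test for doomed vertices. -/
lemma doomed_of_test (hx : outer (simplify G) σ v = {x}) (hv : v ∈ σ.verts)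
    (h1 : (outer (simplify G) σ x).ncard = 1) (h2 : deg G x = 2) : Doomed (simplify G) σ v := by
  obtain ⟨w, hw⟩ := Set.ncard_eq_one.1 h1
  have hwo : w ∈ outer (simplify G) σ x := by rw [hw]; rfl
  have hxo : x ∈ outer (simplify G) σ v := by rw [hx]; rfl
  have hwv : w ≠ v := fun h => hwo.2 (h ▸ hv)
  refine Or.inr ⟨x, w, hx, ?_, hwv, Or.inl hwo.2⟩
  symm
  have hsub : {v, w} ⊆ (simplify G).neighborSet x := by
    rintro z (rfl | rfl)
    · exact (mem_outer.1 hxo).1.symm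
    · exact hwo.1
  refine Set.eq_of_subset_of_ncard_le hsub ?_ (Set.toFinite _)
  rw [Set.ncard_pair hwv.symm, ← h2]
  exact Set.ncard_le_ncard (fun z hz => hz.1) (Set.toFinite _)

/-- In the critical case x has one outside neighbour, has v in the tree, and has degree other than
2; so at least two of its neighbours are in the tree. -/
lemma O2_or_O3_of_test (hx : outer (simplify G) σ v = {x}) (hv : v ∈ σ.verts)
    (h : ¬ ((outer (simplify G) σ x).ncard = 1 ∧ deg G x = 2)) :
    O2 (simplify G) σ v x ∨ O3 (simplify G) σ v x := by
  by_cases h2 : 2 ≤ (outer (simplify G) σ x).ncard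
  · exact Or.inr ⟨hv, hx, h2⟩
  left
  refine ⟨hv, hx, ?_⟩
  by_cases h0 : (outer (simplify G) σ x).ncard = 0
  · left
    exact (Set.ncard_eq_zero (Set.toFinite _)).1 h0
  right
  have h1 : (outer (simplify G) σ x).ncard = 1 := by omega
  have hd : deg G x ≠ 2 := fun hd => h ⟨h1, hd⟩
  have hxo : x ∈ outer (simplify G) σ v := by rw [hx]; rfl
  have hpos : 1 ≤ ((simplify G).neighborSet x ∩ σ.verts).ncard :=
    (Set.ncard_pos (Set.toFinite _)).2 ⟨v, (mem_outer.1 hxo).1.symm, hv⟩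
  have hsum := Set.ncard_inter_add_ncard_sdiff_eq_ncard ((simplify G).neighborSet x) σ.verts
    (Set.toFinite _)
  rw [neighborSet_simplify hd] at hsum hpos ⊢
  rw [outer, neighborSet_simplify hd] at h1
  rw [h1] at hsum
  change _ = deg G x at hsum
  omega

lemma Inv.init (hN : ∀ v w, w ∈ nbrs L v ↔ H.Adj v w) (hnd : ∀ v, (nbrs L v).Nodup)
    (ht : m.tree = {r}) (hp : ∀ v, m.par v = r) (hc : ∀ v, m.cnt v = (nbrs L v).length)
    (hs : ∀ j, m.stk j = []) : Inv H L r ((m.decr L [r]).push [r]) (init r) := by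
  have hcnt : ∀ z, ((m.decr L [r]).push [r]).cnt z = (outer H (Branching.init r) z).ncard := by
    intro z
    change m.cnt z - [r].countP (fun u => z ∈ nbrs L u) = _
    have h1 : (H.neighborSet z).ncard = (nbrs L z).length := by
      have h : H.neighborSet z = ((nbrs L z).toFinset : Set (Fin n)) := by
        ext w; simp [hN]
      rw [h, Set.ncard_coe_finset, List.toFinset_card_of_nodup (hnd z)]
    rw [List.countP_singleton, hc, ← h1, outer]
    change _ = (H.neighborSet z \ {r}).ncard
    by_cases hz : H.Adj r z
    · rw [Set.ncard_sdiff_singleton_of_mem (show r ∈ H.neighborSet z from hz.symm)]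
      simp [hN, hz]
    · have : r ∉ H.neighborSet z := fun h => hz h.symm
      rw [Set.sdiff_singleton_eq_self this]
      simp [hN, hz]
  have hstk : ∀ j, ((m.decr L [r]).push [r]).stk j = ([r].filter fun u => 1 ≤ j ∧
      j ≤ ((m.decr L [r]).push [r]).cnt u).reverse ++ m.stk j := fun j => rfl
  have hcur := foldl_max_ge ((m.decr L [r]).push [r]).cnt [r] m.cur
  change m.cur ≤ ((m.decr L [r]).push [r]).cur ∧
    ∀ u ∈ [r], _ ≤ ((m.decr L [r]).push [r]).cur at hcur
  have hmem : ∀ w j, 1 ≤ j → w = r → j ≤ ((m.decr L [r]).push [r]).cnt w →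
      w ∈ ((m.decr L [r]).push [r]).stk j := by
    rintro w j hj rfl hc
    rw [hstk, List.mem_append, List.mem_reverse, List.mem_filter]
    left
    simpa using ⟨hj, hc⟩
  refine ⟨Valid.init H r, Or.inl .refl, ?_, ?_, ?_, hcnt, ?_, ?_, ?_, ?_, ?_, ?_⟩
  · intro v
    change v ∈ m.tree ↔ v ∈ ({r} : Set (Fin n))
    simp [ht]
  · intro v hv
    rw [show v = r from hv]
    exact hp r
  · exact fun v _ => hp v
  · intro j v hv
    rw [hstk, hs, List.append_nil, List.mem_reverse, List.mem_filter, List.mem_singleton] at hv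
    exact hv.1
  · exact fun j hj w hw hc => hmem w j (by omega) hw hc
  · exact fun w hw hc => Or.inl (hmem w 1 le_rfl hw hc)
  · intro j
    refine List.pairwise_of_forall fun _ _ => le_rfl
  · intro w hw _
    exact hcur.2 w (by rw [show w = r from hw]; simp)
  · intro w hw h1
    exact Or.inl (h1.trans (hcur.2 w (by rw [show w = r from hw]; simp)))

end RAM

/-! ### Amortized analysis of the main loop -/

namespace RAM

open Branching

/-! ### The running time -/

variable {n : ℕ} {H : SimpleGraph (Fin n)} {L : Fin n → List (Fin n)} {m : Mem n}
  {σ : State (Fin n)} {r v : Fin n} {l : List (Fin n)}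

/-- The weight of a list of vertices: their number plus the sum of their degrees. -/
def weight (L : Fin n → List (Fin n)) (l : List (Fin n)) : ℕ :=
  (l.map fun u => (L u).length + 1).sum

/-- The total length of the stacks. -/
def Mem.height (L : Fin n → List (Fin n)) (m : Mem n) : ℕ :=
  ∑ j ∈ Finset.range (∑ v, (L v).length + 1), (m.stk j).length

/-- The weight of the vertices outside the tree. -/
def Mem.outside (L : Fin n → List (Fin n)) (m : Mem n) : ℕ :=
  ∑ v ∈ Finset.univ \ m.tree, ((L v).length + 1)

/-- The weight of the vertices with neighbours outside the tree. -/
def Mem.active (L : Fin n → List (Fin n)) (m : Mem n) : ℕ :=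
  ∑ v with 0 < m.cnt v, ((L v).length + 1)

/-- A bound for the number of steps to go. -/
def Mem.pot (L : Fin n → List (Fin n)) (m : Mem n) : ℕ :=
  50 * m.cur + 50 * m.height L + 172 * m.outside L + 50 * m.active L + 50 * weight L (m.stk 1)

lemma weight_append (l l' : List (Fin n)) : weight L (l ++ l') = weight L l + weight L l' := by
  simp [weight]

lemma weight_reverse (l : List (Fin n)) : weight L l.reverse = weight L l := by
  simp [weight, List.sum_reverse]

lemma weight_filter_le (p : Fin n → Bool) : ∀ l, weight L (l.filter p) ≤ weight L l
  | [] => le_rfl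
  | a :: l => by
    have ih := weight_filter_le p l
    by_cases h : p a
    · rw [List.filter_cons_of_pos h]
      simp only [weight, List.map_cons, List.sum_cons] at ih ⊢
      omega
    · rw [List.filter_cons_of_neg h]
      simp only [weight, List.map_cons, List.sum_cons] at ih ⊢
      omega

lemma Mem.pot_pred (hcur : 0 < m.cur) : Mem.pot L { m with cur := m.cur - 1 } + 50 ≤ m.pot L := by
  change 50 * (m.cur - 1) + 50 * m.height L + 172 * m.outside L + 50 * m.active L +
    50 * weight L (m.stk 1) + 50 ≤ 50 * m.cur + 50 * m.height L + 172 * m.outside L +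
    50 * m.active L + 50 * weight L (m.stk 1)
  omega

/-- A removed entry releases a constant; at level 1 it also releases an amount proportional to the
degree, which pays for the test of doom. -/
lemma Mem.pot_setStk (hs : m.stk m.cur = v :: l) (hcur : m.cur ≤ ∑ v, (L v).length) :
    (m.setStk l).pot L + 50 + (if m.cur = 1 then 50 * ((L v).length + 1) else 0) ≤ m.pot L := by
  have h1 : (m.setStk l).height L + 1 = m.height L := by
    have hmem : m.cur ∈ Finset.range (∑ v, (L v).length + 1) := by simp; omega
    rw [Mem.height, Mem.height, ← Finset.add_sum_erase _ _ hmem, ← Finset.add_sum_erase _ _ hmem,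
      Mem.setStk_stk_self, hs, List.length_cons]
    rw [Finset.sum_congr rfl fun j hj => by
      rw [Mem.setStk_stk_of_ne _ _ (Finset.ne_of_mem_erase hj)]]
    ring
  have h2 : weight L ((m.setStk l).stk 1) + (if m.cur = 1 then ((L v).length + 1) else 0) =
      weight L (m.stk 1) := by
    by_cases hc : m.cur = 1
    · have h3 := m.setStk_stk_self l
      rw [hc] at h3 hs
      rw [if_pos hc, h3, hs]
      simp only [weight, List.map_cons, List.sum_cons]
      ring
    · rw [if_neg hc, Mem.setStk_stk_of_ne _ _ (Ne.symm hc), add_zero]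
  change 50 * m.cur + 50 * (m.setStk l).height L + 172 * m.outside L + 50 * m.active L +
    50 * weight L ((m.setStk l).stk 1) + 50 + _ ≤ 50 * m.cur + 50 * m.height L +
    172 * m.outside L + 50 * m.active L + 50 * weight L (m.stk 1)
  split_ifs at h2 ⊢ <;> omega

lemma foldl_max_le (f : Fin n → ℕ) : ∀ (l : List (Fin n)) (c : ℕ),
    l.foldl (fun c u => max c (f u)) c ≤ c + (l.map f).sum
  | [], c => by simp
  | a :: l, c => by
    have := foldl_max_le f l (max c (f a))
    simp only [List.foldl_cons, List.map_cons, List.sum_cons]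
    omega

lemma foldl_max_le_of_le {f : Fin n → ℕ} {b : ℕ} (hf : ∀ u, f u ≤ b) :
    ∀ (l : List (Fin n)) {c : ℕ}, c ≤ b → l.foldl (fun c u => max c (f u)) c ≤ b
  | [], _, hc => hc
  | a :: l, _, hc => foldl_max_le_of_le hf l (max_le hc (hf a))

lemma Mem.push_cur_le_sum (hc : ∀ u, m.cnt u ≤ (L u).length) (l : List (Fin n))
    (hcur : m.cur ≤ ∑ v, (L v).length) : (m.push l).cur ≤ ∑ v, (L v).length :=
  foldl_max_le_of_le (fun u => (hc u).trans (Finset.single_le_sum (f := fun v => (L v).length)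
    (fun _ _ => Nat.zero_le _) (Finset.mem_univ u))) l hcur

lemma sum_map_le_weight {f : Fin n → ℕ} (hf : ∀ u, f u ≤ (L u).length) (l : List (Fin n)) :
    (l.map f).sum ≤ weight L l := by
  refine List.sum_le_sum fun u _ => ?_
  have := hf u
  omega

lemma Mem.push_cur_le (hc : ∀ u, m.cnt u ≤ (L u).length) (l : List (Fin n)) :
    (m.push l).cur ≤ m.cur + weight L l :=
  (foldl_max_le m.cnt l m.cur).trans (Nat.add_le_add_left (sum_map_le_weight hc l) _)

/-- Double counting: u occurs on at most f u levels. -/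
lemma sum_length_filter_le (f : Fin n → ℕ) (N : ℕ) : ∀ l : List (Fin n),
    ∑ j ∈ Finset.range N, (l.filter fun u => 1 ≤ j ∧ j ≤ f u).length ≤ (l.map f).sum
  | [] => by simp
  | a :: l => by
    have ih := sum_length_filter_le f N l
    have h1 : ∀ j, ((a :: l).filter fun u => 1 ≤ j ∧ j ≤ f u).length =
        (if 1 ≤ j ∧ j ≤ f a then 1 else 0) + (l.filter fun u => 1 ≤ j ∧ j ≤ f u).length := by
      intro j
      by_cases hj : 1 ≤ j ∧ j ≤ f a
      · rw [List.filter_cons_of_pos (by simpa using hj), if_pos hj, List.length_cons, add_comm]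
      · rw [List.filter_cons_of_neg (by simpa using hj), if_neg hj, zero_add]
    have h2 : (∑ j ∈ Finset.range N, if 1 ≤ j ∧ j ≤ f a then 1 else 0) ≤ f a := by
      rw [← Finset.card_filter]
      calc _ ≤ (Finset.Icc 1 (f a)).card := by
            refine Finset.card_le_card fun j hj => ?_
            simpa using (Finset.mem_filter.1 hj).2
        _ = f a := by simp
    simp only [h1, Finset.sum_add_distrib, List.map_cons, List.sum_cons]
    omega

lemma Mem.height_push_le (hc : ∀ u, m.cnt u ≤ (L u).length) (l : List (Fin n)) :
    (m.push l).height L ≤ m.height L + weight L l := by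
  have h1 := (sum_length_filter_le m.cnt (∑ v, (L v).length + 1) l).trans (sum_map_le_weight hc l)
  simp only [Mem.height, Mem.push, List.length_append, List.length_reverse,
    Finset.sum_add_distrib]
  omega

lemma Mem.weight_push_le (l : List (Fin n)) :
    weight L ((m.push l).stk 1) ≤ weight L (m.stk 1) + weight L l := by
  simp only [Mem.push, weight_append, weight_reverse]
  have := weight_filter_le (L := L) (fun u => decide (1 ≤ 1 ∧ 1 ≤ m.cnt u)) l
  omega

/-- Leaving the active set, v pays for the scan of its list. Each new vertex releases 172 = 3·50 +
22 per unit of weight: 50 each for the rise of the level, of the total height and of the weight of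
stack 1, and 22 for `processNew`. -/
lemma Mem.pot_expand (hnd : ∀ v, (nbrs L v).Nodup) (hc : ∀ u, m.cnt u ≤ (L u).length)
    (hv : 0 < m.cnt v) (hv' : (m.expand L v).cnt v = 0) :
    (m.expand L v).pot L + 50 * ((L v).length + 1) + 22 * weight L (m.new L v) ≤ m.pot L := by
  set m₁ := (m.add v (nbrs L v)).decr L (m.new L v) with hm₁
  have hle : ∀ u, m₁.cnt u ≤ m.cnt u := fun u => Nat.sub_le _ _
  have hc₁ : ∀ u, m₁.cnt u ≤ (L u).length := fun u => (hle u).trans (hc u)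
  have h1 : (m.expand L v).cur ≤ m.cur + weight L (m.new L v) := Mem.push_cur_le hc₁ _
  have h2 : (m.expand L v).height L ≤ m.height L + weight L (m.new L v) :=
    Mem.height_push_le hc₁ _
  have h3 : weight L ((m.expand L v).stk 1) ≤ weight L (m.stk 1) + weight L (m.new L v) :=
    Mem.weight_push_le (m := m₁) _
  have h4 : (m.expand L v).outside L + weight L (m.new L v) = m.outside L := by
    have e1 : weight L (m.new L v) = ∑ u ∈ (m.new L v).toFinset, ((L u).length + 1) :=
      (List.sum_toFinset _ ((hnd v).filter _)).symm
    have e2 : Finset.univ \ (m.expand L v).tree =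
        (Finset.univ \ m.tree) \ (m.new L v).toFinset := by
      ext w
      change w ∈ Finset.univ \ (m.tree ∪ (nbrs L v).toFinset) ↔ _
      simp only [Finset.mem_sdiff, Finset.mem_univ, Finset.mem_union, List.mem_toFinset, Mem.new,
        List.mem_filter, decide_eq_true_eq, true_and]
      tauto
    have e3 : (m.new L v).toFinset ⊆ Finset.univ \ m.tree := by
      intro w hw
      simpa using (List.mem_filter.1 (List.mem_toFinset.1 hw)).2
    rw [Mem.outside, e1, e2, Finset.sum_sdiff e3, Mem.outside]
  have h5 : (m.expand L v).active L + ((L v).length + 1) ≤ m.active L := by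
    have hmem : v ∈ ({u | 0 < m.cnt u} : Finset (Fin n)) := by simpa using hv
    rw [Mem.active, Mem.active, ← Finset.sum_erase_add _ _ hmem]
    refine Nat.add_le_add_right (Finset.sum_le_sum_of_subset fun u hu => ?_) _
    simp only [Finset.mem_filter, Finset.mem_univ, true_and, Finset.mem_erase] at hu ⊢
    refine ⟨?_, hu.trans_le (hle u)⟩
    rintro rfl
    omega
  simp only [Mem.pot]
  omega

lemma weight_le_sum (hl : l.Nodup) : weight L l ≤ ∑ v, ((L v).length + 1) := by
  rw [weight, ← List.sum_toFinset _ hl]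
  exact Finset.sum_le_sum_of_subset (Finset.subset_univ _)

lemma Mem.pot_init (hc : ∀ u, m.cnt u ≤ (L u).length) (hcur : m.cur = 0) (hs : ∀ j, m.stk j = []) :
    (m.push [r]).pot L ≤ 372 * ∑ v, ((L v).length + 1) := by
  have h0 := weight_le_sum (L := L) (List.nodup_singleton r)
  have h1 := Mem.push_cur_le hc [r]
  have h2 := Mem.height_push_le hc [r]
  have h3 := Mem.weight_push_le (L := L) (m := m) [r]
  have h4 : m.height L = 0 := by simp [Mem.height, hs]
  have h5 : (m.push [r]).outside L ≤ ∑ v, ((L v).length + 1) :=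
    Finset.sum_le_sum_of_subset (Finset.subset_univ _)
  have h6 : (m.push [r]).active L ≤ ∑ v, ((L v).length + 1) :=
    Finset.sum_le_sum_of_subset (Finset.subset_univ _)
  have h7 : weight L (m.stk 1) = 0 := by simp [weight, hs]
  simp only [Mem.pot]
  omega

end RAM

/-! ### The main loop and its running time -/

namespace RAM

open Branching

/-! ### The main loop -/

variable {n : ℕ} {G : SimpleGraph (Fin n)} {L : Fin n → List (Fin n)} {m : Mem n}
  {σ : State (Fin n)} {r v x : Fin n} {l : List (Fin n)} {s : Store}

/-- Expand the vertex in register `16`. -/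
def expandProg : Prog := .seq (block [.copy 7 4, .copy 8 16]) (.seq addNbrs processNew)

lemma runs_expandProg (h : Rep L m s) (hv : s.reg 16 = v) (hnd : ∀ u, (L u).Nodup)
    (hc : ∀ u, m.cnt u ≤ (L u).length) :
    Runs expandProg s (17 * (L v).length + 22 * weight L (m.new L v) + 17)
      (Rep L (m.expand L v)) := by
  refine Runs.mono (c := 3 + (17 * (L v).length + 10 + (22 * weight L (m.new L v) + 4))) ?_
    (by omega) fun _ h => h
  refine Runs.seq (Runs.block _ (Runs.seq ?_))
  have h1 := (h.setReg (x := 7) (k := s.reg 4) (by norm_num)).setReg (x := 8) (k := s.reg 16)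
    (by norm_num)
  have h8 : ((s.setReg 7 (s.reg 4)).setReg 8 (s.reg 16)).reg 8 = v := by
    simp [Store.setReg_reg, hv]
  refine (runs_addNbrs h1 h8 (hnd v)).mono le_rfl ?_
  rintro s' ⟨h2, h3⟩
  refine runs_processNew h2 (pre := m.ord) (new := m.new L v) rfl ?_ hnd hc
  rw [h3]
  simp [Store.setReg_reg, h.top]

/-- Set register `18` to `0` if the only neighbour outside the tree of the vertex in register `16`
has degree `2` and a neighbour outside the tree. -/
def testDoomed : Prog :=
  .seq (.instr (.copy 8 16))
    (.seq (forNbr (.seq (.instr (.load 14 3 11)) (.cond (.eq 14 2) (.instr (.copy 17 11)) .skip)))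
      (.seq (block [.load 12 4 17, .load 13 8 17])
        (.cond (.eq 12 1) (.cond (.eq 13 1) (.instr (.const 18 0)) .skip) .skip)))

lemma runs_testDoomed (h : Rep L m s) (hv : s.reg 16 = v) (h18 : s.reg 18 = 1)
    (hx : ∀ w, w ∈ nbrs L v ∧ w ∉ m.tree ↔ w = x) :
    Runs testDoomed s (13 * (L v).length + 17) (fun s' => Rep L m s' ∧ s'.reg 16 = v ∧
      s'.reg 18 = if m.cnt x = 1 ∧ (L x).length = 2 then 0 else 1) := by
  refine Runs.mono (c := 1 + ((3 + 10) * (L v).length + 10 + (3 + (2 + 1)))) ?_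
    (by omega) fun _ h => h
  refine Runs.seq (Runs.instr (Runs.seq ?_))
  refine (runs_forNbr (c := 3) (v := v) (L := L) (I := fun l s' => Rep L m s' ∧ s'.reg 8 = v ∧
    s'.reg 16 = v ∧ s'.reg 18 = 1 ∧ (x ∈ l → s'.reg 17 = x)) ?_ ?_ ?_ ?_).mono le_rfl ?_
  · rintro l s s' ⟨h1, h2, h3, h4, h5⟩ ha hr
    refine ⟨h1.congr ha fun x hx => hr x (by omega), ?_, ?_, ?_, ?_⟩
    · rw [hr _ (by norm_num), h2]
    · rw [hr _ (by norm_num), h3]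
    · rw [hr _ (by norm_num), h4]
    · rw [hr _ (by norm_num)]; exact h5
  · exact fun l s ⟨h1, h2, _⟩ => ⟨h2, _, h1⟩
  · rintro done w rest s' hsplit ⟨h1, h2, h3, h4, h5⟩ h11
    have hw : w ∈ nbrs L v := by simp [hsplit]
    refine (Runs.seq (Runs.instr (Runs.cond (c := 1) (fun hb => Runs.instr ?_) fun hb =>
      Runs.skip ?_))).mono (c := 1 + (1 + 1)) (by norm_num) fun _ h => h
    all_goals
      simp only [Test.holds, Instr.run, Store.setReg_reg, if_true, Nat.reduceEqDiff, if_false,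
        h11, h1.tree, h1.zero] at hb ⊢
    · have hwt : w ∉ m.tree := by simpa using hb
      have hwx := (hx w).1 ⟨hw, hwt⟩
      refine ⟨⟨(h1.setReg (by norm_num)).setReg (by norm_num), h2, h3, h4, fun _ => ?_⟩,
        trivial, trivial⟩
      rw [hwx]
    · have hwt : w ∈ m.tree := by simpa using hb
      refine ⟨⟨h1.setReg (by norm_num), h2, h3, h4, fun hd => h5 ?_⟩, trivial, trivial⟩
      rw [List.mem_append, List.mem_singleton] at hd
      refine hd.resolve_right ?_
      rintro rfl
      exact ((hx x).2 rfl).2 hwt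
  · refine ⟨h.setReg (by norm_num), ?_, ?_, ?_, by simp⟩ <;>
      simp [Instr.run, Store.setReg_reg, hv, h18]
  · rintro s' ⟨h1, h2, h3, h4, h5⟩
    have h17 := h5 ((hx x).2 rfl).1
    refine Runs.seq (Runs.block _ ?_)
    simp only [List.foldl_cons, List.foldl_nil, Instr.run, Store.setReg_arr, Store.setReg_reg,
      Nat.reduceEqDiff, if_false, h17, h1.cnt, h1.two]
    have h6 := (h1.setReg (x := 12) (k := m.cnt x) (by norm_num)).setReg (x := 13)
      (k := if (L x).length = 2 then 1 else 0) (by norm_num)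
    refine Runs.cond (fun hb => Runs.cond (c := 1) (fun hb' => Runs.instr ?_) fun hb' =>
      Runs.skip ?_) fun hb => (Runs.skip ?_).mono (by norm_num) fun _ h => h
    all_goals
      simp only [Test.holds, Instr.run, Store.setReg_reg, if_true, Nat.reduceEqDiff, if_false,
        h1.one] at *
    · have hb' : (L x).length = 2 := by simpa using hb'
      exact ⟨h6.setReg (by norm_num), h3, by simp [hb, hb']⟩
    · have hb' : (L x).length ≠ 2 := by simpa using hb'
      exact ⟨h6, h3, by simp [hb', h4]⟩
    · exact ⟨h6, h3, by simp [hb, h4]⟩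

/-- Decide whether the vertex in register `16` is to be expanded. -/
def testProg : Prog :=
  .cond (.lt 14 3) (.instr (.const 18 0)) (.cond (.eq 3 1) testDoomed .skip)

lemma runs_testProg (h : Rep L m s) (hv : s.reg 16 = v) (h18 : s.reg 18 = 1)
    (h14 : s.reg 14 = m.cnt v)
    (hx : m.cur = 1 → m.cur ≤ m.cnt v → ∀ w, w ∈ nbrs L v ∧ w ∉ m.tree ↔ w = x) :
    Runs testProg s ((if m.cur = 1 then 13 * (L v).length + 17 else 1) + 1 + 1) (fun s' =>
      Rep L m s' ∧ s'.reg 16 = v ∧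
      s'.reg 18 = if m.cnt v < m.cur ∨ (m.cur = 1 ∧ m.cnt x = 1 ∧ (L x).length = 2) then 0
        else 1) := by
  refine Runs.cond (fun hb => (Runs.instr ?_).mono (by omega) fun _ h => h) fun hb =>
    Runs.cond (fun hb' => ?_) fun hb' => (Runs.skip ?_).mono (by split_ifs <;> omega) fun _ h => h
  all_goals simp only [Test.holds, h14, h.cur, h.one] at *
  · refine ⟨h.setReg (by norm_num), ?_, ?_⟩ <;> simp [Instr.run, Store.setReg_reg, hv, hb]
  · rw [if_pos hb']
    refine (runs_testDoomed h hv h18 (hx hb' (not_lt.1 hb))).mono le_rfl ?_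
    rintro s' ⟨h1, h2, h3⟩
    exact ⟨h1, h2, by rw [h3]; exact if_congr (by tauto) rfl rfl⟩
  · exact ⟨h, hv, by simp [hb, hb', h18]⟩

/-- The body of the main loop: treat the first vertex of the stack of the current level. -/
def mainBody : Prog :=
  .seq (.instr (.load 19 5 3))
    (.cond (.eq 19 2) (.instr (.pred 3))
      (.seq (block [.load 16 7 19, .load 12 6 19, .store 5 3 12, .load 14 4 16, .const 18 1])
        (.seq testProg (.cond (.eq 18 1) expandProg .skip))))

lemma runs_mainBody_nil (h : Rep L m s) (hs : m.stk m.cur = []) :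
    Runs mainBody s 3 (Rep L { m with cur := m.cur - 1 }) := by
  have hc := h.stk m.cur
  rw [hs] at hc
  have hc : s.arr 5 m.cur = 0 := hc
  refine Runs.seq (c := 1) (c' := 2) (Runs.instr (Runs.cond (fun hb => Runs.instr ?_) fun hb => ?_))
  · have := (h.setReg (x := 19) (k := s.arr 5 (s.reg 3)) (by norm_num)).setCur (m.cur - 1)
    simp only [Instr.run, Store.setReg_reg, Nat.reduceEqDiff, if_false, h.cur] at this ⊢
    exact this
  · simp [Test.holds, Instr.run, Store.setReg_reg, h.cur, h.zero, hc] at hb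

lemma runs_mainBody_cons (h : Rep L m s) (hs : m.stk m.cur = v :: l) (hnd : ∀ u, (L u).Nodup)
    (hc : ∀ u, m.cnt u ≤ (L u).length)
    (hx : m.cur = 1 → m.cur ≤ m.cnt v → ∀ w, w ∈ nbrs L v ∧ w ∉ m.tree ↔ w = x) :
    if m.cnt v < m.cur ∨ (m.cur = 1 ∧ m.cnt x = 1 ∧ (L x).length = 2) then
      Runs mainBody s ((if m.cur = 1 then 13 * (L v).length + 17 else 1) + 12)
        (Rep L (m.setStk l))
    else Runs mainBody s ((if m.cur = 1 then 13 * (L v).length + 17 else 1) +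
        (17 * (L v).length + 22 * weight L (m.new L v) + 17) + 11)
      (Rep L ((m.setStk l).expand L v)) := by
  have hch := h.stk m.cur
  rw [hs] at hch
  obtain ⟨p1, p2, p3, -⟩ := hch
  have key : ∀ c Q, (∀ s', Rep L (m.setStk l) s' → s'.reg 16 = v → (s'.reg 18 =
      if m.cnt v < m.cur ∨ (m.cur = 1 ∧ m.cnt x = 1 ∧ (L x).length = 2) then 0 else 1) →
      Runs (.cond (.eq 18 1) expandProg .skip) s' c Q) →
      Runs mainBody s
        (1 + (6 + ((if m.cur = 1 then 13 * (L v).length + 17 else 1) + 1 + 1 + c) + 1)) Q := by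
    intro c Q hQ
    refine Runs.seq (Runs.instr (Runs.cond (fun hb => ?_) fun hb => ?_))
    · exfalso
      simp only [Test.holds, Instr.run, Store.setReg_reg, Nat.reduceEqDiff, if_true, if_false,
        h.cur, h.zero] at hb
      omega
    · refine Runs.seq (Runs.block _ ?_)
      simp only [List.foldl_cons, List.foldl_nil, Instr.run, Store.setReg_arr, Store.setReg_reg,
        Store.setArr_arr, Store.setArr_reg, Nat.reduceEqDiff, if_true, if_false, h.cur, p3, h.cnt]
      have h1 : Rep L (m.setStk l) _ := ((h.pop hs).setReg (x := 19) (k := s.arr 5 m.cur)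
        (by norm_num)).setReg (x := 16) (k := v) (by norm_num)
      have h2 := ((h1.setReg (x := 12) (k := s.arr 6 (s.arr 5 m.cur)) (by norm_num)).setReg
        (x := 14) (k := m.cnt v) (by norm_num)).setReg (x := 18) (k := 1) (by norm_num)
      refine Runs.seq ?_
      refine (runs_testProg (m := m.setStk l) (v := v) (x := x) ?_ ?_ ?_ ?_ hx).mono le_rfl ?_
      · exact h2
      · simp [Store.setReg_reg, Store.setArr_reg]
      · simp [Store.setReg_reg]
      · simp [Store.setReg_reg, Mem.setStk]
      · rintro s' ⟨h3, h4, h5⟩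
        exact hQ s' h3 h4 h5
  by_cases ht : m.cnt v < m.cur ∨ (m.cur = 1 ∧ m.cnt x = 1 ∧ (L x).length = 2)
  · rw [if_pos ht]
    refine (key 2 _ fun s' h1 h2 h3 => ?_).mono (by omega) fun _ h => h
    refine Runs.cond (fun hb => ?_) fun hb => Runs.skip h1
    simp only [Test.holds, h3, h1.one, if_pos ht] at hb
    omega
  · rw [if_neg ht]
    refine (key (17 * (L v).length + 22 * weight L (m.new L v) + 17 + 1) _ fun s' h1 h2 h3 =>
      ?_).mono (by omega) fun _ h => h
    refine Runs.cond (fun hb => ?_) fun hb => ?_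
    · exact runs_expandProg h1 h2 hnd hc
    · rw [if_neg ht] at h3
      exact absurd (h3.trans h1.one.symm) hb

lemma runs_mainLoop (hL : IsAdjLists G L) (h : Rep L m s) (hI : Inv (simplify G) L r m σ)
    (hcur : m.cur ≤ ∑ v, (L v).length) : Runs (.loop (.lt 2 3) mainBody) s (m.pot L + 1)
      (fun s' => ∃ m σ, Rep L m s' ∧ Inv (simplify G) L r m σ ∧ m.cur = 0) := by
  have hnd : ∀ u, (L u).Nodup := fun u => (hL u).1
  have hN := hL.mem_nbrs
  have hnd' := hL.nodup_nbrs
  have hcnt : ∀ {m σ}, Inv (simplify G) L r m σ → ∀ u, m.cnt u ≤ (L u).length := by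
    intro m σ hI u
    rw [hI.cnt, hL.length_eq]
    exact Set.ncard_le_ncard (fun z hz => hz.1.1) (Set.toFinite _)
  refine (Runs.loop (I := fun k s => ∃ m σ, Rep L m s ∧ Inv (simplify G) L r m σ ∧
    m.cur ≤ ∑ v, (L v).length ∧ k = m.pot L) ?_ (m.pot L) s ⟨m, σ, h, hI, hcur, rfl⟩).mono
    le_rfl ?_
  · rintro k s ⟨m, σ, h, hI, hcur, rfl⟩ hb
    have hpos : 0 < m.cur := by
      have : s.reg 2 < s.reg 3 := hb
      rwa [h.cur, h.zero] at this
    rcases hs : m.stk m.cur with _ | ⟨v, l⟩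
    · refine ⟨3, (runs_mainBody_nil h hs).mono le_rfl fun s' h' => ⟨_, ⟨_, σ, h', hI.pred hs,
        ?_, rfl⟩, ?_⟩⟩
      · exact (Nat.sub_le _ _).trans hcur
      · have := Mem.pot_pred (L := L) hpos
        omega
    · have hvT : v ∈ σ.verts := hI.mem m.cur v (by simp [hs])
      have hpot := Mem.pot_setStk hs hcur
      obtain ⟨x, hx⟩ : ∃ x, m.cur = 1 → m.cur ≤ m.cnt v → outer (simplify G) σ v = {x} := by
        by_cases h1 : m.cur = 1 ∧ m.cur ≤ m.cnt v
        · have h2 := (hI.noO1 h1.1.le).ncard_le hvT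
          have h3 := h1.2
          rw [hI.cnt, h1.1] at h3
          obtain ⟨x, hx⟩ := Set.ncard_eq_one.1 (le_antisymm h2 h3)
          exact ⟨x, fun _ _ => hx⟩
        -- An arbitrary value: x plays a role only when the doom test is run at level 1.
        · exact ⟨v, fun h2 h3 => absurd ⟨h2, h3⟩ h1⟩
      have hx' : m.cur = 1 → m.cur ≤ m.cnt v → ∀ w, w ∈ nbrs L v ∧ w ∉ m.tree ↔ w = x := by
        intro h1 h2 w
        rw [hN, hI.tree, ← mem_outer, hx h1 h2]
        rfl
      have hrun := runs_mainBody_cons h hs hnd (hcnt hI) hx'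
      by_cases ht : m.cnt v < m.cur ∨ (m.cur = 1 ∧ m.cnt x = 1 ∧ (L x).length = 2)
      · rw [if_pos ht] at hrun
        refine ⟨_, hrun.mono le_rfl fun s' h' => ⟨_, ⟨_, σ, h', hI.pop hs ?_ ?_, hcur, rfl⟩, ?_⟩⟩
        · intro h2
          exact ht.resolve_right (by omega)
        · intro h1
          by_cases h2 : m.cnt v < m.cur
          · left
            rw [hI.cnt, h1, Nat.lt_one_iff] at h2
            exact (Set.ncard_eq_zero (Set.toFinite _)).1 h2
          · have h3 := ht.resolve_left h2
            refine doomed_of_test (hx h1 (not_lt.1 h2)) hvT ?_ ?_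
            · rw [← hI.cnt]; exact h3.2.1
            · rw [← hL.length_eq]; exact h3.2.2
        · split_ifs at hpot ⊢ <;> omega
      · rw [if_neg ht] at hrun
        rw [not_or, not_lt] at ht
        have hreach : Reached (simplify G) r (Branching.expand (simplify G) σ v) := by
          by_cases h1 : m.cur = 1
          · refine hI.reached_of_eq_one hs h1 (O2_or_O3_of_test (hx h1 ht.1) hvT ?_)
            rw [← hI.cnt, ← hL.length_eq]
            exact fun h2 => ht.2 ⟨h1, h2⟩
          · exact hI.reached_of_two_le hs (by omega) ht.1
        have hI' := hI.expand hN hnd' hs hreach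
        have hpot' := Mem.pot_expand (m := m.setStk l) (v := v) hnd'
          (show ∀ u, m.cnt u ≤ (L u).length from hcnt hI) (hpos.trans_le ht.1)
          (by rw [hI'.cnt, outer_expand_self]; simp)
        refine ⟨_, hrun.mono le_rfl fun s' h' => ⟨_, ⟨_, _, h', hI', ?_, rfl⟩, ?_⟩⟩
        · exact Mem.push_cur_le_sum (m := ((m.setStk l).add v (nbrs L v)).decr L
            ((m.setStk l).new L v)) (fun u => (Nat.sub_le _ _).trans (hcnt hI u)) _ hcur
        · change _ + 22 * weight L (m.new L v) ≤ _ at hpot'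
          split_ifs at hpot ⊢ <;> omega
  · rintro s' ⟨⟨k, m, σ, h1, h2, -, -⟩, h4⟩
    refine ⟨m, σ, h1, h2, ?_⟩
    have : ¬ s'.reg 2 < s'.reg 3 := h4
    rw [h1.cur, h1.zero] at this
    omega

end RAM

/-! ### Initialization, the whole program and its output -/

namespace RAM

open Branching

/-! ### The initialization and the whole program -/

variable {n : ℕ} {G : SimpleGraph (Fin n)} {L : Fin n → List (Fin n)} {m : Mem n}
  {σ : State (Fin n)} {r v x : Fin n} {l : List (Fin n)} {s : Store}

/-- Execute `body` for each vertex, in register `6`. -/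
def forVert (body : Prog) : Prog := .loop (.lt 6 0) (.seq body (.instr (.succ 6)))

lemma runs_forVert {body : Prog} {c : Fin n → ℕ} {I : ℕ → Store → Prop}
    (hstab : ∀ i s s', I i s → s'.arr = s.arr → (∀ x, x ≠ 6 → s'.reg x = s.reg x) → I i s')
    (hsize : ∀ i s, I i s → s.reg 0 = n)
    (hbody : ∀ (v : Fin n) s, I v s → s.reg 6 = v →
      Runs body s (c v) (fun s' => I (v + 1) s' ∧ s'.reg 6 = s.reg 6))
    (h0 : I 0 s) (h6 : s.reg 6 = 0) : Runs (forVert body) s (∑ v, (c v + 2) + 1) (I n) := by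
  have hsum : ∀ v : Fin n, ∑ w ∈ Finset.univ.filter (fun w : Fin n => (v : ℕ) ≤ w), (c w + 2) =
      c v + 2 + ∑ w ∈ Finset.univ.filter (fun w : Fin n => (v : ℕ) + 1 ≤ w), (c w + 2) := by
    intro v
    rw [← Finset.add_sum_erase _ _ (show v ∈ Finset.univ.filter (fun w : Fin n => (v : ℕ) ≤ w) by
      simp)]
    congr 1
    refine Finset.sum_congr ?_ fun _ _ => rfl
    ext w
    simp only [Finset.mem_erase, Finset.mem_filter, Finset.mem_univ, true_and, ne_eq, Fin.ext_iff]
    omega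
  refine (Runs.loop (I := fun k s => ∃ i ≤ n, I i s ∧ s.reg 6 = i ∧
    k = ∑ w ∈ Finset.univ.filter (fun w : Fin n => i ≤ w), (c w + 2)) ?_ _ s
    ⟨0, Nat.zero_le n, h0, h6, rfl⟩).mono (by simp) ?_
  · rintro k s ⟨i, hi, hI, h6, rfl⟩ hb
    have hi : i < n := by
      have hb : s.reg 6 < s.reg 0 := hb
      rwa [h6, hsize i s hI] at hb
    refine ⟨c ⟨i, hi⟩ + 1, Runs.seq ((hbody ⟨i, hi⟩ s hI h6).mono le_rfl ?_)⟩
    rintro s' ⟨h1, h2⟩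
    refine Runs.instr ⟨_, ⟨i + 1, hi, hstab _ _ _ h1 rfl fun x hx => ?_, ?_, rfl⟩, ?_⟩
    · simp [Instr.run, Store.setReg_reg, hx]
    · simp [Instr.run, Store.setReg_reg, h2, h6]
    · have := hsum ⟨i, hi⟩
      simp only at this
      omega
  · rintro s' ⟨⟨k, i, hi, hI, h6, -⟩, hb⟩
    have hb : ¬ s'.reg 6 < s'.reg 0 := hb
    rw [h6, hsize i s' hI] at hb
    have : i = n := by omega
    exact this ▸ hI

/-- Mark the vertices of degree `2`. -/
def markTwo : Prog :=
  .seq (block [.load 12 0 6, .succ 12, .succ 12, .copy 13 6, .succ 13, .load 13 0 13])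
    (.cond (.eq 12 13) (.instr (.store 8 6 1)) .skip)

/-- The data before the root is added. -/
def Mem.empty (n : ℕ) : Mem n := ⟨∅, fun _ => 0, fun _ => 0, fun _ => [], 0, []⟩

lemma runs_forVert_markTwo (hr0 : s.reg 0 = n) (hr1 : s.reg 1 = 1) (hr2 : s.reg 2 = 0)
    (hr3 : s.reg 3 = 0) (hr4 : s.reg 4 = 0) (hr5 : s.reg 5 = 1) (hr6 : s.reg 6 = 0)
    (ha : s.arr = (inputStore L).arr) :
    Runs (forVert markTwo) s (11 * n + 1) (Rep L (Mem.empty n)) := by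
  refine (runs_forVert (n := n) (c := fun _ => 9) (I := fun i s' =>
    (∀ x < 6, s'.reg x = s.reg x) ∧ (∀ a, a ≠ 8 → s'.arr a = s.arr a) ∧
    ∀ v : Fin n, s'.arr 8 v = if v < i ∧ (L v).length = 2 then 1 else 0) ?_ ?_ ?_ ?_ hr6).mono
    (by simp; omega) ?_
  · rintro i s₁ s₂ ⟨h1, h2, h3⟩ ha hr
    exact ⟨fun x hx => by rw [hr x (by omega), h1 x hx], fun a h => by rw [ha, h2 a h],
      fun v => by rw [ha, h3]⟩
  · rintro i s₁ ⟨h1, -⟩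
    rw [h1 0 (by norm_num), hr0]
  · rintro v s₁ ⟨h1, h2, h3⟩ h6
    refine (Runs.seq (c := 7) (c' := 2) (Runs.block _ ?_))
    have h0 : s₁.arr 0 = (inputStore L).arr 0 := by rw [h2 0 (by norm_num), ha]
    simp only [List.foldl_cons, List.foldl_nil, Instr.run, Store.setReg_arr, Store.setReg_reg,
      Nat.reduceEqDiff, if_true, if_false, h6, h0, inputStore_arr_zero_succ]
    refine Runs.cond (c := 1) (fun hb => Runs.instr ?_) fun hb => Runs.skip ?_
    · have hlen : (L v).length = 2 := by
        simp only [Test.holds, Store.setReg_reg, Nat.reduceEqDiff, if_true, if_false] at hb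
        omega
      refine ⟨⟨fun x hx => ?_, fun a h => ?_, fun w => ?_⟩, ?_⟩
      · simp only [Instr.run, Store.setArr_reg, Store.setReg_reg]
        rw [if_neg (by omega), if_neg (by omega), if_neg (by omega), if_neg (by omega),
          if_neg (by omega), if_neg (by omega), h1 x hx]
      · simp only [Instr.run, Store.setArr_arr, Store.setReg_arr, if_neg h, h2 a h]
      · simp only [Instr.run, Store.setArr_arr, Store.setReg_arr, Store.setReg_reg,
          Nat.reduceEqDiff, if_true, if_false, h6, h1 1 (by norm_num), hr1, update_fin, h3]
        by_cases hw : w = v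
        · subst hw; simp [hlen]
        · have : (w : ℕ) ≠ v := fun h => hw (Fin.ext h)
          rw [if_neg hw]
          refine if_congr ?_ rfl rfl
          have : (w : ℕ) < v ↔ (w : ℕ) < v + 1 := by omega
          rw [this]
      · simp [Instr.run, Store.setArr_reg, Store.setReg_reg, h6]
    · have hlen : (L v).length ≠ 2 := by
        simp only [Test.holds, Store.setReg_reg, Nat.reduceEqDiff, if_true, if_false] at hb
        omega
      refine ⟨⟨fun x hx => ?_, fun a h => h2 a h, fun w => ?_⟩, ?_⟩
      · simp only [Store.setReg_reg]
        rw [if_neg (by omega), if_neg (by omega), if_neg (by omega), if_neg (by omega),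
          if_neg (by omega), if_neg (by omega), h1 x hx]
      · simp only [Store.setReg_arr, h3]
        refine if_congr ?_ rfl rfl
        by_cases hw : w = v
        · subst hw; simp [hlen]
        · have : (w : ℕ) ≠ v := fun h => hw (Fin.ext h)
          have : (w : ℕ) < v ↔ (w : ℕ) < v + 1 := by omega
          rw [this]
      · simp [Store.setReg_reg, h6]
  · refine ⟨fun _ _ => rfl, fun _ _ => rfl, fun v => ?_⟩
    simp [ha, inputStore]
  · rintro s' ⟨h1, h2, h3⟩
    have harr : ∀ a, 2 ≤ a → a ≠ 8 → ∀ i, s'.arr a i = 0 := by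
      intro a ha2 ha8 i
      rw [h2 a ha8, ha]
      simp [inputStore, show a ≠ 0 by omega, show a ≠ 1 by omega]
    refine ⟨?_, ?_, ?_, ?_, ?_, ?_, ?_, ?_, ?_, ?_, ?_, ?_, ?_, ?_⟩
    · rw [h1 0 (by norm_num), hr0]
    · rw [h1 1 (by norm_num), hr1]
    · rw [h1 2 (by norm_num), hr2]
    · rw [h1 3 (by norm_num), hr3]; rfl
    · rw [h1 4 (by norm_num), hr4]; rfl
    · rw [h1 5 (by norm_num), hr5]; norm_num
    · rw [h2 0 (by norm_num), ha]
    · rw [h2 1 (by norm_num), ha]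
    · intro v; rw [harr 2 (by norm_num) (by norm_num)]; rfl
    · intro v; rw [harr 3 (by norm_num) (by norm_num)]; simp [Mem.empty]
    · intro v; rw [harr 4 (by norm_num) (by norm_num)]; rfl
    · intro j
      exact harr 5 (by norm_num) (by norm_num) j
    · intro v
      rw [h3]
      simp
    · intro i hi
      simp [Mem.empty] at hi

/-- Count the neighbours of the vertex in register `6`. -/
def countNbrs : Prog :=
  .seq (.instr (.copy 8 6)) (forNbr (block [.load 14 4 8, .succ 14, .store 4 8 14]))

lemma runs_countNbrs (h : Rep L m s) (h6 : s.reg 6 = v) (hv : m.cnt v = 0) :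
    Runs countNbrs s (14 * (L v).length + 11) (fun s' =>
      Rep L { m with cnt := Function.update m.cnt v (nbrs L v).length } s' ∧
        s'.reg 6 = s.reg 6) := by
  refine Runs.mono (c := 1 + ((4 + 10) * (L v).length + 10)) (Runs.seq (Runs.instr ?_)) (by omega)
    fun _ h => h
  refine (runs_forNbr (c := 4) (v := v) (L := L) (I := fun l s' =>
    Rep L { m with cnt := Function.update m.cnt v l.length } s' ∧
    s'.reg 8 = v ∧ s'.reg 6 = s.reg 6) ?_ ?_ ?_ ?_).mono le_rfl ?_
  · rintro l s s' ⟨h1, h2, h3⟩ ha hr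
    exact ⟨h1.congr ha fun x hx => hr x (by omega), by rw [hr _ (by norm_num), h2],
      by rw [hr _ (by norm_num), h3]⟩
  · exact fun l s ⟨h1, h2, _⟩ => ⟨h2, _, h1⟩
  · rintro done w rest s' hsplit ⟨h1, h2, h3⟩ h11
    refine Runs.block _ ?_
    simp only [List.foldl_cons, List.foldl_nil, Instr.run, Store.setReg_reg,
        Store.setArr_reg, Nat.reduceEqDiff, if_true, if_false, h2, h1.cnt, Function.update_self]
    refine ⟨⟨?_, ?_, ?_⟩, ?_, ?_⟩
    · have := (((h1.setReg (x := 14) (k := done.length) (by norm_num)).setReg (x := 14)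
        (k := done.length + 1) (by norm_num)).setCnt v (done.length + 1))
      simp only [Function.update_idem] at this
      simpa using this
    all_goals simp [h3]
  · refine ⟨?_, ?_, ?_⟩
    · have h1 : Function.update m.cnt v ([] : List (Fin n)).length = m.cnt := by
        rw [List.length_nil, ← hv, Function.update_eq_self]
      rw [h1]
      exact h.setReg (by norm_num)
    · simp [Instr.run, Store.setReg_reg, h6]
    · simp [Instr.run, Store.setReg_reg]
  · exact fun s' ⟨h1, _, h3⟩ => ⟨h1, h3⟩

/-- The data with the root `r`, before its stacks are filled. -/
def Mem.root (L : Fin n → List (Fin n)) (r : Fin n) : Mem n :=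
  ⟨{r}, fun _ => 0, fun v => (nbrs L v).length, fun _ => [], 0, [r]⟩

lemma runs_forVert_countNbrs (h : Rep L (Mem.empty n) s) (h6 : s.reg 6 = 0) :
    Runs (forVert countNbrs) s (∑ v, (14 * (L v).length + 11 + 2) + 1)
      (Rep L { Mem.empty n with cnt := fun v => (nbrs L v).length }) := by
  refine (runs_forVert (c := fun v => 14 * (L v).length + 11) (I := fun i =>
    Rep L { Mem.empty n with cnt := fun v => if v < i then (nbrs L v).length else 0 }) ?_ ?_ ?_ ?_
    h6).mono le_rfl ?_
  · exact fun i s s' h1 ha hr => h1.congr ha fun x hx => hr x (by omega)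
  · exact fun i s h1 => h1.size
  · intro v s h1 h6
    refine (runs_countNbrs h1 h6 (by simp)).mono le_rfl ?_
    rintro s' ⟨h2, h3⟩
    refine ⟨?_, h3⟩
    convert h2 using 2
    funext w
    by_cases hw : w = v
    · subst hw; simp
    · have : (w : ℕ) ≠ v := fun h => hw (Fin.ext h)
      have : (w : ℕ) < v ↔ (w : ℕ) < v + 1 := by omega
      simp only [Function.update_of_ne hw, this]
  · simpa [Mem.empty] using h
  · intro s' h1
    simpa using h1

/-- The program. -/
def prog : Prog :=
  .seq (block [.const 1 1, .const 5 1])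
    (.seq (forVert markTwo)
      (.seq (.instr (.const 6 0))
        (.seq (forVert countNbrs)
          (.seq (block [.store 3 2 1, .store 9 4 2, .const 4 1, .const 7 0])
            (.seq processNew (.loop (.lt 2 3) mainBody))))))

lemma runs_prog (hL : IsAdjLists G L) (h0 : 0 < n) :
    Runs prog (inputStore L) (600 * ∑ v, ((L v).length + 1))
      (fun s' => ∃ m σ, Rep L m s' ∧ Inv (simplify G) L ⟨0, h0⟩ m σ ∧ m.cur = 0) := by
  -- The root is vertex 0 because memory is initially 0: the untouched entries of the output array
  -- already point to the root.
  set r : Fin n := ⟨0, h0⟩ with hr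
  set W := ∑ v, ((L v).length + 1) with hW
  have hnd : ∀ u, (L u).Nodup := fun u => (hL u).1
  have hWn : n ≤ W := by
    rw [hW, Finset.sum_add_distrib]; simp
  have hcost : ∑ v, (14 * (L v).length + 11 + 2) ≤ 14 * W := by
    rw [hW, Finset.mul_sum]
    exact Finset.sum_le_sum fun v _ => by omega
  have hcnt : ∀ u, (Mem.root L r).cnt u ≤ (L u).length := fun u => List.length_filter_le _ _
  have hcnt' : ∀ u, ((Mem.root L r).decr L [r]).cnt u ≤ (L u).length :=
    fun u => (Nat.sub_le _ _).trans (hcnt u)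
  have hw := weight_le_sum (L := L) (List.nodup_singleton r)
  have hpot := Mem.pot_init (L := L) (r := r) hcnt' rfl fun _ => rfl
  refine Runs.mono (c := 3 + (11 * n + 1 + (1 + (∑ v, (14 * (L v).length + 11 + 2) + 1 +
    (5 + ((22 * weight L [r] + 4) +
      ((((Mem.root L r).decr L [r]).push [r]).pot L + 1))))))) ?_ (by omega) fun _ h => h
  refine Runs.seq (Runs.block _ (Runs.seq ?_))
  have hmark : Runs (forVert markTwo) (((inputStore L).setReg 1 1).setReg 5 1) (11 * n + 1)
      (Rep L (Mem.empty n)) := by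
    refine runs_forVert_markTwo (L := L) ?_ ?_ ?_ ?_ ?_ ?_ ?_ rfl <;>
      simp [Store.setReg_reg, inputStore]
  refine hmark.mono le_rfl fun s₁ h₁ => ?_
  refine Runs.seq (Runs.instr (Runs.seq ?_))
  refine (runs_forVert_countNbrs (h₁.setReg (x := 6) (k := 0) (by norm_num))
    (by simp [Store.setReg_reg])).mono le_rfl fun s₂ h₂ => ?_
  refine Runs.seq (Runs.block _ (Runs.seq ?_))
  have h₃ := ((h₂.setTree r).pushOrd r).setReg (x := 7) (k := 0) (by norm_num)
  have e1 := h₂.one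
  have e2 := h₂.zero
  have e4 : s₂.reg 4 = 0 := h₂.top
  simp only [List.foldl_cons, List.foldl_nil, Instr.run, Store.setArr_reg,
    e1, e2, e4]
  refine (runs_processNew (m := Mem.root L r) (pre := []) (new := [r]) h₃ rfl ?_ hnd hcnt).mono
    le_rfl fun s₄ h₄ => ?_
  · simp [Store.setReg_reg]
  · exact runs_mainLoop hL h₄ (Inv.init hL.mem_nbrs hL.nodup_nbrs rfl (fun _ => rfl)
      (fun _ => rfl) fun _ => rfl) (Mem.push_cur_le_sum hcnt' _ (Nat.zero_le _))

lemma sum_length_eq (hL : IsAdjLists G L) : ∑ v, (L v).length = 2 * G.edgeSet.ncard := by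
  classical
  have h1 : ∀ v, (L v).length = G.degree v := by
    intro v
    rw [hL.length_eq, deg, Set.ncard_eq_toFinset_card', ← SimpleGraph.card_neighborFinset_eq_degree]
    rfl
  rw [Finset.sum_congr rfl fun v _ => h1 v, G.sum_degrees_eq_twice_card_edges,
    Set.ncard_eq_toFinset_card']
  rfl

/-- The simplified triangle has no edges, so the tree is just the root, and the default entries of
the output describe a star. Thus the program needs no special treatment of the triangle. -/
lemma Inv.par_eq_of_isTriangle (h : Inv (simplify G) L r m σ)
    (hG : IsTriangle G) (v : Fin n) : m.par v = r := by
  have hd : ∀ v, deg G v = 2 := by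
    intro v
    have : (⊤ : SimpleGraph (Fin n)).neighborSet v = {v}ᶜ := by ext w; simp [eq_comm]
    rw [deg, hG.2, this, Set.ncard_compl, Set.ncard_singleton, Nat.card_eq_fintype_card, hG.1]
  by_cases hv : v ∈ σ.verts
  · by_cases hvr : v = r
    · rw [h.par v hv, hvr, h.valid.root_parent]
    · exact absurd ⟨hd _, hd _⟩ (h.valid.parent_adj v hv hvr).2
  · exact h.par_out v hv

theorem exists_prog : ∃ (prog : Prog) (c : ℕ), ∀ (n : ℕ) (G : SimpleGraph (Fin n))
    (L : Fin n → List (Fin n)), G.Connected → NoTwoVertexSeparator G → IsAdjLists G L →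
      ∃ (s : Store) (t : ℕ) (p : Fin n → Fin n),
        Exec prog (inputStore L) s t ∧ t ≤ c * (n + G.edgeSet.ncard) ∧ Outputs s p ∧
        IsManyLeafTree G (parentGraph p) ∧
        (¬ IsTriangle G → ∃ r s', IsResult (simplify G) r s' ∧ s'.parent = p) := by
  -- The bound 600·(n + 2m) from `runs_prog` is at most 1200·(n + m).
  refine ⟨prog, 1200, fun n G L hconn hG hL => ?_⟩
  have h0 : 0 < n := Fin.pos_iff_nonempty.2 hconn.nonempty
  obtain ⟨s, t, h1, h2, m, σ, h3, h4, h5⟩ := runs_prog hL h0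
  have ht : t ≤ 1200 * (n + G.edgeSet.ncard) := by
    have h6 := sum_length_eq hL
    rw [Finset.sum_add_distrib, h6] at h2
    simp only [Finset.sum_const, Finset.card_univ, Fintype.card_fin, smul_eq_mul, mul_one] at h2
    omega
  by_cases htri : IsTriangle G
  · refine ⟨s, t, fun _ => ⟨0, h0⟩, h1, ht, fun v => ?_, isManyLeafTree_of_isTriangle htri _,
      fun h => absurd htri h⟩
    rw [h3.par, h4.par_eq_of_isTriangle htri]
  · have hres := h4.isResult h5
    refine ⟨s, t, σ.parent, h1, ht, fun v => ?_, isManyLeafTree hG htri hres,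
      fun _ => ⟨_, σ, hres, rfl⟩⟩
    rw [h3.par, h4.par v (by rw [verts_eq_univ hG htri hres]; trivial)]

end RAM

theorem mainTheorem2 :
    -- existence of the tree, and every execution of BRANCHING finds one
    (∀ (V : Type u) [Fintype V] (G : SimpleGraph V), G.Connected → NoTwoVertexSeparator G →
      (∃ T : SimpleGraph V, IsManyLeafTree G T) ∧
      (¬ IsTriangle G → ∀ r : V,
        (∃ s, Branching.IsResult (simplify G) r s) ∧
        ∀ s, Branching.IsResult (simplify G) r s → IsManyLeafTree G (parentGraph s.parent))) ∧
    -- linear time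
    (∃ (prog : RAM.Prog) (c : ℕ), ∀ (n : ℕ) (G : SimpleGraph (Fin n)) (L : Fin n → List (Fin n)),
      G.Connected → NoTwoVertexSeparator G → RAM.IsAdjLists G L →
      ∃ (s : RAM.Store) (t : ℕ) (p : Fin n → Fin n),
        RAM.Exec prog (RAM.inputStore L) s t ∧
        t ≤ c * (n + G.edgeSet.ncard) ∧
        RAM.Outputs s p ∧
        IsManyLeafTree G (parentGraph p) ∧
        (¬ IsTriangle G → ∃ r s', Branching.IsResult (simplify G) r s' ∧ s'.parent = p)) := by
  exact ⟨fun V _ G hconn hG => Branching.exists_and_forall_isManyLeafTree hconn hG,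
    RAM.exists_prog⟩
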